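/- **Setting.** Let $d\in\{2,3\}$, $m\in\mathbb N$, let $\Lambda^{\rm hom}=\mathsf A\mathbb Z^d$ with $\mathsf A\in\mathbb R^{d\times d}$ non-singular, and let $\Lambda\subset\Lambda^{\rm hom}$ be a reference configuration with $\Lambda\setminus B_{R^{\rm def}}=\Lambda^{\rm hom}\setminus B_{R^{\rm def}}$ for some $R^{\rm def}>0$. Every $\ell\in\Lambda$ has a finite interaction range $\mathcal R_\ell\subset\Lambda-\ell$ and a site potential $V_\ell\in C^3((\mathbb R^m)^{\mathcal R_\ell})$, and $\mathcal R_\ell=\mathcal R$, $V_\ell=V$ for $\ell\in\Lambda\setminus B_{R^{\rm def}}$, where $V\in C^3((\mathbb R^m)^{\mathcal R})$, $\mathcal R$ is finite, $\mathcal R=-\mathcal R$, ${\rm span}_{\mathbb Z}\mathcal R=\Lambda^{\rm hom}$ and $V((-g_{-\rho})_{\rho\in\mathcal R})=V(g)$ for all $g$. For $u:\Lambda\to\mathbb R^m$ put $D_\rho u(\ell)=u(\ell+\rho)-u(\ell)$ and $Du(\ell)=(D_\rho u(\ell))_{\rho\in\mathcal R_\ell}$; let $\dot{\mathcal W}^{1,2}$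 be the set of $u$ with $\sum_{\ell\in\Lambda}\sum_{\rho\in\mathcal R_\ell}|D_\rho u(\ell)|^2<\infty$. Let $\langle H(u)v,w\rangle=\sum_{\ell\in\Lambda}\nabla^2V_\ell(Du(\ell))[Dv(\ell),Dw(\ell)]$. Assume that the homogeneous crystal is stable: there is $c_0>0$ with $$\sum_{\ell\in\Lambda^{\rm hom}}\nabla^2V(0)[Dv(\ell),Dv(\ell)]\ge c_0\sum_{\ell\in\Lambda^{\rm hom}}\sum_{\rho\in\mathcal R}|D_\rho v(\ell)|^2$$ for all finitely supported $v:\Lambda^{\rm hom}\to\mathbb R^m$ (here $Dv(\ell)=(D_\rho v(\ell))_{\rho\in\mathcal R}$). Let $\mathcal B=\pi\mathsf A^{-T}(-1,1)^d$, let $\hat h(k)\in\mathbb C^{m\times m}$ be the symbol $$\hat h(k)_{ij}=\sum_{\rho,\sigma\in\mathcal R}\frac{\partial^2V(0)}{\partial g_{\rho i}\,\partial g_{\sigma j}}\,(e^{-ik\cdot\rho}-1)(e^{ik\cdot\sigma}-1),$$ and let $$F(x)=\frac1{|\mathcal B|}\int_{\mathcal B}e^{-ik\cdot x}\,\hat h(k)^{-1/2}\,dk\quad(x\in\Lambda^{\rm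 hom}),\qquad (\mathbf Fv)(\ell)=\sum_{n\in\Lambda}\big(F(\ell-n)-F(-n)\big)v(n)$$ for $v\in\ell^2(\Lambda;\mathbb C^m)$, $\ell\in\Lambda$. The operator $\mathbf F^*H(u)\mathbf F$ on $\ell^2(\Lambda;\mathbb C^m)$ is the bounded operator $T$ with $\langle v,Tw\rangle=\langle H(u)\mathbf Fv,\mathbf Fw\rangle$ for all $v,w$ (with $H(u)$ extended sesquilinearly). Fix $0<\underline\sigma<\overline\sigma$. Let $\mathcal U$ be the set of $u\in\dot{\mathcal W}^{1,2}$ with $\sigma(\mathbf F^*H(u)\mathbf F)\cap(0,\infty)\subset[\underline\sigma,\overline\sigma]$, and let $\mathcal C$ be the positively oriented circle with centre $(\underline\sigma+\overline\sigma)/2$ and radius $\overline\sigma/2$, which encircles $[\underline\sigma,\overline\sigma]$ in the open right half-plane. For $u\in\mathcal U$ the site entropy at $\ell\in\Lambda$ is $$\mathcal S_\ell(u)=-\tfrac12\,{\rm Trace}\big[\log^+(\mathbf F^*H(u)\mathbf F)\big]_{\ell\ell},\qquad \log^+T=\frac1{2\pi i}\oint_{\mathcal C}\log(z)\,(zI-T)^{-1}\,dz,$$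 where $[\,\cdot\,]_{\ell\ell}$ is the $m\times m$ diagonal block of the site $\ell$. For $r_{\rm cut}>0$ let $T_{r_{\rm cut}}u$ be equal to $u$ on $\Lambda\cap B_{r_{\rm cut}}(\ell)$ and zero elsewhere, and let $\widetilde{\mathcal S}_\ell(u;r_{\rm cut})=\mathcal S_\ell(T_{r_{\rm cut}}u)$ be the truncated site entropy, defined when $T_{r_{\rm cut}}u\in\mathcal U$. **Theorem.** These objects are well defined: $\hat h^{-1/2}$ is integrable on $\mathcal B$, the series for $(\mathbf Fv)(\ell)$ is summable for all $v\in\ell^2(\Lambda;\mathbb C^m)$ and $\ell\in\Lambda$, and the bounded operator $\mathbf F^*H(u)\mathbf F$ exists for every $u\in\dot{\mathcal W}^{1,2}$. Moreover there is a constant $C_3>0$, independent of $u$ and $\ell$, such that for every bounded $u\in\mathcal U$ there is $r_0>0$, independent of $\ell$, with $$\big|\mathcal S_\ell(u)-\widetilde{\mathcal S}_\ell(u;r_{\rm cut})\big|\le C_3\,r_{\rm cut}^{-d}\,\|u\|_\infty$$ for all $r_{\rm cut}\ge r_0$ and all $\ell\in\Lambda$ such that $T_{r_{\rm cut}}u\in\mathcal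 U$. -/

import Mathlib

open scoped Topology

noncomputable section

namespace SiteEntropy

/-- The physical space `ℝ^d` with the Euclidean norm. -/
abbrev Space (d : ℕ) : Type := EuclideanSpace ℝ (Fin d)

/-- Complex amplitudes `ℂ^m` with the Hermitian norm. -/
abbrev Amp (m : ℕ) : Type := EuclideanSpace ℂ (Fin m)

/-- The Bravais lattice `A ℤ^d`. -/
def bravais {d : ℕ} (A : Matrix (Fin d) (Fin d) ℝ) : Set (Space d) :=
  {x | ∃ z : Fin d → ℤ, x = WithLp.toLp 2 (A.mulVec fun i => (z i : ℝ))}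

/-- The displacement differences seen on a stencil `S`: elements of `(ℝ^m)^S`. -/
abbrev Stencil {d : ℕ} (m : ℕ) (S : Finset (Space d)) : Type := S → Space m

/-- The stencil `e_i` at `ρ`, zero elsewhere. -/
def basisStencil {d m : ℕ} {S : Finset (Space d)} (ρ : S) (i : Fin m) : Stencil m S :=
  fun τ => open Classical in if τ = ρ then EuclideanSpace.single i 1 else 0

/-- The second partial derivative `∂² W(g) / ∂g_{ρ i} ∂g_{σ j}` of a site potential. -/
def secondPartial {d m : ℕ} {S : Finset (Space d)} (W : Stencil m S → ℝ) (g : Stencil m S)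
    (ρ : S) (i : Fin m) (σ : S) (j : Fin m) : ℝ :=
  fderiv ℝ (fderiv ℝ W) g (basisStencil ρ i) (basisStencil σ j)

/-- The Hessian form `∇²W(g)[a, b]`, extended to complex arguments (conjugate linear in `a`,
linear in `b`). -/
def hessianForm {d m : ℕ} {S : Finset (Space d)} (W : Stencil m S → ℝ) (g : Stencil m S)
    (a b : S → Amp m) : ℂ :=
  ∑ ρ : S, ∑ σ : S, ∑ i : Fin m, ∑ j : Fin m,
    (secondPartial W g ρ i σ j : ℂ) * (starRingEnd ℂ (a ρ i) * b σ j)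

/-- A point defect in a Bravais lattice crystal, with finite-range site potentials. -/
structure Crystal (d m : ℕ) where
  /-- The matrix of the homogeneous lattice `A ℤ^d`. -/
  A : Matrix (Fin d) (Fin d) ℝ
  A_nonsingular : A.det ≠ 0
  /-- The reference configuration `Λ`. -/
  sites : Set (Space d)
  sites_subset : sites ⊆ bravais A
  /-- The radius of the defect core. -/
  Rdef : ℝ
  Rdef_pos : 0 < Rdef
  mem_sites : ∀ x ∈ bravais A, Rdef ≤ ‖x‖ → x ∈ sites
  /-- The homogeneous interaction range `R`. -/
  range : Finset (Space d)
  neg_mem_range : ∀ ρ ∈ range, -ρ ∈ range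
  span_range : (AddSubgroup.closure (range : Set (Space d)) : Set (Space d)) = bravais A
  /-- The homogeneous site potential `V`. -/
  V : Stencil m range → ℝ
  V_smooth : ContDiff ℝ 3 V
  /-- Point symmetry `V((-g_{-ρ})_ρ) = V(g)`. -/
  V_symm : ∀ g : Stencil m range, V (fun ρ => -g ⟨-ρ.1, neg_mem_range ρ.1 ρ.2⟩) = V g
  /-- The interaction range `R_ℓ` of the site `ℓ`. -/
  siteRange : sites → Finset (Space d)
  add_mem_sites : ∀ (l : sites), ∀ ρ ∈ siteRange l, l.1 + ρ ∈ sites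
  /-- The site potential `V_ℓ`. -/
  siteV : ∀ l : sites, Stencil m (siteRange l) → ℝ
  siteV_smooth : ∀ l : sites, ContDiff ℝ 3 (siteV l)
  /-- Outside the defect core, `R_ℓ = R` and `V_ℓ = V`. -/
  homogeneous : ∀ l : sites, Rdef ≤ ‖l.1‖ → ∃ h : range = siteRange l,
    ∀ g : Stencil m (siteRange l), siteV l g = V (fun ρ => g ⟨ρ.1, h ▸ ρ.2⟩)

namespace Crystal

variable {d m : ℕ} (M : Crystal d m)

/-- The finite difference stencil `Du(ℓ) = (u(ℓ + ρ) - u(ℓ))_{ρ ∈ R_ℓ}`. -/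
def diff {X : Type} [AddCommGroup X] (u : M.sites → X) (l : M.sites) :
    M.siteRange l → X :=
  fun ρ => u ⟨l.1 + ρ.1, M.add_mem_sites l ρ.1 ρ.2⟩ - u l

/-- Membership in the energy space `Ẇ^{1,2}`: `∑_ℓ ∑_{ρ ∈ R_ℓ} |D_ρ u(ℓ)|² < ∞`. -/
def FiniteEnergy (u : M.sites → Space m) : Prop :=
  Summable fun l : M.sites => ∑ ρ : M.siteRange l, ‖M.diff u l ρ‖ ^ 2

/-- Stability of the homogeneous crystal: `⟨H^hom v, v⟩ ≥ c ‖Dv‖²` on the lattice `A ℤ^d` for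
all finitely supported `v`. -/
def HomStable : Prop :=
  ∃ c : ℝ, 0 < c ∧ ∀ v : Space d → Space m, (Function.support v).Finite →
    c * ∑' l : bravais M.A, ∑ ρ : M.range, ‖v (l.1 + ρ.1) - v l.1‖ ^ 2 ≤
      ∑' l : bravais M.A, fderiv ℝ (fderiv ℝ M.V) 0
        (fun ρ => v (l.1 + ρ.1) - v l.1) (fun ρ => v (l.1 + ρ.1) - v l.1)

/-- The Brillouin zone `π A^{-T} (-1,1)^d`. -/
def brillouin : Set (Space d) :=
  {k | ∃ t : Fin d → ℝ, (∀ i, t i ∈ Set.Ioo (-1 : ℝ) 1) ∧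
    k = WithLp.toLp 2 (Real.pi • (M.A⁻¹.transpose.mulVec t))}

/-- The plane wave `e^{i k·x}`. -/
def planeWave (k x : Space d) : ℂ := Complex.exp (Complex.I * (inner ℝ k x : ℝ))

/-- The Fourier symbol of the homogeneous Hessian,
`ĥ(k)_{ij} = ∑_{ρ,σ} ∂²V(0)/∂g_{ρi}∂g_{σj} (e^{-ik·ρ} - 1) (e^{ik·σ} - 1)`. -/
def symbol (k : Space d) : Matrix (Fin m) (Fin m) ℂ :=
  Matrix.of fun i j => ∑ ρ : M.range, ∑ σ : M.range,
    (secondPartial M.V 0 ρ i σ j : ℂ) *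
      ((planeWave k (-ρ.1) - 1) * (planeWave k σ.1 - 1))

/-- `F̂(k) = ĥ(k)^{-1/2}`, by functional calculus of the Hermitian matrix `ĥ(k)`. -/
def symbolInvSqrt (k : Space d) : Amp m →L[ℂ] Amp m :=
  cfc (fun x : ℝ => x ^ (-(1 / 2) : ℝ)) (Matrix.toEuclideanCLM (𝕜 := ℂ) (M.symbol k))

/-- The kernel `F(x) = |B|⁻¹ ∫_B e^{-ik·x} F̂(k) dk`, for `x` in the lattice. -/
def kernel (x : Space d) : Amp m →L[ℂ] Amp m :=
  ⨍ k in M.brillouin, planeWave k (-x) • M.symbolInvSqrt k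

/-- The Hilbert space `ℓ²(Λ; ℂ^m)`. -/
abbrev L2 : Type := lp (fun _ : M.sites => Amp m) 2

/-- The operator `F = (H^hom)^{-1/2}`: `(Fv)(ℓ) = ∑_n (F(ℓ - n) - F(-n)) v(n)`. -/
def applyF (v : M.L2) (l : M.sites) : Amp m :=
  ∑' n : M.sites, (M.kernel (l.1 - n.1) - M.kernel (-n.1)) (v n)

/-- `T = F* H(u) F` as an operator on `ℓ²`, that is
`⟨v, T w⟩ = ⟨H(u) Fv, Fw⟩ = ∑_ℓ ∇²V_ℓ(Du(ℓ))[D(Fv)(ℓ), D(Fw)(ℓ)]` for all `v, w`. -/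
def IsConjHessian (u : M.sites → Space m) (T : M.L2 →L[ℂ] M.L2) : Prop :=
  ∀ v w : M.L2, HasSum
    (fun l : M.sites => hessianForm (M.siteV l) (M.diff u l)
      (M.diff (M.applyF v) l) (M.diff (M.applyF w) l))
    (inner ℂ v (T w))

/-- The operator `F* H(u) F`. -/
def conjHessian (u : M.sites → Space m) : M.L2 →L[ℂ] M.L2 :=
  open Classical in if h : ∃ T, M.IsConjHessian u T then h.choose else 0

/-- The defining property determines the operator, so the choice above is the only one. -/
theorem isConjHessian_unique (u : M.sites → Space m) {T T' : M.L2 →L[ℂ] M.L2}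
    (h : M.IsConjHessian u T) (h' : M.IsConjHessian u T') : T = T' := by
  ext1 w
  exact ext_inner_left ℂ fun v => (h v w).unique (h' v w)

/-- The set `U(a, b)` of the `u ∈ Ẇ^{1,2}` with `σ(F* H(u) F) ∩ (0, ∞) ⊆ [a, b]`. -/
def Admissible (a b : ℝ) (u : M.sites → Space m) : Prop :=
  M.FiniteEnergy u ∧
    ∀ x : ℝ, (x : ℂ) ∈ spectrum ℂ (M.conjHessian u) → 0 < x → x ∈ Set.Icc a b

/-- `log⁺ T = (2πi)⁻¹ ∮ log z (z - T)⁻¹ dz`, over the circle that crosses the real axis at `a / 2`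
and `b + a / 2`; it encircles `[a, b]` and stays in the open right half-plane when `0 < a < b`. -/
def logPlus (a b : ℝ) (T : M.L2 →L[ℂ] M.L2) : M.L2 →L[ℂ] M.L2 :=
  (2 * Real.pi * Complex.I : ℂ)⁻¹ •
    ∮ z in C((((a + b) / 2 : ℝ) : ℂ), b / 2), Complex.log z • resolvent T z

/-- The element `δ_ℓ e_i` of `ℓ²`. -/
def delta (l : M.sites) (i : Fin m) : M.L2 :=
  open Classical in lp.single 2 l (EuclideanSpace.single i (1 : ℂ))

/-- The site entropy `S_ℓ(u) = -½ Trace [log⁺(F* H(u) F)]_{ℓℓ}`, for `u ∈ U(a, b)`. The trace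
is real there: it is that of a diagonal block of a self-adjoint operator. -/
def siteEntropy (a b : ℝ) (u : M.sites → Space m) (l : M.sites) : ℝ :=
  -(1 / 2) * (∑ i : Fin m,
    inner ℂ (M.delta l i) (M.logPlus a b (M.conjHessian u) (M.delta l i)) : ℂ).re

/-- The truncation `T_r u`, equal to `u` on `Λ ∩ B_r(ℓ)` and zero elsewhere. -/
def truncate (r : ℝ) (l : M.sites) (u : M.sites → Space m) : M.sites → Space m :=
  fun k => open Classical in if k.1 ∈ Metric.ball l.1 r then u k else 0

/-- The truncated site entropy `S̃_ℓ(u; r) = S_ℓ(T_r u)`. -/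
def truncatedSiteEntropy (a b r : ℝ) (u : M.sites → Space m) (l : M.sites) : ℝ :=
  M.siteEntropy a b (M.truncate r l u) l

end Crystal

end SiteEntropy

end

noncomputable section

namespace SiteEntropy

/-! ### Polynomial weights on the lattice `ℤ^d` -/

/-! Write `T(u)` for `F* H(u) F`. Since `r₀` may depend on `u`, it suffices to bound the error by `K
r^{-(d + 1/4)}` with `K` depending on `u` but not on the site `ℓ`: for large `r` the surplus
`r^{-1/4}` absorbs `K / ‖u‖_∞`, and `C₃ = 1` works. That bound is `exists_siteEntropy_sub_le`.

As `log⁺` is a contour integral, it is enough to compare the diagonal entries at `δ_ℓ e_i` of the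
resolvents of `T(u)` and `T(w)`, where `w` is the truncation of `u`. On the contour both have norm
at most `2 / a`. With `Δ = T(u) - T(w)`, the expansion `R_u - R_w = R_u Δ R_u - R_u Δ R_w Δ R_u`
asks for off-diagonal decay of `R_u` alone; of `R_w` only the norm enters, so no constant depends on
the radius or the centre of the truncation. `norm_inner_resolvent_sub_le` arrives at the sum of `e_k
(1 + |k - ℓ|)^{-2(d - 1/4)}`, where `e_k` measures the change of the second derivatives at `k`. This
change vanishes well inside the ball, is bounded in a shell of fixed width with `O(r^{d-1})` points,
and is dominated by a square summable sequence outside, because `u` has finite energy.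
`exists_tsum_shell_le` sums this to `O(r^{-(d + 1/4)})`.

The decay of `R_u` comes from Fourier analysis and a perturbation argument. Stability gives the
pointwise bound `ĥ(k) ≥ c |k|²` (`LatticeForm.gap_nonneg`). The symbol `(e^{-ik·z} - 1) ĥ(k)^{-1/2}`
of a difference `D_z F` is therefore bounded and extends holomorphically along coordinate lines to
discs of radius proportional to `|k|`, so that its Fourier coefficients decay like `|n|^{-s}` for
each `s < d` (`norm_mFourierCoeff_le_of_slices`). Hence the functionals `v ↦ (D_ρ F v)_i(k)` are
represented by vectors of `ℓ²` that form a Bessel family with a decaying Gram matrix. In this family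
the homogeneous Hessian is the identity (`LatticeForm.hasSum_frame_form`), and `T(u) - 1` has square
summable coefficients.

For such a perturbation `K` of the identity, the coefficients of `(ζ - K)⁻¹ x`, with `ζ = z - 1`,
satisfy a linear inequality with an `ℓ²` coefficient. Off a finite core the coefficient is small and
the inequality contracts in the weighted norm; on the core the decay is obtained from the adjoint
resolvent (`IsLatticePerturbation.exists_resolvent_decay`). The argument needs `ζ` away from `0`.
This is automatic: `1` is in the spectrum of `T(u)` (`one_mem_spectrum`), hence in `[a, b]`, and the
contour keeps its distance from it. -/

/-- The weight `(1 + ‖x‖)^{-s}`. -/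
def weight {E : Type*} [Norm E] (s : ℝ) (x : E) : ℝ := (1 + ‖x‖) ^ (-s)

section Weight

variable {E : Type*} [SeminormedAddCommGroup E] {s t : ℝ} {x y : E}

theorem weight_pos (s : ℝ) (x : E) : 0 < weight s x :=
  Real.rpow_pos_of_pos (by positivity) _

theorem weight_nonneg (s : ℝ) (x : E) : 0 ≤ weight s x := (weight_pos s x).le

theorem weight_le_one (hs : 0 ≤ s) (x : E) : weight s x ≤ 1 :=
  Real.rpow_le_one_of_one_le_of_nonpos (by simp) (by simpa using hs)

theorem weight_neg (s : ℝ) (x : E) : weight s (-x) = weight s x := by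
  simp [weight]

theorem weight_sub_comm (s : ℝ) (x y : E) : weight s (x - y) = weight s (y - x) := by
  rw [← weight_neg, neg_sub]

theorem weight_mul_weight (s t : ℝ) (x : E) : weight s x * weight t x = weight (s + t) x := by
  rw [weight, weight, weight, ← Real.rpow_add (by positivity)]
  congr 1
  ring

theorem weight_anti (hs : 0 ≤ s) (h : ‖x‖ ≤ ‖y‖) : weight s y ≤ weight s x :=
  Real.rpow_le_rpow_of_nonpos (by positivity) (by linarith) (by simpa using hs)

theorem weight_le_of_le_mul {F : Type*} [SeminormedAddCommGroup F] {z : F} (hs : 0 ≤ s) {c : ℝ}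
    (hc : 0 < c) (h : 1 + ‖z‖ ≤ c * (1 + ‖x‖)) : weight s x ≤ c ^ s * weight s z := by
  have h1 : weight s x = c ^ s * (c * (1 + ‖x‖)) ^ (-s) := by
    rw [Real.mul_rpow hc.le (by positivity), ← mul_assoc, ← Real.rpow_add hc]
    simp [weight]
  rw [h1]
  gcongr
  exact Real.rpow_le_rpow_of_nonpos (by positivity) h (by simpa using hs)

/-- The longer vector `x` dominates `x + y`, so `t` of its powers become decay in `x + y`; the other
`s - t` are passed on to the shorter `y`. -/
theorem weight_mul_le_of_norm_le (ht : 0 ≤ t) (hts : t ≤ s) (h : ‖y‖ ≤ ‖x‖) :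
    weight s x * weight s y ≤ 2 ^ t * weight t (x + y) * weight (2 * s - t) y := by
  have h1 : weight s x = weight t x * weight (s - t) x := by
    rw [weight_mul_weight]; congr 1; ring
  have h2 : weight (2 * s - t) y = weight (s - t) y * weight s y := by
    rw [weight_mul_weight]; congr 1; ring
  have h3 : weight t x ≤ 2 ^ t * weight t (x + y) :=
    weight_le_of_le_mul ht (by norm_num) (by linarith [norm_add_le x y])
  have h4 : weight (s - t) x ≤ weight (s - t) y := weight_anti (by linarith) h
  rw [h1, h2, ← mul_assoc (2 ^ t * _)]
  exact mul_le_mul_of_nonneg_right (mul_le_mul h3 h4 (weight_nonneg _ _)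
    (mul_nonneg (by positivity) (weight_nonneg _ _))) (weight_nonneg _ _)

/-- Giving up decay, `t < s`, can make the leftover exponent `2 * s - t` exceed `d` and hence
summable, which is how the Gram matrix of the frame inherits decay. The case `t = s` is
`weight_conv_le`. -/
theorem weight_mul_le (ht : 0 ≤ t) (hts : t ≤ s) (x y : E) :
    weight s x * weight s y ≤
      2 ^ t * weight t (x + y) * (weight (2 * s - t) x + weight (2 * s - t) y) := by
  have h0 : 0 ≤ 2 ^ t * weight t (x + y) := mul_nonneg (by positivity) (weight_nonneg _ _)
  rcases le_total ‖y‖ ‖x‖ with h | h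
  · refine (weight_mul_le_of_norm_le ht hts h).trans ?_
    exact mul_le_mul_of_nonneg_left (by linarith [weight_nonneg (2 * s - t) x]) h0
  · have := weight_mul_le_of_norm_le ht hts h
    rw [mul_comm, add_comm x y]
    rw [add_comm x y] at h0
    refine this.trans ?_
    exact mul_le_mul_of_nonneg_left (by linarith [weight_nonneg (2 * s - t) y]) h0

theorem weight_conv_le (hs : 0 ≤ s) (x y z : E) :
    weight s (x - y) * weight s (y - z) ≤
      2 ^ s * weight s (x - z) * (weight s (x - y) + weight s (y - z)) := by
  have := weight_mul_le hs le_rfl (x - y) (y - z)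
  rwa [sub_add_sub_cancel, show 2 * s - s = s by ring] at this

end Weight

theorem summable_weight {d : ℕ} {p : ℝ} (hp : (d : ℝ) < p) :
    Summable fun z : Fin d → ℤ => weight p z := by
  classical
  let b := Pi.basisFun ℝ (Fin d)
  let L := Submodule.span ℤ (Set.range b)
  let bz : Module.Basis (Fin d) ℤ L := b.restrictScalars ℤ
  let φ : (Fin d → ℤ) ≃ L := bz.equivFun.symm.toEquiv
  have hφ : ∀ z : Fin d → ℤ, ‖φ z‖ = ‖z‖ := by
    intro z
    have h1 : ((φ z : L) : Fin d → ℝ) = fun i => (z i : ℝ) := by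
      have : φ z = ∑ i, z i • bz i := bz.equivFun_symm_apply z
      rw [this]
      ext j
      have h2 : ∀ i, ((bz i : L) : Fin d → ℝ) = b i := fun i => b.restrictScalars_apply ℤ i
      simp [h2, b, Finset.sum_apply, Pi.single_apply]
    rw [Submodule.coe_norm, h1]
    simp only [Pi.norm_def]
    congr 1
  have hr : Module.finrank ℤ L = d := by
    rw [Module.finrank_eq_card_basis bz, Fintype.card_fin]
  have h1 := ZLattice.summable_norm_rpow L (-p) (by rw [hr]; linarith)
  have h2 : Summable fun z : Fin d → ℤ => ‖z‖ ^ (-p) := by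
    have := (φ.summable_iff (f := fun z : L => ‖z‖ ^ (-p))).2 h1
    refine this.congr fun z => ?_
    rw [Function.comp_apply, hφ]
  -- The comparison fails at `z = 0`, where the real power `0 ^ (-p)` is `0` by convention; a single
  -- point is harmless.
  refine Summable.of_norm_bounded_eventually h2 ?_
  refine (Set.finite_singleton (0 : Fin d → ℤ)).subset ?_
  intro z hz
  by_contra hne
  apply hz
  rw [Set.mem_ofPred_eq, Real.norm_of_nonneg (weight_nonneg _ _)]
  have : 0 < ‖z‖ := norm_pos_iff.2 hne
  exact Real.rpow_le_rpow_of_nonpos this (by linarith) (by linarith [(Nat.cast_nonneg d : (0:ℝ) ≤ d)])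

theorem summable_weight_sub {d : ℕ} {p : ℝ} (hp : (d : ℝ) < p) (y : Fin d → ℤ) :
    Summable fun z : Fin d → ℤ => weight p (z - y) :=
  ((Equiv.subRight y).summable_iff (f := fun z : Fin d → ℤ => weight p z)).2 (summable_weight hp)

theorem tsum_weight_sub {d : ℕ} {p : ℝ} (y : Fin d → ℤ) :
    ∑' z : Fin d → ℤ, weight p (z - y) = ∑' z : Fin d → ℤ, weight p z :=
  (Equiv.subRight y).tsum_eq (fun z : Fin d → ℤ => weight p z)

/-- The Cauchy-Schwarz inequality for series of nonnegative reals. -/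
theorem summable_mul_and_tsum_mul_le_sqrt {ι : Type*} {f g : ι → ℝ} (hf : ∀ i, 0 ≤ f i)
    (hg : ∀ i, 0 ≤ g i) (hf2 : Summable fun i => f i ^ 2) (hg2 : Summable fun i => g i ^ 2) :
    (Summable fun i => f i * g i) ∧
      ∑' i, f i * g i ≤ √(∑' i, f i ^ 2) * √(∑' i, g i ^ 2) := by
  have := Real.summable_and_inner_le_Lp_mul_Lq_tsum_of_nonneg
    (Real.HolderConjugate.two_two) hf hg (by simpa using hf2) (by simpa using hg2)
  simpa [Real.sqrt_eq_rpow] using this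

/-! ### Convolution of weights against square summable sequences -/

section Convolution

variable {d : ℕ} {s : ℝ}

theorem summable_weight_sq (hs : (d : ℝ) < 2 * s) (y : Fin d → ℤ) :
    Summable fun z : Fin d → ℤ => weight s (z - y) ^ 2 := by
  have := summable_weight_sub hs y
  refine this.congr fun z => ?_
  rw [sq, weight_mul_weight]
  congr 1; ring

theorem tsum_weight_sq (y : Fin d → ℤ) :
    ∑' z : Fin d → ℤ, weight s (z - y) ^ 2 = ∑' z : Fin d → ℤ, weight (2 * s) z := by
  rw [← tsum_weight_sub y]
  refine tsum_congr fun z => ?_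
  rw [sq, weight_mul_weight]
  congr 1; ring

/-- `ℓ²` sequences act on the weight `(1 + |x|)^{-s}`, `s > d / 2`, as convolution multipliers. -/
theorem weight_conv_ell2 (hs : (d : ℝ) < 2 * s) {c : (Fin d → ℤ) → ℝ} (hc : ∀ k, 0 ≤ c k)
    (hc2 : Summable fun k => c k ^ 2) (x y : Fin d → ℤ) :
    (Summable fun k => c k * (weight s (x - k) * weight s (k - y))) ∧
      ∑' k, c k * (weight s (x - k) * weight s (k - y)) ≤
        2 ^ s * 2 * √(∑' k, c k ^ 2) * √(∑' k : Fin d → ℤ, weight (2 * s) k) * weight s (x - y) := by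
  have hs0 : 0 ≤ s := by linarith [(Nat.cast_nonneg d : (0 : ℝ) ≤ d)]
  obtain ⟨h1, h1'⟩ := summable_mul_and_tsum_mul_le_sqrt hc (fun k => weight_nonneg s (k - x)) hc2
    (summable_weight_sq hs x)
  obtain ⟨h2, h2'⟩ := summable_mul_and_tsum_mul_le_sqrt hc (fun k => weight_nonneg s (k - y)) hc2
    (summable_weight_sq hs y)
  rw [tsum_weight_sq] at h1' h2'
  have hb : ∀ k, c k * (weight s (x - k) * weight s (k - y)) ≤
      2 ^ s * weight s (x - y) * (c k * weight s (k - x) + c k * weight s (k - y)) := by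
    intro k
    have := mul_le_mul_of_nonneg_left (weight_conv_le hs0 x k y) (hc k)
    refine this.trans (le_of_eq ?_)
    rw [weight_sub_comm s x k]
    ring
  have hsum := (h1.add h2).mul_left (2 ^ s * weight s (x - y))
  have hS : Summable fun k => c k * (weight s (x - k) * weight s (k - y)) :=
    Summable.of_nonneg_of_le (fun k => mul_nonneg (hc k) (mul_nonneg (weight_nonneg _ _)
      (weight_nonneg _ _))) hb hsum
  refine ⟨hS, (hS.tsum_le_tsum hb hsum).trans ?_⟩
  rw [tsum_mul_left, h1.tsum_add h2]
  have h0 : 0 ≤ 2 ^ s * weight s (x - y) := mul_nonneg (by positivity) (weight_nonneg _ _)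
  calc _ ≤ 2 ^ s * weight s (x - y) * (√(∑' k, c k ^ 2) * √(∑' k : Fin d → ℤ, weight (2 * s) k) +
        √(∑' k, c k ^ 2) * √(∑' k : Fin d → ℤ, weight (2 * s) k)) :=
        mul_le_mul_of_nonneg_left (add_le_add h1' h2') h0
    _ = _ := by ring

end Convolution

/-- The constant of the convolution estimate `weight_conv_ell2`. -/
def convConst (d : ℕ) (s : ℝ) (c : (Fin d → ℤ) → ℝ) : ℝ :=
  2 ^ s * 2 * √(∑' k, c k ^ 2) * √(∑' k : Fin d → ℤ, weight (2 * s) k)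

theorem convConst_nonneg (d : ℕ) (s : ℝ) (c : (Fin d → ℤ) → ℝ) : 0 ≤ convConst d s c := by
  unfold convConst; positivity

/-- A square summable sequence is small off a finite set. -/
theorem exists_finset_convConst_le {d : ℕ} {s : ℝ} (c : (Fin d → ℤ) → ℝ)
    {ε : ℝ} (hε : 0 < ε) :
    ∃ core : Finset (Fin d → ℤ),
      convConst d s (fun k => open Classical in if k ∈ core then 0 else c k) ≤ ε := by
  classical
  have h1 := tendsto_tsum_compl_atTop_zero fun k => c k ^ 2
  have h2 : Filter.Tendsto (fun core : Finset (Fin d → ℤ) => 2 ^ s * 2 *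
      √(∑' k : { k // k ∉ core }, c k ^ 2) * √(∑' k : Fin d → ℤ, weight (2 * s) k))
      Filter.atTop (𝓝 0) := by
    have := ((h1.sqrt).const_mul (2 ^ s * 2)).mul_const (√(∑' k : Fin d → ℤ, weight (2 * s) k))
    simpa using this
  obtain ⟨core, hcore⟩ := (h2.eventually (gt_mem_nhds hε)).exists
  refine ⟨core, le_of_lt ?_⟩
  have h3 := tsum_subtype ({k | k ∉ core} : Set (Fin d → ℤ)) fun k => c k ^ 2
  have e : ∑' k, (if k ∈ core then 0 else c k) ^ 2 = ∑' k : { k // k ∉ core }, c k ^ 2 := by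
    refine Eq.trans ?_ h3.symm
    refine tsum_congr fun k => ?_
    by_cases hk : k ∈ core <;> simp [hk]
  rw [convConst, e]
  exact hcore

/-! ### Decay from a self-consistent inequality -/

section SelfConsistent

variable {d : ℕ} {s : ℝ}

/-- A bounded sequence that satisfies a linear self-consistency inequality with an `ℓ²`
coefficient, and decays on the finite set off which the coefficient is small, decays. -/
theorem decay_of_selfConsistent (hs : (d : ℝ) < 2 * s) {c : (Fin d → ℤ) → ℝ}
    (hc : ∀ k, 0 ≤ c k) (hc2 : Summable fun k => c k ^ 2) (core : Finset (Fin d → ℤ)) {κ : ℝ}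
    (hκ : 0 ≤ κ)
    (hsmall : κ * convConst d s (fun k => open Classical in if k ∈ core then 0 else c k) ≤ 1 / 2)
    {Ψ : (Fin d → ℤ) → ℝ} (hΨ : ∀ k, 0 ≤ Ψ k) {β : ℝ} (hβ : ∀ k, Ψ k ≤ β) {α γ : ℝ}
    (hα : 0 ≤ α) (hγ : 0 ≤ γ) (y : Fin d → ℤ)
    (hcore : ∀ k ∈ core, Ψ k ≤ γ * weight s (k - y))
    (h : ∀ k, Ψ k ≤ α * weight s (k - y) + κ * ∑' k', c k' * (weight s (k - k') * Ψ k'))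
    (k : Fin d → ℤ) :
    Ψ k ≤ 2 * (α + κ * (γ * convConst d s c)) * weight s (k - y) := by
  classical
  have hs0 : 0 ≤ s := by linarith [(Nat.cast_nonneg d : (0 : ℝ) ≤ d)]
  set c' : (Fin d → ℤ) → ℝ := fun k => if k ∈ core then 0 else c k with hc'
  have hβ0 : 0 ≤ β := (hΨ k).trans (hβ k)
  have hc'0 : ∀ k, 0 ≤ c' k := fun k => by
    by_cases hk : k ∈ core <;> simp [hc', hk, hc k]
  have hc'le : ∀ k, c' k ≤ c k := fun k => by
    by_cases hk : k ∈ core <;> simp [hc', hk, hc k]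
  have hc'2 : Summable fun k => c' k ^ 2 :=
    hc2.of_nonneg_of_le (fun k => sq_nonneg _) fun k => pow_le_pow_left₀ (hc'0 k) (hc'le k) 2
  set D := α + κ * (γ * convConst d s c) with hD
  have hD0 : 0 ≤ D := by
    have := convConst_nonneg d s c
    positivity
  -- A bound `2 D w + B` reproduces itself with `B` halved: off the core the convolution contracts
  -- both the weight and the constant by `1 / 2`, and the core is paid for by the `γ` term in `D`.
  -- The a priori bound `β` only starts the iteration and disappears in the limit.
  have key : ∀ n : ℕ, ∀ k, Ψ k ≤ 2 * D * weight s (k - y) + β * (1 / 2) ^ n := by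
    intro n
    induction n with
    | zero =>
      intro k
      have := mul_nonneg (mul_nonneg zero_le_two hD0) (weight_nonneg s (k - y))
      simpa using (hβ k).trans (by linarith)
    | succ n ih =>
      intro k
      set B := β * (1 / 2) ^ n with hB
      have hB0 : 0 ≤ B := by positivity
      obtain ⟨h1, h1'⟩ := weight_conv_ell2 hs hc hc2 k y
      obtain ⟨h2, h2'⟩ := weight_conv_ell2 hs hc'0 hc'2 k y
      obtain ⟨h3, h3'⟩ := summable_mul_and_tsum_mul_le_sqrt hc'0 (fun k' => weight_nonneg s (k' - k))
        hc'2 (summable_weight_sq hs k)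
      rw [tsum_weight_sq] at h3'
      have hpt : ∀ k', c k' * (weight s (k - k') * Ψ k') ≤
          γ * (c k' * (weight s (k - k') * weight s (k' - y))) +
          (2 * D * (c' k' * (weight s (k - k') * weight s (k' - y))) +
            B * (c' k' * weight s (k' - k))) := by
        intro k'
        have hw := weight_nonneg s (k - k')
        have hw' := weight_nonneg s (k' - y)
        by_cases hk : k' ∈ core
        · have e : c' k' = 0 := by simp [hc', hk]
          have := mul_le_mul_of_nonneg_left (hcore k' hk) (mul_nonneg (hc k') hw)
          rw [e]
          nlinarith
        · have e : c' k' = c k' := by simp [hc', hk]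
          have h5 := mul_le_mul_of_nonneg_left (ih k') (mul_nonneg (hc k') hw)
          have h6 : 0 ≤ γ * (c k' * (weight s (k - k') * weight s (k' - y))) :=
            mul_nonneg hγ (mul_nonneg (hc k') (mul_nonneg hw hw'))
          rw [e, weight_sub_comm s k' k]
          nlinarith
      have hsum := (h1.mul_left γ).add ((h2.mul_left (2 * D)).add (h3.mul_left B))
      have hS : Summable fun k' => c k' * (weight s (k - k') * Ψ k') :=
        hsum.of_nonneg_of_le
          (fun k' => mul_nonneg (hc k') (mul_nonneg (weight_nonneg _ _) (hΨ k'))) hpt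
      have hT := hS.tsum_le_tsum hpt hsum
      rw [(h1.mul_left γ).tsum_add ((h2.mul_left (2 * D)).add (h3.mul_left B)),
        (h2.mul_left (2 * D)).tsum_add (h3.mul_left B), tsum_mul_left, tsum_mul_left,
        tsum_mul_left] at hT
      have hw := weight_nonneg s (k - y)
      -- The constant part of the bound is contracted by the same small quantity, because the
      -- prefactor `2 ^ s * 2` is at least `1`.
      have hcc : √(∑' k, c' k ^ 2) * √(∑' k : Fin d → ℤ, weight (2 * s) k) ≤ convConst d s c' := by
        rw [convConst, mul_assoc (2 ^ s * 2)]
        refine le_mul_of_one_le_left (by positivity) ?_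
        have : (1 : ℝ) ≤ 2 ^ s := Real.one_le_rpow (by norm_num) hs0
        linarith
      have e1 : ∑' k', c k' * (weight s (k - k') * Ψ k') ≤
          γ * (convConst d s c * weight s (k - y)) +
          (2 * D * (convConst d s c' * weight s (k - y)) + B * convConst d s c') := by
        refine hT.trans ?_
        gcongr
        · exact h1'
        · exact h2'
        · exact h3'.trans hcc
      calc Ψ k ≤ _ := h k
        _ ≤ α * weight s (k - y) + κ * (γ * (convConst d s c * weight s (k - y)) +
          (2 * D * (convConst d s c' * weight s (k - y)) + B * convConst d s c')) := by gcongr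
        _ = D * weight s (k - y) + (κ * convConst d s c') * (2 * D * weight s (k - y)) +
            (κ * convConst d s c') * B := by rw [hD]; ring
        _ ≤ D * weight s (k - y) + 1 / 2 * (2 * D * weight s (k - y)) + 1 / 2 * B := by
          gcongr
        _ = _ := by rw [pow_succ, hB]; ring
  have hlim : Filter.Tendsto (fun n : ℕ => 2 * D * weight s (k - y) + β * (1 / 2) ^ n)
      Filter.atTop (𝓝 (2 * D * weight s (k - y) + β * 0)) :=
    ((tendsto_pow_atTop_nhds_zero_of_lt_one (by norm_num) (by norm_num)).const_mul β).const_add _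
  rw [mul_zero, add_zero] at hlim
  exact ge_of_tendsto' hlim fun n => key n k

end SelfConsistent

/-! ### Resolvents of square summable perturbations in a localized family -/

section Perturbation

variable {d : ℕ} {P : Type*} [Fintype P] {H : Type*} [NormedAddCommGroup H]
  [InnerProductSpace ℂ H]

/-- The size of the coefficients of `v` at the lattice point `k`. -/
def coeffSize (b : (Fin d → ℤ) → P → H) (v : H) (k : Fin d → ℤ) : ℝ :=
  ∑ p, ‖inner ℂ (b k p) v‖

theorem coeffSize_nonneg (b : (Fin d → ℤ) → P → H) (v : H) (k : Fin d → ℤ) :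
    0 ≤ coeffSize b v k := Finset.sum_nonneg fun _ _ => norm_nonneg _

theorem norm_inner_le_coeffSize (b : (Fin d → ℤ) → P → H) (v : H) (k : Fin d → ℤ) (p : P) :
    ‖inner ℂ (b k p) v‖ ≤ coeffSize b v k :=
  Finset.single_le_sum (f := fun p => ‖inner ℂ (b k p) v‖) (fun _ _ => norm_nonneg _)
    (Finset.mem_univ p)

theorem coeffSize_le {b : (Fin d → ℤ) → P → H} {v : H} {k : Fin d → ℤ} {t : ℝ}
    (h : ∀ p, ‖inner ℂ (b k p) v‖ ≤ t) : coeffSize b v k ≤ Fintype.card P * t := by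
  have := Finset.sum_le_card_nsmul Finset.univ (fun p => ‖inner ℂ (b k p) v‖) t fun p _ => h p
  simpa [coeffSize] using this

theorem norm_form_term_le {b : (Fin d → ℤ) → P → H} {C : P → P → ℂ} {c : ℝ}
    (hC : ∀ p q, ‖C p q‖ ≤ c) (v w : H) (k : Fin d → ℤ) :
    ‖∑ p, ∑ q, C p q * (starRingEnd ℂ (inner ℂ (b k p) v) * inner ℂ (b k q) w)‖ ≤
      c * (coeffSize b v k * coeffSize b w k) := by
  have : c * (coeffSize b v k * coeffSize b w k) =
      ∑ p, ∑ q, c * (‖inner ℂ (b k p) v‖ * ‖inner ℂ (b k q) w‖) := by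
    rw [coeffSize, coeffSize, Finset.sum_mul_sum, Finset.mul_sum]
    simp only [Finset.mul_sum]
  rw [this]
  refine (norm_sum_le _ _).trans (Finset.sum_le_sum fun p _ => (norm_sum_le _ _).trans
    (Finset.sum_le_sum fun q _ => ?_))
  rw [norm_mul, norm_mul, RCLike.norm_conj]
  exact mul_le_mul_of_nonneg_right (hC p q) (by positivity)

theorem norm_form_le {b : (Fin d → ℤ) → P → H} {C : (Fin d → ℤ) → P → P → ℂ}
    {c : (Fin d → ℤ) → ℝ} (hC : ∀ k p q, ‖C k p q‖ ≤ c k) {v w : H} {z : ℂ}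
    (h : HasSum (fun k => ∑ p, ∑ q, C k p q *
      (starRingEnd ℂ (inner ℂ (b k p) v) * inner ℂ (b k q) w)) z) {g : (Fin d → ℤ) → ℝ}
    (hg : Summable g) (hle : ∀ k, c k * (coeffSize b v k * coeffSize b w k) ≤ g k) :
    ‖z‖ ≤ ∑' k, g k :=
  h.tsum_eq ▸ tsum_of_norm_bounded hg.hasSum fun k =>
    (norm_form_term_le (hC k) v w k).trans (hle k)

variable [CompleteSpace H]

/-- A self-adjoint operator `K = ∑_k ∑_{p, q} C_k(p, q) ⟨·, b_{kp}⟩ ⟨b_{kq}, ·⟩` with square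
summable coefficients, where the Gram matrix of the family `b` decays off the diagonal. -/
structure IsLatticePerturbation (b : (Fin d → ℤ) → P → H) (C : (Fin d → ℤ) → P → P → ℂ)
    (c : (Fin d → ℤ) → ℝ) (κ s : ℝ) (K : H →L[ℂ] H) : Prop where
  exponent : (d : ℝ) < 2 * s
  gram : ∀ k p k' q, ‖inner ℂ (b k p) (b k' q)‖ ≤ κ * weight s (k - k')
  gram_nonneg : 0 ≤ κ
  coeff : ∀ k p q, ‖C k p q‖ ≤ c k
  coeff_nonneg : ∀ k, 0 ≤ c k
  summable : Summable fun k => c k ^ 2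
  form : ∀ v w : H, HasSum (fun k => ∑ p, ∑ q, C k p q *
    (starRingEnd ℂ (inner ℂ (b k p) v) * inner ℂ (b k q) w)) (inner ℂ v (K w))
  selfAdjoint : IsSelfAdjoint K

namespace IsLatticePerturbation

variable {b : (Fin d → ℤ) → P → H} {C : (Fin d → ℤ) → P → P → ℂ} {c : (Fin d → ℤ) → ℝ}
  {κ s : ℝ} {K : H →L[ℂ] H}

theorem norm_le (h : IsLatticePerturbation b C c κ s K) (k : Fin d → ℤ) (p : P) :
    ‖b k p‖ ≤ √κ := by
  have := h.gram k p k p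
  rw [inner_self_eq_norm_sq_to_K, sub_self] at this
  refine Real.le_sqrt_of_sq_le ?_
  simpa [weight] using this

theorem coeffSize_gram (h : IsLatticePerturbation b C c κ s K) (k k' : Fin d → ℤ) (p : P) :
    coeffSize b (b k p) k' ≤ Fintype.card P * (κ * weight s (k - k')) :=
  coeffSize_le fun q => by
    rw [weight_sub_comm]
    exact h.gram k' q k p

theorem coeffSize_le_norm (h : IsLatticePerturbation b C c κ s K) (k : Fin d → ℤ) (v : H) :
    coeffSize b v k ≤ Fintype.card P * (√κ * ‖v‖) :=
  coeffSize_le fun p => (norm_inner_le_norm _ _).trans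
    (mul_le_mul_of_nonneg_right (h.norm_le k p) (norm_nonneg _))

/-- The self-consistency inequality for the coefficients of `(ζ - K)⁻¹ x`. -/
theorem coeffSize_resolvent_le (h : IsLatticePerturbation b C c κ s K) {ρ : ℝ} {ζ : ℂ}
    (hζ : ζ ≠ 0) (hζρ : ‖ζ⁻¹‖ ≤ ρ) {R : H →L[ℂ] H} (hR : ∀ x, ζ • R x - K (R x) = x) {x : H}
    {α : ℝ} {y : Fin d → ℤ} (hx : ∀ k, coeffSize b x k ≤ α * weight s (k - y))
    (k : Fin d → ℤ) :
    coeffSize b (R x) k ≤ (Fintype.card P * ρ * α) * weight s (k - y) +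
      (Fintype.card P * ρ * (Fintype.card P * κ)) *
        ∑' k', c k' * (weight s (k - k') * coeffSize b (R x) k') := by
  have hρ : 0 ≤ ρ := (norm_nonneg _).trans hζρ
  set N : ℝ := (Fintype.card P : ℝ) with hN
  set S := ∑' k', c k' * (weight s (k - k') * coeffSize b (R x) k') with hS
  have hsum : Summable fun k' => c k' * (weight s (k - k') * coeffSize b (R x) k') := by
    have h1 := (summable_mul_and_tsum_mul_le_sqrt h.coeff_nonneg
      (fun k' => weight_nonneg s (k' - k)) h.summable (summable_weight_sq h.exponent k)).1
    refine (h1.mul_left (N * (√κ * ‖R x‖))).of_nonneg_of_le (fun k' => mul_nonneg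
      (h.coeff_nonneg k') (mul_nonneg (weight_nonneg _ _) (coeffSize_nonneg _ _ _))) fun k' => ?_
    have := mul_le_mul_of_nonneg_left (h.coeffSize_le_norm k' (R x))
      (mul_nonneg (h.coeff_nonneg k') (weight_nonneg s (k' - k)))
    rw [weight_sub_comm s k k']
    linarith
  have hp : ∀ p, ‖inner ℂ (b k p) (R x)‖ ≤ ρ * (α * weight s (k - y) + N * κ * S) := by
    intro p
    -- The resolvent equation as a fixed point equation: the free part keeps the decay of `x`, and
    -- the rest passes through the Gram matrix.
    have e : R x = ζ⁻¹ • (x + K (R x)) := by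
      rw [eq_inv_smul_iff₀ hζ]
      exact sub_eq_iff_eq_add.1 (hR x)
    have h2 : ‖inner ℂ (b k p) (K (R x))‖ ≤ N * κ * S := by
      rw [hS, ← tsum_mul_left]
      refine norm_form_le h.coeff (h.form (b k p) (R x)) (hsum.mul_left (N * κ)) fun k' => ?_
      have := mul_le_mul_of_nonneg_left (mul_le_mul_of_nonneg_right (h.coeffSize_gram k k' p)
        (coeffSize_nonneg b (R x) k')) (h.coeff_nonneg k')
      linarith
    rw [e, inner_smul_right, inner_add_right, norm_mul]
    refine mul_le_mul hζρ ((norm_add_le _ _).trans (add_le_add ?_ h2)) (norm_nonneg _) hρ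
    exact (norm_inner_le_coeffSize b x k p).trans (hx k)
  refine (coeffSize_le hp).trans (le_of_eq ?_)
  ring

/-- Decay of the coefficients of `(ζ - K)⁻¹ x`, uniformly in `ζ` and `x`. -/
theorem exists_resolvent_decay (h : IsLatticePerturbation b C c κ s K) {ρ α : ℝ}
    (hρ : 0 ≤ ρ) (hα : 0 ≤ α) :
    ∃ A : ℝ, 0 ≤ A ∧ ∀ (ζ : ℂ) (R : H →L[ℂ] H), ζ ≠ 0 → ‖ζ⁻¹‖ ≤ ρ → ‖R‖ ≤ ρ →
      (∀ x, ζ • R x - K (R x) = x) → (∀ x, ζ • R x - R (K x) = x) →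
      ∀ (x : H) (y : Fin d → ℤ), (∀ k, coeffSize b x k ≤ α * weight s (k - y)) →
        ∀ k, coeffSize b (R x) k ≤ A * weight s (k - y) := by
  classical
  set N : ℝ := (Fintype.card P : ℝ) with hN
  have hN0 : 0 ≤ N := by positivity
  have hκ := h.gram_nonneg
  have hs0 : 0 ≤ s := by linarith [h.exponent, (Nat.cast_nonneg d : (0 : ℝ) ≤ d)]
  set κ' := N * ρ * (N * κ) with hκ'
  have hκ'0 : 0 ≤ κ' := by positivity
  -- The core is chosen once, before `ζ` and `x`; this makes the final constant uniform in both.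
  obtain ⟨core, hcore⟩ := exists_finset_convConst_le (s := s) c
    (ε := 1 / (2 * (κ' + 1))) (by positivity)
  have hsmall : κ' * convConst d s (fun k => if k ∈ core then 0 else c k) ≤ 1 / 2 := by
    refine (mul_le_mul_of_nonneg_left hcore hκ'0).trans ?_
    rw [mul_one_div, div_le_div_iff₀ (by positivity) (by norm_num)]
    linarith
  set Q := convConst d s c with hQ
  have hQ0 : 0 ≤ Q := convConst_nonneg d s c
  -- decay from decay on the core
  have step : ∀ (ζ : ℂ) (R : H →L[ℂ] H), ζ ≠ 0 → ‖ζ⁻¹‖ ≤ ρ → (∀ x, ζ • R x - K (R x) = x) →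
      ∀ (α γ : ℝ), 0 ≤ α → 0 ≤ γ → ∀ (x : H) (y : Fin d → ℤ),
      (∀ k, coeffSize b x k ≤ α * weight s (k - y)) →
      (∀ k ∈ core, coeffSize b (R x) k ≤ γ * weight s (k - y)) →
        ∀ k, coeffSize b (R x) k ≤ 2 * (N * ρ * α + κ' * (γ * Q)) * weight s (k - y) := by
    intro ζ R hζ hζρ hR α γ hα hγ x y hx hxc k
    exact decay_of_selfConsistent h.exponent h.coeff_nonneg h.summable core hκ'0 hsmall
      (coeffSize_nonneg b (R x)) (fun k => h.coeffSize_le_norm k (R x)) (by positivity) hγ y hxc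
      (fun k => h.coeffSize_resolvent_le hζ hζρ hR hx k) k
  -- the columns of the core
  set γ₁ := ∑ k ∈ core, ∑ ν ∈ core, N * (√κ * (ρ * √κ)) * (1 + ‖k - ν‖) ^ s with hγ₁
  have hγ₁0 : 0 ≤ γ₁ := by positivity
  set A₁ := 2 * (N * ρ * (N * κ) + κ' * (γ₁ * Q)) with hA₁
  have hA₁0 : 0 ≤ A₁ := by positivity
  have col : ∀ (ζ : ℂ) (R : H →L[ℂ] H), ζ ≠ 0 → ‖ζ⁻¹‖ ≤ ρ → ‖R‖ ≤ ρ →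
      (∀ x, ζ • R x - K (R x) = x) → ∀ ν ∈ core, ∀ q k,
        coeffSize b (R (b ν q)) k ≤ A₁ * weight s (k - ν) := by
    intro ζ R hζ hζρ hRρ hR ν hν q k
    refine step ζ R hζ hζρ hR (N * κ) γ₁ (by positivity) hγ₁0 (b ν q) ν (fun k => ?_)
      (fun k hk => ?_) k
    · rw [weight_sub_comm, mul_assoc]
      exact h.coeffSize_gram ν k q
    -- With the centre `ν` in the core too, only finitely many pairs occur. The norm bound on `R`
    -- then suffices, and `γ₁` compensates for the weight on all these pairs.
    · have h1 : ‖R (b ν q)‖ ≤ ρ * √κ := (R.le_of_opNorm_le hRρ _).trans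
        (mul_le_mul_of_nonneg_left (h.norm_le ν q) hρ)
      have h2 : N * (√κ * (ρ * √κ)) * (1 + ‖k - ν‖) ^ s ≤ γ₁ := by
        refine le_trans ?_ (Finset.single_le_sum
          (f := fun k => ∑ ν ∈ core, N * (√κ * (ρ * √κ)) * (1 + ‖k - ν‖) ^ s)
          (fun _ _ => by positivity) hk)
        exact Finset.single_le_sum (f := fun ν => N * (√κ * (ρ * √κ)) * (1 + ‖k - ν‖) ^ s)
          (fun _ _ => by positivity) hν
      have h3 : (1 + ‖k - ν‖) ^ s * weight s (k - ν) = 1 := by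
        rw [weight, ← Real.rpow_add (by positivity), add_neg_cancel, Real.rpow_zero]
      calc coeffSize b (R (b ν q)) k ≤ N * (√κ * ‖R (b ν q)‖) := h.coeffSize_le_norm k _
        _ ≤ N * (√κ * (ρ * √κ)) := by gcongr
        _ = N * (√κ * (ρ * √κ)) * (1 + ‖k - ν‖) ^ s * weight s (k - ν) := by
          rw [mul_assoc _ _ (weight s (k - ν)), h3, mul_one]
        _ ≤ _ := mul_le_mul_of_nonneg_right h2 (weight_nonneg _ _)
  set γ₂ := N * (ρ * (α + A₁ * α * Q)) with hγ₂
  have hγ₂0 : 0 ≤ γ₂ := by positivity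
  refine ⟨2 * (N * ρ * α + κ' * (γ₂ * Q)), by positivity, ?_⟩
  intro ζ R hζ hζρ hRρ hR hR' x y hx
  refine step ζ R hζ hζρ hR α γ₂ hα hγ₂0 x y hx fun k hk => ?_
  -- the rows of the core, from the columns of the adjoint
  have hK : ContinuousLinearMap.adjoint K = K := h.selfAdjoint.adjoint_eq
  have hadj : ∀ z, starRingEnd ℂ ζ • (ContinuousLinearMap.adjoint R) z -
      K ((ContinuousLinearMap.adjoint R) z) = z := by
    intro z
    refine ext_inner_right ℂ fun w => ?_
    rw [inner_sub_left, inner_smul_left, Complex.conj_conj, ContinuousLinearMap.adjoint_inner_left]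
    conv_lhs => rw [← hK]
    rw [ContinuousLinearMap.adjoint_inner_left, ContinuousLinearMap.adjoint_inner_left,
      ← inner_smul_right, ← inner_sub_right, hR' w]
  -- The adjoint is a resolvent at the conjugate point, so the column estimate applies to it with
  -- centre `k` in the core. Moving `R` to the left in `⟨b_k, R K x⟩` leaves `⟨R* b_k, K x⟩`, where
  -- both arguments have known decay.
  have hcolk := fun p => col (starRingEnd ℂ ζ) (ContinuousLinearMap.adjoint R)
    (by simpa using hζ) (by rwa [← map_inv₀, RCLike.norm_conj])
    (by rwa [LinearIsometryEquiv.norm_map]) hadj k hk p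
  refine (coeffSize_le (t := ρ * (α + A₁ * α * Q) * weight s (k - y)) fun p => ?_).trans
    (le_of_eq (by rw [hγ₂]; ring))
  have e : R x = ζ⁻¹ • (x + R (K x)) := by
    rw [eq_inv_smul_iff₀ hζ]
    exact sub_eq_iff_eq_add.1 (hR' x)
  obtain ⟨c1, c2⟩ := weight_conv_ell2 h.exponent h.coeff_nonneg h.summable k y
  have h2 : ‖inner ℂ (b k p) (R (K x))‖ ≤ A₁ * α * Q * weight s (k - y) := by
    rw [← ContinuousLinearMap.adjoint_inner_left]
    refine (norm_form_le h.coeff (h.form _ x) (c1.mul_left (A₁ * α)) fun k' => ?_).trans ?_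
    · have := mul_le_mul (hcolk p k') (hx k') (coeffSize_nonneg _ _ _)
        (mul_nonneg hA₁0 (weight_nonneg _ _))
      have := mul_le_mul_of_nonneg_left this (h.coeff_nonneg k')
      rw [weight_sub_comm s k k']
      linarith
    · rw [tsum_mul_left, mul_assoc (A₁ * α)]
      exact mul_le_mul_of_nonneg_left c2 (by positivity)
  rw [e, inner_smul_right, inner_add_right, norm_mul, mul_assoc]
  refine mul_le_mul hζρ ((norm_add_le _ _).trans ?_) (norm_nonneg _) hρ
  rw [add_mul]
  exact add_le_add ((norm_inner_le_coeffSize b x k p).trans (hx k)) h2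

end IsLatticePerturbation

end Perturbation

/-! ### Resolvents of self-adjoint operators on the contour -/

section Resolvent

variable {H : Type*} [NormedAddCommGroup H] [InnerProductSpace ℂ H] [CompleteSpace H]

/-- For a normal operator the resolvent is the functional calculus of `(z - x)⁻¹`, so its norm is
bounded by the values on the spectrum. -/
theorem norm_resolvent_le {T : H →L[ℂ] H} (hT : IsSelfAdjoint T) {z : ℂ} {δ : ℝ} (hδ : 0 < δ)
    (h : ∀ x ∈ spectrum ℂ T, δ ≤ ‖z - x‖) :
    z ∈ resolventSet ℂ T ∧ ‖resolvent T z‖ ≤ δ⁻¹ := by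
  have hT' : IsStarNormal T := hT.isStarNormal
  have hz : z ∉ spectrum ℂ T := fun hz => by
    have := h z hz
    simp at this
    linarith
  refine ⟨by simpa [spectrum] using hz, ?_⟩
  have hne : ∀ x ∈ spectrum ℂ T, z - x ≠ 0 := fun x hx h0 => by
    have := h x hx
    rw [h0, norm_zero] at this
    linarith
  have e : resolvent T z = cfc (fun x : ℂ => (z - x)⁻¹) T := by
    rw [cfc_inv (fun x : ℂ => z - x) T hne, cfc_sub (fun _ => z) (fun x => x) T, cfc_const z T,
      cfc_id' ℂ T]
    rfl
  rw [e]
  refine norm_cfc_le (by positivity) fun x hx => ?_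
  rw [norm_inv]
  exact inv_anti₀ hδ (h x hx)

/-- The circle crosses the real axis at `a / 2` and `b + a / 2`, so it is at distance `a / 2` both
from the half-line up to `0` and from `[a, b]`. -/
theorem half_le_norm_sub_of_mem_sphere {a b : ℝ} {z : ℂ}
    (hz : z ∈ Metric.sphere (((a + b) / 2 : ℝ) : ℂ) (b / 2)) {x : ℝ}
    (hx : 0 < x → x ∈ Set.Icc a b) : a / 2 ≤ ‖z - x‖ := by
  rw [mem_sphere_iff_norm] at hz
  have hc : ‖((((a + b) / 2 : ℝ) : ℂ)) - x‖ = |(a + b) / 2 - x| := by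
    rw [← Complex.ofReal_sub, Complex.norm_real, Real.norm_eq_abs]
  have e : z - (x : ℂ) = (z - (((a + b) / 2 : ℝ) : ℂ)) + ((((a + b) / 2 : ℝ) : ℂ) - x) := by ring
  rcases le_or_gt x 0 with h0 | h0
  · have h1 := norm_sub_norm_le ((((a + b) / 2 : ℝ) : ℂ) - x) (((((a + b) / 2 : ℝ) : ℂ)) - z)
    rw [norm_sub_rev _ z, hz, hc, sub_sub_sub_cancel_left] at h1
    have := le_abs_self ((a + b) / 2 - x)
    linarith
  · obtain ⟨h2, h3⟩ := hx h0
    have h1 := norm_sub_norm_le (z - (((a + b) / 2 : ℝ) : ℂ)) ((x : ℂ) - (((a + b) / 2 : ℝ) : ℂ))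
    rw [norm_sub_rev (x : ℂ), hz, hc, sub_sub_sub_cancel_right] at h1
    have : |(a + b) / 2 - x| ≤ (b - a) / 2 := abs_le.2 ⟨by linarith, by linarith⟩
    linarith

/-- On the contour, the resolvent of a self-adjoint operator with positive spectrum in `[a, b]` is
bounded, whatever its nonpositive spectrum. -/
theorem norm_resolvent_le_of_mem_sphere {T : H →L[ℂ] H} (hT : IsSelfAdjoint T) {a b : ℝ}
    (ha : 0 < a)
    (h : ∀ x : ℝ, (x : ℂ) ∈ spectrum ℂ T → 0 < x → x ∈ Set.Icc a b) {z : ℂ}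
    (hz : z ∈ Metric.sphere (((a + b) / 2 : ℝ) : ℂ) (b / 2)) :
    z ∈ resolventSet ℂ T ∧ ‖resolvent T z‖ ≤ 2 / a := by
  have := norm_resolvent_le hT (z := z) (half_pos ha) fun x hx => by
    have hre := hT.mem_spectrum_eq_re hx
    rw [hre] at hx ⊢
    exact half_le_norm_sub_of_mem_sphere hz (h _ hx)
  rwa [inv_div] at this

omit [CompleteSpace H] in
theorem resolvent_apply {T : H →L[ℂ] H} {z : ℂ} (hz : z ∈ resolventSet ℂ T) (x : H) :
    z • resolvent T z x - T (resolvent T z x) = x ∧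
      z • resolvent T z x - resolvent T z (T x) = x := by
  have hu : IsUnit (algebraMap ℂ (H →L[ℂ] H) z - T) := hz
  have h1 := Ring.mul_inverse_cancel _ hu
  have h2 := Ring.inverse_mul_cancel _ hu
  constructor
  · simpa [Algebra.algebraMap_eq_smul_one, resolvent] using congrArg (fun A : H →L[ℂ] H => A x) h1
  · simpa [Algebra.algebraMap_eq_smul_one, resolvent] using congrArg (fun A : H →L[ℂ] H => A x) h2

theorem re_pos_of_mem_sphere {a b : ℝ} (ha : 0 < a) {z : ℂ}
    (hz : z ∈ Metric.sphere (((a + b) / 2 : ℝ) : ℂ) (b / 2)) : 0 < z.re := by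
  rw [mem_sphere_iff_norm] at hz
  have := Complex.abs_re_le_norm (z - (((a + b) / 2 : ℝ) : ℂ))
  rw [hz, Complex.sub_re, Complex.ofReal_re] at this
  have := (abs_le.1 this).1
  linarith

/-- The difference of the values of two holomorphic functional calculi is controlled by the
difference of the resolvents on the contour. -/
theorem exists_norm_inner_log_sub_le {a b : ℝ} (ha : 0 < a) (hab : a < b) :
    ∃ Q : ℝ, 0 ≤ Q ∧ ∀ (T₁ T₂ : H →L[ℂ] H) (x : H) (t : ℝ),
      (∀ z ∈ Metric.sphere (((a + b) / 2 : ℝ) : ℂ) (b / 2),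
        z ∈ resolventSet ℂ T₁ ∧ z ∈ resolventSet ℂ T₂ ∧
        ‖inner ℂ x (resolvent T₁ z x - resolvent T₂ z x)‖ ≤ t) →
      ‖inner ℂ x (((2 * Real.pi * Complex.I : ℂ)⁻¹ •
          ∮ z in C((((a + b) / 2 : ℝ) : ℂ), b / 2), Complex.log z • resolvent T₁ z) x) -
        inner ℂ x (((2 * Real.pi * Complex.I : ℂ)⁻¹ •
          ∮ z in C((((a + b) / 2 : ℝ) : ℂ), b / 2), Complex.log z • resolvent T₂ z) x)‖ ≤ Q * t := by
  have hb : 0 ≤ b / 2 := by linarith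
  have hlog : ContinuousOn Complex.log (Metric.sphere (((a + b) / 2 : ℝ) : ℂ) (b / 2)) :=
    continuousOn_id.clog fun z hz => Or.inl (re_pos_of_mem_sphere ha hz)
  obtain ⟨L, hL⟩ := (isCompact_sphere _ _).exists_bound_of_continuousOn hlog
  refine ⟨‖(2 * Real.pi * Complex.I : ℂ)⁻¹‖ * (2 * Real.pi * (b / 2) * max L 0),
    by positivity, ?_⟩
  intro T₁ T₂ x t h
  have hcont : ∀ T : H →L[ℂ] H, (∀ z ∈ Metric.sphere (((a + b) / 2 : ℝ) : ℂ) (b / 2),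
      z ∈ resolventSet ℂ T) → CircleIntegrable (fun z => Complex.log z • resolvent T z)
        (((a + b) / 2 : ℝ) : ℂ) (b / 2) := fun T hT =>
    ContinuousOn.circleIntegrable hb (hlog.smul fun z hz =>
      (spectrum.hasDerivAt_resolvent_const_left (hT z hz)).continuousAt.continuousWithinAt)
  have i1 := hcont T₁ fun z hz => (h z hz).1
  have i2 := hcont T₂ fun z hz => (h z hz).2.1
  -- The diagonal entry is a continuous linear functional of the operator, so it can be taken under
  -- the contour integral.
  let Φ : (H →L[ℂ] H) →L[ℂ] ℂ := (innerSL ℂ x).comp (ContinuousLinearMap.apply ℂ H x)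
  have hΦ : ∀ A, Φ A = inner ℂ x (A x) := fun A => rfl
  rw [← hΦ, ← hΦ, ← map_sub, ← smul_sub, ← circleIntegral.integral_sub i1 i2, map_smul]
  have e : Φ (∮ z in C((((a + b) / 2 : ℝ) : ℂ), b / 2),
      (Complex.log z • resolvent T₁ z - Complex.log z • resolvent T₂ z)) =
      ∮ z in C((((a + b) / 2 : ℝ) : ℂ), b / 2),
        Φ (Complex.log z • resolvent T₁ z - Complex.log z • resolvent T₂ z) := by
    have i3 := (i1.sub i2).out
    simp only [circleIntegral]
    rw [← ContinuousLinearMap.intervalIntegral_comp_comm Φ (by simpa using i3)]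
    simp
  rw [e, norm_smul, mul_assoc ‖_‖ _ t, mul_assoc (2 * Real.pi * (b / 2))]
  refine mul_le_mul_of_nonneg_left ?_ (norm_nonneg _)
  refine circleIntegral.norm_integral_le_of_norm_le_const hb fun z hz => ?_
  rw [← smul_sub, map_smul, norm_smul, hΦ]
  exact mul_le_mul ((hL z hz).trans (le_max_left _ _)) (h z hz).2.2 (norm_nonneg _)
    (le_max_right _ _)

end Resolvent

/-! ### Second order perturbation of the resolvent -/

section SecondOrder

variable {d : ℕ} {P : Type*} [Fintype P] {H : Type*} [NormedAddCommGroup H]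
  [InnerProductSpace ℂ H] {b : (Fin d → ℤ) → P → H}

/-- The image of a vector under an operator with coefficients `D` in a Bessel family. -/
theorem norm_apply_sq_le {B : ℝ} (hB : 0 ≤ B)
    (hbessel : ∀ v : H, (Summable fun k => coeffSize b v k ^ 2) ∧
      ∑' k, coeffSize b v k ^ 2 ≤ B * ‖v‖ ^ 2)
    {D : (Fin d → ℤ) → P → P → ℂ} {e : (Fin d → ℤ) → ℝ} (he : ∀ k, 0 ≤ e k)
    (hD : ∀ k p q, ‖D k p q‖ ≤ e k) {Δ : H →L[ℂ] H}
    (hΔ : ∀ v w : H, HasSum (fun k => ∑ p, ∑ q, D k p q *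
      (starRingEnd ℂ (inner ℂ (b k p) v) * inner ℂ (b k q) w)) (inner ℂ v (Δ w)))
    {w : H} (hsum : Summable fun k => (e k * coeffSize b w k) ^ 2) :
    ‖Δ w‖ ^ 2 ≤ B * ∑' k, (e k * coeffSize b w k) ^ 2 := by
  -- The form is tested with `Δ w` itself; Cauchy-Schwarz and the Bessel bound then give back one
  -- factor `‖Δ w‖`, which cancels.
  have h1 : ‖Δ w‖ * ‖Δ w‖ ≤ √B * ‖Δ w‖ * √(∑' k, (e k * coeffSize b w k) ^ 2) := by
    obtain ⟨s1, s2⟩ := hbessel (Δ w)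
    obtain ⟨t1, t2⟩ := summable_mul_and_tsum_mul_le_sqrt (fun k => coeffSize_nonneg b (Δ w) k)
      (fun k => mul_nonneg (he k) (coeffSize_nonneg b w k)) s1 hsum
    have h2 := norm_form_le hD (hΔ (Δ w) w) t1 fun k => le_of_eq (by ring)
    have h3 : ‖inner ℂ (Δ w) (Δ w)‖ = ‖Δ w‖ * ‖Δ w‖ := by
      rw [inner_self_eq_norm_sq_to_K]
      simp [sq]
    rw [h3] at h2
    refine (h2.trans t2).trans (mul_le_mul_of_nonneg_right ?_ (Real.sqrt_nonneg _))
    calc √(∑' k, coeffSize b (Δ w) k ^ 2) ≤ √(B * ‖Δ w‖ ^ 2) := Real.sqrt_le_sqrt s2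
      _ = √B * ‖Δ w‖ := by rw [Real.sqrt_mul hB, Real.sqrt_sq (norm_nonneg _)]
  rcases eq_or_ne ‖Δ w‖ 0 with h0 | h0
  · rw [h0]
    simpa using mul_nonneg hB (tsum_nonneg fun k => sq_nonneg _)
  · have hpos : 0 < ‖Δ w‖ := lt_of_le_of_ne (norm_nonneg _) (Ne.symm h0)
    have h2 : ‖Δ w‖ ≤ √B * √(∑' k, (e k * coeffSize b w k) ^ 2) := by
      refine le_of_mul_le_mul_right ?_ hpos
      linarith
    calc ‖Δ w‖ ^ 2 ≤ (√B * √(∑' k, (e k * coeffSize b w k) ^ 2)) ^ 2 := by gcongr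
      _ = _ := by
        rw [mul_pow, Real.sq_sqrt hB, Real.sq_sqrt (tsum_nonneg fun k => sq_nonneg _)]

variable [CompleteSpace H]

/-- The second order resolvent expansion bounds the diagonal entries of a difference of resolvents
by the decay of only one of them. -/
theorem norm_inner_resolvent_sub_le {B : ℝ} (hB : 0 ≤ B)
    (hbessel : ∀ v : H, (Summable fun k => coeffSize b v k ^ 2) ∧
      ∑' k, coeffSize b v k ^ 2 ≤ B * ‖v‖ ^ 2)
    {D : (Fin d → ℤ) → P → P → ℂ} {e : (Fin d → ℤ) → ℝ} (he : ∀ k, 0 ≤ e k) {E : ℝ}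
    (heE : ∀ k, e k ≤ E) (hD : ∀ k p q, ‖D k p q‖ ≤ e k) {T₁ T₂ : H →L[ℂ] H}
    (hT₁ : IsSelfAdjoint T₁) (hT₂ : IsSelfAdjoint T₂)
    (hΔ : ∀ v w : H, HasSum (fun k => ∑ p, ∑ q, D k p q *
      (starRingEnd ℂ (inner ℂ (b k p) v) * inner ℂ (b k q) w)) (inner ℂ v ((T₁ - T₂) w)))
    {z : ℂ} {R₁ R₂ : H →L[ℂ] H} (h₁ : ∀ x, z • R₁ x - T₁ (R₁ x) = x)
    (h₁' : ∀ x, z • R₁ x - R₁ (T₁ x) = x)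
    (h₂ : ∀ x, z • R₂ x - T₂ (R₂ x) = x)
    (h₂' : ∀ x, z • R₂ x - R₂ (T₂ x) = x) {ρ : ℝ} (hρ : ‖R₂‖ ≤ ρ) {x : H}
    {A s : ℝ} (hA : 0 ≤ A) {y : Fin d → ℤ}
    (hw : Summable fun k => e k * weight s (k - y) ^ 2)
    (hR : ∀ k, coeffSize b (R₁ x) k ≤ A * weight s (k - y))
    (hR' : ∀ k, coeffSize b (ContinuousLinearMap.adjoint R₁ x) k ≤ A * weight s (k - y)) :
    ‖inner ℂ x (R₁ x - R₂ x)‖ ≤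
      (A ^ 2 + ρ * (B * (E * A ^ 2))) * ∑' k, e k * weight s (k - y) ^ 2 := by
  set Δ := T₁ - T₂ with hΔdef
  set S := ∑' k, e k * weight s (k - y) ^ 2 with hS
  have hS0 : 0 ≤ S := tsum_nonneg fun k => mul_nonneg (he k) (sq_nonneg _)
  have hΔs : ContinuousLinearMap.adjoint Δ = Δ := (hT₁.sub hT₂).adjoint_eq
  -- `R₁ - R₂ = R₁ Δ R₂ = R₂ Δ R₁`
  have i1 : ∀ x, R₁ x - R₂ x = R₁ (Δ (R₂ x)) := by
    intro x
    have e1 := h₁' (R₂ x)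
    have e2 : R₁ (z • R₂ x - T₂ (R₂ x)) = R₁ x := by rw [h₂]
    rw [map_sub, map_smul] at e2
    rw [hΔdef, sub_apply, map_sub, ← e2]
    nth_rewrite 3 [← e1]
    abel
  have i2 : ∀ x, R₁ x - R₂ x = R₂ (Δ (R₁ x)) := by
    intro x
    have e1 := h₂' (R₁ x)
    have e2 : R₂ (z • R₁ x - T₁ (R₁ x)) = R₂ x := by rw [h₁]
    rw [map_sub, map_smul] at e2
    rw [hΔdef, sub_apply, map_sub, ← e2]
    nth_rewrite 1 [← e1]
    abel
  -- Inserting one identity in the other gives `R₁ Δ R₁ - R₁ Δ R₂ Δ R₁`. Here `R₂` stands between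
  -- two localized factors, so its operator norm is all that is needed.
  have i3 : inner ℂ x (R₁ x - R₂ x) = inner ℂ (ContinuousLinearMap.adjoint R₁ x) (Δ (R₁ x)) -
      inner ℂ (Δ (ContinuousLinearMap.adjoint R₁ x)) (R₂ (Δ (R₁ x))) := by
    have : R₁ x - R₂ x = R₁ (Δ (R₁ x)) - R₁ (Δ (R₂ (Δ (R₁ x)))) := by
      rw [← i2, map_sub, map_sub, i1]
      abel
    rw [this, inner_sub_right, ContinuousLinearMap.adjoint_inner_left]
    conv_rhs => rw [← hΔs, ContinuousLinearMap.adjoint_inner_left,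
      ContinuousLinearMap.adjoint_inner_left]
    rw [hΔs]
  have n1 : ‖inner ℂ (ContinuousLinearMap.adjoint R₁ x) (Δ (R₁ x))‖ ≤ A ^ 2 * S := by
    rw [hS, ← tsum_mul_left]
    refine norm_form_le hD (hΔ _ _) (hw.mul_left _) fun k => ?_
    have := mul_le_mul_of_nonneg_left (mul_le_mul (hR' k) (hR k) (coeffSize_nonneg _ _ _)
      (mul_nonneg hA (weight_nonneg _ _))) (he k)
    linarith
  have n2 : ∀ f, (∀ k, coeffSize b f k ≤ A * weight s (k - y)) →
      ‖Δ f‖ ^ 2 ≤ B * (E * A ^ 2) * S := by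
    intro f hf
    -- One of the two factors `e k` is spent on the uniform bound `E`. The quadratic term is thus
    -- controlled by the same sum, linear in `e`, as the first order term.
    have hle : ∀ k, (e k * coeffSize b f k) ^ 2 ≤ E * A ^ 2 * (e k * weight s (k - y) ^ 2) := by
      intro k
      have h3 : (e k * coeffSize b f k) ^ 2 ≤ (e k * (A * weight s (k - y))) ^ 2 :=
        pow_le_pow_left₀ (mul_nonneg (he k) (coeffSize_nonneg _ _ _))
          (mul_le_mul_of_nonneg_left (hf k) (he k)) 2
      have h4 : 0 ≤ (E - e k) * (e k * (A * weight s (k - y)) ^ 2) :=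
        mul_nonneg (by linarith [heE k]) (mul_nonneg (he k) (sq_nonneg _))
      nlinarith
    have hs := (hw.mul_left (E * A ^ 2)).of_nonneg_of_le (fun k => sq_nonneg _) hle
    refine (norm_apply_sq_le hB hbessel he hD hΔ hs).trans ?_
    rw [mul_assoc]
    refine mul_le_mul_of_nonneg_left ?_ hB
    rw [hS, ← tsum_mul_left]
    exact hs.tsum_le_tsum hle (hw.mul_left _)
  have m1 := n2 _ hR
  have m2 := n2 _ hR'
  have hρ0 : 0 ≤ ρ := (norm_nonneg _).trans hρ
  have n3 : ‖inner ℂ (Δ (ContinuousLinearMap.adjoint R₁ x)) (R₂ (Δ (R₁ x)))‖ ≤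
      ρ * (B * (E * A ^ 2) * S) := by
    refine (norm_inner_le_norm _ _).trans ?_
    have h5 : ‖R₂ (Δ (R₁ x))‖ ≤ ρ * ‖Δ (R₁ x)‖ := R₂.le_of_opNorm_le hρ _
    have h6 : ‖Δ (ContinuousLinearMap.adjoint R₁ x)‖ * ‖Δ (R₁ x)‖ ≤ B * (E * A ^ 2) * S := by
      nlinarith [sq_nonneg (‖Δ (ContinuousLinearMap.adjoint R₁ x)‖ - ‖Δ (R₁ x)‖)]
    calc _ ≤ ‖Δ (ContinuousLinearMap.adjoint R₁ x)‖ * (ρ * ‖Δ (R₁ x)‖) := by gcongr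
      _ = ρ * (‖Δ (ContinuousLinearMap.adjoint R₁ x)‖ * ‖Δ (R₁ x)‖) := by ring
      _ ≤ _ := by gcongr
  rw [i3]
  refine (norm_sub_le _ _).trans ?_
  linarith

end SecondOrder

/-! ### The inverse square root as a power series -/

/-- The Taylor coefficients of `(1 - x)^{-1/2}`. -/
def invSqrtCoeff (n : ℕ) : ℝ :=
  ((n.factorial : ℂ)⁻¹ * iteratedDeriv n (fun z : ℂ => (1 - z) ^ (-(1 / 2) : ℂ)) 0).re

/-- On the unit disc `1 - z` has positive real part, so the principal branch is holomorphic there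
and equals its Taylor series. -/
theorem hasSum_invSqrtCoeff_complex {z : ℂ} (hz : ‖z‖ < 1) :
    HasSum (fun n : ℕ => ((n.factorial : ℂ)⁻¹ *
      iteratedDeriv n (fun z : ℂ => (1 - z) ^ (-(1 / 2) : ℂ)) 0) * z ^ n)
      ((1 - z) ^ (-(1 / 2) : ℂ)) := by
  have hd : DifferentiableOn ℂ (fun z : ℂ => (1 - z) ^ (-(1 / 2) : ℂ)) (Metric.ball 0 1) := by
    refine DifferentiableOn.cpow (by fun_prop) (by fun_prop) fun w hw => Or.inl ?_
    rw [Metric.mem_ball, dist_zero_right] at hw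
    have := (Complex.re_le_norm w).trans_lt hw
    simpa using this
  have := Complex.hasSum_taylorSeries_on_ball hd (z := z) (by simpa using hz)
  simp only [sub_zero, smul_eq_mul] at this
  refine this.congr_fun fun n => ?_
  ring

theorem hasSum_invSqrtCoeff {x : ℝ} (hx : |x| < 1) :
    HasSum (fun n => invSqrtCoeff n * x ^ n) ((1 - x) ^ (-(1 / 2) : ℝ)) := by
  have h := Complex.hasSum_re (hasSum_invSqrtCoeff_complex (z := (x : ℂ)) (by simpa using hx))
  have e : ((1 - (x : ℂ)) ^ (-(1 / 2) : ℂ)).re = (1 - x) ^ (-(1 / 2) : ℝ) := by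
    have := Complex.ofReal_cpow (x := 1 - x) (by linarith [(abs_lt.1 hx).2]) (-(1 / 2))
    push_cast at this
    rw [← this]
    simp
  rw [e] at h
  refine h.congr_fun fun n => ?_
  rw [← Complex.ofReal_pow, Complex.re_mul_ofReal]
  rfl

theorem summable_abs_invSqrtCoeff {r : ℝ} (h0 : 0 ≤ r) (hr : r < 1) :
    Summable fun n => |invSqrtCoeff n| * r ^ n := by
  have h := (hasSum_invSqrtCoeff (x := r) (by rwa [abs_of_nonneg h0])).summable.norm
  refine h.congr fun n => ?_
  rw [norm_mul, Real.norm_eq_abs, Real.norm_of_nonneg (by positivity)]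

section Operator

variable {V : Type*} [NormedAddCommGroup V] [InnerProductSpace ℂ V] [CompleteSpace V]

/-- The power series of `(1 - B)^{-1/2}`. -/
def invSqrtSeries (B : V →L[ℂ] V) : V →L[ℂ] V := ∑' n : ℕ, (invSqrtCoeff n : ℂ) • B ^ n

omit [CompleteSpace V] in
theorem norm_pow_le_of_norm_le {B : V →L[ℂ] V} {r : ℝ} (h : ‖B‖ ≤ r) (n : ℕ) : ‖B ^ n‖ ≤ r ^ n := by
  induction n with
  | zero => exact ContinuousLinearMap.norm_id_le.trans (by simp)
  | succ n ih =>
    rw [pow_succ, pow_succ]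
    exact (norm_mul_le _ _).trans (mul_le_mul ih h (norm_nonneg _)
      (pow_nonneg ((norm_nonneg _).trans h) _))

omit [CompleteSpace V] in
theorem norm_invSqrtTerm_le {B : V →L[ℂ] V} {r : ℝ} (h : ‖B‖ ≤ r) (n : ℕ) :
    ‖(invSqrtCoeff n : ℂ) • B ^ n‖ ≤ |invSqrtCoeff n| * r ^ n := by
  rw [norm_smul, Complex.norm_real, Real.norm_eq_abs]
  exact mul_le_mul_of_nonneg_left (norm_pow_le_of_norm_le h n) (abs_nonneg _)

theorem hasSum_invSqrtSeries {B : V →L[ℂ] V} {r : ℝ} (h : ‖B‖ ≤ r) (hr : r < 1) :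
    HasSum (fun n : ℕ => (invSqrtCoeff n : ℂ) • B ^ n) (invSqrtSeries B) :=
  ((summable_abs_invSqrtCoeff ((norm_nonneg _).trans h) hr).of_norm_bounded
    (norm_invSqrtTerm_le h)).hasSum

omit [CompleteSpace V] in
theorem norm_invSqrtSeries_le {B : V →L[ℂ] V} {r : ℝ} (h : ‖B‖ ≤ r) (hr : r < 1) :
    ‖invSqrtSeries B‖ ≤ ∑' n, |invSqrtCoeff n| * r ^ n :=
  tsum_of_norm_bounded (summable_abs_invSqrtCoeff ((norm_nonneg _).trans h) hr).hasSum
    (norm_invSqrtTerm_le h)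

/-- The reason for using a series: off the real axis the symbol is no longer self-adjoint and the
functional calculus is not available, but the series still converges locally uniformly and is
holomorphic. -/
theorem differentiableOn_invSqrtSeries {B : ℂ → V →L[ℂ] V} {U : Set ℂ} (hU : IsOpen U)
    (hB : DifferentiableOn ℂ B U) {r : ℝ} (h0 : 0 ≤ r) (hr : r < 1) (h : ∀ z ∈ U, ‖B z‖ ≤ r) :
    DifferentiableOn ℂ (fun z => invSqrtSeries (B z)) U :=
  Complex.differentiableOn_tsum_of_summable_norm (summable_abs_invSqrtCoeff h0 hr)
    (fun n => (hB.fun_pow n).fun_const_smul _) hU fun n z hz => norm_invSqrtTerm_le (h z hz) n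

/-- The inverse square root given by the functional calculus is the sum of the power series. -/
theorem cfc_invSqrt_eq {A : V →L[ℂ] V} (hA : IsSelfAdjoint A) {s r : ℝ} (hs : 0 < s) (hr : r < 1)
    (h : ‖1 - (s⁻¹ : ℂ) • A‖ ≤ r) :
    cfc (fun x : ℝ => x ^ (-(1 / 2) : ℝ)) A =
      ((s ^ (-(1 / 2) : ℝ) : ℝ) : ℂ) • invSqrtSeries (1 - (s⁻¹ : ℂ) • A) := by
  have h0 : 0 ≤ r := (norm_nonneg _).trans h
  have hsa : IsSelfAdjoint (1 - (s⁻¹ : ℂ) • A) := by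
    refine (IsSelfAdjoint.one _).sub (IsSelfAdjoint.smul ?_ hA)
    rw [isSelfAdjoint_iff, Complex.star_def, map_inv₀, Complex.conj_ofReal]
  have hspec : ∀ x ∈ spectrum ℝ A, |1 - s⁻¹ * x| ≤ r := by
    intro x hx
    have e : (1 - (s⁻¹ : ℂ) • A) = cfc (fun x : ℝ => 1 - s⁻¹ * x) A := by
      rw [cfc_sub (fun _ => (1 : ℝ)) (fun x => s⁻¹ * x) A, cfc_const_one ℝ A,
        cfc_const_mul s⁻¹ (fun x => x) A, cfc_id' ℝ A]
      congr 1
      rw [← Complex.ofReal_inv]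
      exact Complex.coe_smul _ _
    have := norm_apply_le_norm_cfc (fun x : ℝ => 1 - s⁻¹ * x) A hx
    rw [← e] at this
    exact this.trans h
  let F : Finset ℕ → ℝ → ℝ := fun t x => ∑ n ∈ t, s ^ (-(1 / 2) : ℝ) * (invSqrtCoeff n * (1 - s⁻¹ * x) ^ n)
  have hval : ∀ x ∈ spectrum ℝ A, x ^ (-(1 / 2) : ℝ) =
      ∑' n, s ^ (-(1 / 2) : ℝ) * (invSqrtCoeff n * (1 - s⁻¹ * x) ^ n) := by
    intro x hx
    have hlt := (hspec x hx).trans_lt hr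
    rw [tsum_mul_left, (hasSum_invSqrtCoeff hlt).tsum_eq, sub_sub_cancel]
    have hpos : 0 < s⁻¹ * x := by linarith [(abs_lt.1 hlt).2]
    rw [← Real.mul_rpow hs.le hpos.le, mul_inv_cancel_left₀ hs.ne']
  -- Uniform convergence on the spectrum allows the functional calculus to be applied term by term.
  have hunif : TendstoUniformlyOn F (fun x => ∑' n, s ^ (-(1 / 2) : ℝ) *
      (invSqrtCoeff n * (1 - s⁻¹ * x) ^ n)) Filter.atTop (spectrum ℝ A) := by
    refine tendstoUniformlyOn_tsum ((summable_abs_invSqrtCoeff h0 hr).mul_left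
      (s ^ (-(1 / 2) : ℝ))) fun n x hx => ?_
    rw [norm_mul, norm_mul, norm_pow, Real.norm_of_nonneg (Real.rpow_nonneg hs.le _)]
    exact mul_le_mul_of_nonneg_left (mul_le_mul_of_nonneg_left
      (pow_le_pow_left₀ (norm_nonneg _) (hspec x hx) n) (norm_nonneg _)) (Real.rpow_nonneg hs.le _)
  have hlim := tendsto_cfc_fun (a := A) hunif
    (Filter.Eventually.of_forall fun t => by fun_prop)
  rw [← cfc_congr (a := A) (fun x hx => hval x hx)] at hlim
  have hF : ∀ t, cfc (F t) A =
      ∑ n ∈ t, ((s ^ (-(1 / 2) : ℝ) : ℝ) : ℂ) • (invSqrtCoeff n : ℂ) • (1 - (s⁻¹ : ℂ) • A) ^ n := by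
    intro t
    have e : (1 - (s⁻¹ : ℂ) • A) = cfc (fun x : ℝ => 1 - s⁻¹ * x) A := by
      rw [cfc_sub (fun _ => (1 : ℝ)) (fun x => s⁻¹ * x) A, cfc_const_one ℝ A,
        cfc_const_mul s⁻¹ (fun x => x) A, cfc_id' ℝ A]
      congr 1
      rw [← Complex.ofReal_inv]
      exact Complex.coe_smul _ _
    have hFt : F t = ∑ n ∈ t, fun x : ℝ =>
        s ^ (-(1 / 2) : ℝ) * (invSqrtCoeff n * (1 - s⁻¹ * x) ^ n) := by
      ext x
      simp [F]
    rw [hFt, cfc_sum (fun (n : ℕ) (x : ℝ) =>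
      s ^ (-(1 / 2) : ℝ) * (invSqrtCoeff n * (1 - s⁻¹ * x) ^ n)) A t (fun n _ => by fun_prop)]
    refine Finset.sum_congr rfl fun n _ => ?_
    rw [cfc_const_mul _ _ _ (by fun_prop), cfc_const_mul _ _ _ (by fun_prop), e,
      cfc_pow _ _ _ (by fun_prop)]
    simp only [Complex.coe_smul]
  simp only [hF] at hlim
  have h2 := (hasSum_invSqrtSeries h hr).const_smul ((s ^ (-(1 / 2) : ℝ) : ℝ) : ℂ)
  exact tendsto_nhds_unique hlim h2

end Operator

/-! ### Third differences of bounded holomorphic functions -/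

section Differences

variable {G : Type*} [NormedAddCommGroup G] [NormedSpace ℂ G]

/-- Cauchy's estimate on discs of radius `δ` bounds the derivative by `M / δ`, and the mean value
inequality bounds the difference. The outcome has the form of the hypothesis, so that the step can
be repeated. -/
theorem fwdDiff_holomorphic {φ : ℂ → G} {R R' M δ : ℝ} {h : ℂ}
    (hφ : DifferentiableOn ℂ φ (Metric.ball 0 R)) (hM : ∀ z ∈ Metric.ball (0 : ℂ) R, ‖φ z‖ ≤ M)
    (hδ : 0 < δ) (hR : R' + ‖h‖ + δ ≤ R) :
    DifferentiableOn ℂ (fun z => φ (z + h) - φ z) (Metric.ball 0 R') ∧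
      ∀ z ∈ Metric.ball (0 : ℂ) R', ‖φ (z + h) - φ z‖ ≤ M / δ * ‖h‖ := by
  have hsub : ∀ z ∈ Metric.ball (0 : ℂ) R', z + h ∈ Metric.ball (0 : ℂ) (R' + ‖h‖) := by
    intro z hz
    rw [Metric.mem_ball, dist_zero_right] at hz ⊢
    linarith [norm_add_le z h]
  have hsub' : Metric.ball (0 : ℂ) (R' + ‖h‖) ⊆ Metric.ball 0 R :=
    Metric.ball_subset_ball (by linarith)
  have hsub'' : Metric.ball (0 : ℂ) R' ⊆ Metric.ball 0 (R' + ‖h‖) :=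
    Metric.ball_subset_ball (by linarith [norm_nonneg h])
  constructor
  · refine DifferentiableOn.sub (hφ.comp (by fun_prop) fun z hz => hsub' (hsub z hz))
      (hφ.mono (hsub''.trans hsub'))
  · intro z hz
    have hd : ∀ x ∈ Metric.ball (0 : ℂ) (R' + ‖h‖), ‖deriv φ x‖ ≤ M / δ := by
      intro x hx
      have hb : Metric.closedBall x δ ⊆ Metric.ball 0 R := by
        intro w hw
        rw [Metric.mem_ball, dist_zero_right] at hx ⊢
        rw [mem_closedBall_iff_norm] at hw
        have := norm_add_le (w - x) x
        rw [sub_add_cancel] at this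
        linarith
      refine Complex.norm_deriv_le_of_forall_mem_sphere_norm_le hδ
        ((hφ.mono hb).diffContOnCl_ball subset_rfl) fun w hw =>
          hM w (hb (Metric.sphere_subset_closedBall hw))
    have := Convex.norm_image_sub_le_of_norm_deriv_le (𝕜 := ℂ) (f := φ)
      (fun x hx => hφ.differentiableAt (Metric.isOpen_ball.mem_nhds (hsub' hx))) hd
      (convex_ball _ _) (hsub'' hz) (hsub z hz)
    simpa using this

/-- Each of the three differences costs `R / 4` of the radius, `R / 8` for the shift and `R / 8` for
Cauchy's estimate, and `R / 4` remains at the end. -/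
theorem norm_fwdDiff_three_le {φ : ℂ → G} {R M : ℝ} {h : ℂ} (hR : 0 < R)
    (hφ : DifferentiableOn ℂ φ (Metric.ball 0 R)) (hM : ∀ z ∈ Metric.ball (0 : ℂ) R, ‖φ z‖ ≤ M)
    (hh : ‖h‖ ≤ R / 8) :
    ‖((φ (h + h + h) - φ (h + h)) - (φ (h + h) - φ h)) -
      ((φ (h + h) - φ h) - (φ h - φ 0))‖ ≤ M * (8 * ‖h‖ / R) ^ 3 := by
  have hδ : 0 < R / 8 := by linarith
  obtain ⟨d1, b1⟩ := fwdDiff_holomorphic (R' := 3 * R / 4) (h := h) hφ hM hδ (by linarith)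
  obtain ⟨d2, b2⟩ := fwdDiff_holomorphic (R' := R / 2) (h := h) d1 b1 hδ (by linarith)
  obtain ⟨d3, b3⟩ := fwdDiff_holomorphic (R' := R / 4) (h := h) d2 b2 hδ (by linarith)
  have := b3 0 (by simpa using hR)
  simp only [zero_add] at this
  refine this.trans (le_of_eq ?_)
  field_simp

end Differences

end SiteEntropy

namespace SiteEntropy

open MeasureTheory UnitAddTorus

/-- The normalized Haar measure on the circle `ℝ / ℤ`. -/
@[reducible] def circleMeasureSpace : MeasureSpace UnitAddCircle := ⟨AddCircle.haarAddCircle⟩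

attribute [local instance] circleMeasureSpace

theorem isAddHaarMeasure_circle : Measure.IsAddHaarMeasure (volume : Measure UnitAddCircle) :=
  inferInstanceAs (Measure.IsAddHaarMeasure AddCircle.haarAddCircle)

theorem isProbabilityMeasure_circle : IsProbabilityMeasure (volume : Measure UnitAddCircle) :=
  inferInstanceAs (IsProbabilityMeasure AddCircle.haarAddCircle)

attribute [local instance] isAddHaarMeasure_circle isProbabilityMeasure_circle

/-! ### Decay of Fourier coefficients on the torus -/

section Decay

variable {d : ℕ} {G : Type*} [NormedAddCommGroup G] [NormedSpace ℂ G]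

theorem integrable_mFourier_smul {f : UnitAddTorus (Fin d) → G} (hf : Integrable f)
    (z : Fin d → ℤ) : Integrable fun θ => mFourier z θ • f θ := by
  refine hf.bdd_smul 1 (mFourier z).continuous.aestronglyMeasurable
    (Filter.Eventually.of_forall fun θ => ?_)
  exact ((mFourier z).norm_coe_le_norm θ).trans mFourier_norm.le

theorem norm_mFourier_apply (z : Fin d → ℤ) (θ : UnitAddTorus (Fin d)) : ‖mFourier z θ‖ = 1 := by
  simp only [mFourier, ContinuousMap.coe_mk, fourier_apply, norm_prod, Circle.norm_coe,
    Finset.prod_const_one]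

theorem mFourier_apply_add (z : Fin d → ℤ) (θ a : UnitAddTorus (Fin d)) :
    mFourier z (θ + a) = mFourier z θ * mFourier z a := by
  simp only [mFourier, ContinuousMap.coe_mk, Pi.add_apply, fourier_apply, smul_add,
    AddCircle.toCircle_add, Circle.coe_mul, Finset.prod_mul_distrib]

theorem mFourier_single_apply (z : Fin d → ℤ) (j : Fin d) (t : ℝ) :
    mFourier z (Pi.single j (t : UnitAddCircle)) =
      Complex.exp (2 * Real.pi * Complex.I * z j * t) := by
  rw [mFourier, ContinuousMap.coe_mk, Finset.prod_eq_single j]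
  · rw [Pi.single_eq_same, fourier_coe_apply]
    simp
  · intro i _ hij
    rw [Pi.single_eq_of_ne hij, fourier_eval_zero]
  · simp

theorem mFourier_half_period (z : Fin d → ℤ) (j : Fin d) (hz : z j ≠ 0) :
    mFourier z (Pi.single j ((1 / (2 * z j) : ℝ) : UnitAddCircle)) = -1 := by
  rw [mFourier_single_apply, ← Complex.exp_pi_mul_I]
  congr 1
  have : (z j : ℂ) ≠ 0 := by exact_mod_cast hz
  push_cast
  field_simp

omit [NormedSpace ℂ G] in
theorem integrable_translate {f : UnitAddTorus (Fin d) → G} (hf : Integrable f)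
    (a : UnitAddTorus (Fin d)) : Integrable fun θ => f (θ + a) :=
  hf.comp_add_right a

/-- A shift by half a period of the mode `z` reverses its sign, so differencing doubles the
coefficient in size. Smallness of differences thus becomes smallness of the coefficient. -/
theorem mFourierCoeff_fwdDiff {f : UnitAddTorus (Fin d) → G} (hf : Integrable f)
    {z : Fin d → ℤ} {a : UnitAddTorus (Fin d)} (ha : mFourier z a = -1) :
    mFourierCoeff (fun θ => f (θ + a) - f θ) z = (-2 : ℂ) • mFourierCoeff f z := by
  have h1 : ∫ θ, mFourier (-z) θ • f (θ + a) = -∫ θ, mFourier (-z) θ • f θ := by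
    rw [← integral_add_right_eq_self (fun θ => mFourier (-z) θ • f θ) a, ← integral_neg]
    refine integral_congr_ae (Filter.Eventually.of_forall fun θ => ?_)
    have : mFourier (-z) a = -1 := by rw [mFourier_neg, ha]; simp
    simp only [mFourier_apply_add, this, mul_neg, mul_one, neg_smul, neg_neg]
  simp only [mFourierCoeff, smul_sub]
  rw [integral_sub (integrable_mFourier_smul (integrable_translate hf a) _)
    (integrable_mFourier_smul hf _), h1, neg_smul, two_smul]
  abel

theorem norm_mFourierCoeff_le (f : UnitAddTorus (Fin d) → G) (z : Fin d → ℤ) :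
    ‖mFourierCoeff f z‖ ≤ ∫ θ, ‖f θ‖ := by
  refine (norm_integral_le_integral_norm _).trans (le_of_eq ?_)
  simp only [norm_smul, norm_mFourier_apply, one_mul]

/-- Fourier coefficients of a function that extends along coordinate lines to bounded holomorphic
functions on discs of radius comparable to `√q`. -/
theorem norm_mFourierCoeff_le_of_slices {f : UnitAddTorus (Fin d) → G}
    (hf : AEStronglyMeasurable f volume) {M : ℝ} (hM : ∀ θ, ‖f θ‖ ≤ M)
    {q : UnitAddTorus (Fin d) → ℝ} (hq : ∀ᵐ θ, 0 < q θ) {s : ℝ} (hs : 0 < s) (hs3 : s ≤ 3)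
    (hint : Integrable fun θ => q θ ^ (-s / 2)) {r₀ : ℝ} (hr₀ : 0 < r₀)
    (hslice : ∀ θ, 0 < q θ → ∀ j, ∃ φ : ℂ → G,
      DifferentiableOn ℂ φ (Metric.ball 0 (r₀ * √(q θ))) ∧
      (∀ z ∈ Metric.ball (0 : ℂ) (r₀ * √(q θ)), ‖φ z‖ ≤ M) ∧
      ∀ t : ℝ, |t| < r₀ * √(q θ) → φ t = f (θ + Pi.single j (t : UnitAddCircle)))
    (z : Fin d → ℤ) (j : Fin d) (hz : z j ≠ 0) :
    ‖mFourierCoeff f z‖ ≤ M * (∫ θ, q θ ^ (-s / 2)) * (4 / (r₀ * |(z j : ℝ)|)) ^ s := by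
  have hM0 : 0 ≤ M := (norm_nonneg _).trans (hM 0)
  have hfi : Integrable f := Integrable.of_bound hf M (Filter.Eventually.of_forall hM)
  set h : ℝ := 1 / (2 * z j) with hh
  set a : UnitAddTorus (Fin d) := Pi.single j (h : UnitAddCircle) with ha
  have ha1 : mFourier z a = -1 := mFourier_half_period z j hz
  have hzj : 0 < |(z j : ℝ)| := abs_pos.2 (by exact_mod_cast hz)
  have habs : |h| = 1 / (2 * |(z j : ℝ)|) := by
    rw [hh, abs_div, abs_mul]
    norm_num
  set f1 : UnitAddTorus (Fin d) → G := fun θ => f (θ + a) - f θ with hf1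
  set f2 : UnitAddTorus (Fin d) → G := fun θ => f1 (θ + a) - f1 θ with hf2
  set f3 : UnitAddTorus (Fin d) → G := fun θ => f2 (θ + a) - f2 θ with hf3
  have hi1 : Integrable f1 := (integrable_translate hfi a).sub hfi
  have hi2 : Integrable f2 := (integrable_translate hi1 a).sub hi1
  have e3 : mFourierCoeff f3 z = (-8 : ℂ) • mFourierCoeff f z := by
    rw [hf3, mFourierCoeff_fwdDiff hi2 ha1, hf2, mFourierCoeff_fwdDiff hi1 ha1, hf1,
      mFourierCoeff_fwdDiff hfi ha1, smul_smul, smul_smul]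
    norm_num
  -- Let `y` be `8` times the step divided by the radius of the disc at `θ`. The third difference is
  -- at most `M y³` if `y ≤ 1`, and at most `8 M` always; both are below `8 M y ^ s` in their
  -- ranges, since `0 < s ≤ 3`. The remaining power of `q` is integrable by `hint`.
  have hb : ∀ᵐ θ, ‖f3 θ‖ ≤ 8 * M * (4 / (r₀ * |(z j : ℝ)|)) ^ s * q θ ^ (-s / 2) := by
    filter_upwards [hq] with θ hθ
    obtain ⟨φ, hφd, hφM, hφf⟩ := hslice θ hθ j
    have hsq : 0 < √(q θ) := Real.sqrt_pos.2 hθ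
    set R := r₀ * √(q θ) with hR
    have hRpos : 0 < R := by positivity
    set y := 8 * |h| / R with hy
    have hy0 : 0 < y := by rw [hy, habs]; positivity
    have hys : 8 * M * (4 / (r₀ * |(z j : ℝ)|)) ^ s * q θ ^ (-s / 2) = 8 * M * y ^ s := by
      have h1 : y = 4 / (r₀ * |(z j : ℝ)|) * q θ ^ (-(1 : ℝ) / 2) := by
        rw [hy, habs, hR, show (-(1 : ℝ) / 2) = -(1 / 2) by ring, Real.rpow_neg hθ.le,
          ← Real.sqrt_eq_rpow]
        field_simp
        norm_num
      rw [h1, Real.mul_rpow (by positivity) (by positivity), ← Real.rpow_mul hθ.le]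
      ring_nf
    rw [hys]
    rcases le_or_gt y 1 with hy1 | hy1
    · have hhR : |h| ≤ R / 8 := by
        rw [hy, div_le_one hRpos] at hy1
        linarith
      have e1 : f (θ + a) = φ h := (hφf h (by linarith [abs_nonneg h])).symm
      have e2 : f (θ + a + a) = φ (h + h) := by
        rw [show (h : ℂ) + h = ((h + h : ℝ) : ℂ) by push_cast; ring, hφf (h + h)
          (by linarith [abs_add_le h h]), ha, add_assoc, ← Pi.single_add]
        rfl
      have e4 : f (θ + a + a + a) = φ (h + h + h) := by
        rw [show (h : ℂ) + h + h = ((h + h + h : ℝ) : ℂ) by push_cast; ring, hφf (h + h + h)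
          (by linarith [abs_add_le (h + h) h, abs_add_le h h]), ha, add_assoc, add_assoc,
          ← Pi.single_add, ← Pi.single_add, ← add_assoc]
        rfl
      have e0 : f θ = φ 0 := by
        have := hφf 0 (by simpa using hRpos)
        simpa using this.symm
      have := norm_fwdDiff_three_le hRpos hφd hφM (h := (h : ℂ)) (by simpa using hhR)
      simp only [hf3, hf2, hf1, e1, e2, e4, e0]
      refine this.trans ?_
      rw [Complex.norm_real, Real.norm_eq_abs, ← hy]
      have h5 : y ^ 3 ≤ y ^ s := by
        rw [← Real.rpow_natCast]
        exact Real.rpow_le_rpow_of_exponent_ge hy0 hy1 (by exact_mod_cast hs3)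
      have h6 : 0 ≤ y ^ s := by positivity
      nlinarith
    · have h5 : 1 ≤ y ^ s := Real.one_le_rpow hy1.le hs.le
      have b1 : ∀ θ, ‖f1 θ‖ ≤ 2 * M := fun θ => by
        have := norm_sub_le (f (θ + a)) (f θ)
        linarith [hM (θ + a), hM θ]
      have b2 : ∀ θ, ‖f2 θ‖ ≤ 4 * M := fun θ => by
        have := norm_sub_le (f1 (θ + a)) (f1 θ)
        linarith [b1 (θ + a), b1 θ]
      have b3 : ‖f3 θ‖ ≤ 8 * M := by
        have := norm_sub_le (f2 (θ + a)) (f2 θ)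
        linarith [b2 (θ + a), b2 θ]
      nlinarith
  have h1 := norm_mFourierCoeff_le f3 z
  have h2 : ∫ θ, ‖f3 θ‖ ≤ ∫ θ, 8 * M * (4 / (r₀ * |(z j : ℝ)|)) ^ s * q θ ^ (-s / 2) :=
    integral_mono_ae ((integrable_translate hi2 a).sub hi2).norm (hint.const_mul _) hb
  rw [integral_const_mul] at h2
  rw [e3, norm_smul] at h1
  norm_num at h1
  linarith

/-- The decay of `norm_mFourierCoeff_le_of_slices`, in terms of the weight. -/
theorem exists_norm_mFourierCoeff_le_weight {f : UnitAddTorus (Fin d) → G}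
    (hf : AEStronglyMeasurable f volume) {M : ℝ} (hM : ∀ θ, ‖f θ‖ ≤ M)
    {q : UnitAddTorus (Fin d) → ℝ} (hq : ∀ᵐ θ, 0 < q θ) {s : ℝ} (hs : 0 < s) (hs3 : s ≤ 3)
    (hint : Integrable fun θ => q θ ^ (-s / 2)) {r₀ : ℝ} (hr₀ : 0 < r₀)
    (hslice : ∀ θ, 0 < q θ → ∀ j, ∃ φ : ℂ → G,
      DifferentiableOn ℂ φ (Metric.ball 0 (r₀ * √(q θ))) ∧
      (∀ z ∈ Metric.ball (0 : ℂ) (r₀ * √(q θ)), ‖φ z‖ ≤ M) ∧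
      ∀ t : ℝ, |t| < r₀ * √(q θ) → φ t = f (θ + Pi.single j (t : UnitAddCircle))) :
    ∃ c : ℝ, 0 ≤ c ∧ ∀ z : Fin d → ℤ, ‖mFourierCoeff f z‖ ≤ c * weight s z := by
  have hM0 : 0 ≤ M := (norm_nonneg _).trans (hM 0)
  set I := ∫ θ, q θ ^ (-s / 2) with hI
  have hI0 : 0 ≤ I := integral_nonneg_of_ae (by
    filter_upwards [hq] with θ hθ
    positivity)
  refine ⟨M + M * I * (8 / r₀) ^ s, by positivity, fun z => ?_⟩
  rcases eq_or_ne z 0 with rfl | hz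
  · have h1 := norm_mFourierCoeff_le f 0
    have h2 : ∫ θ, ‖f θ‖ ≤ ∫ _ : UnitAddTorus (Fin d), M :=
      integral_mono_of_nonneg (Filter.Eventually.of_forall fun _ => norm_nonneg _)
        (integrable_const M) (Filter.Eventually.of_forall hM)
    rw [integral_const] at h2
    simp only [probReal_univ, one_smul] at h2
    have h3 : 0 ≤ M * I * (8 / r₀) ^ s := by positivity
    simp only [weight, norm_zero, add_zero, Real.one_rpow, mul_one]
    linarith
  · obtain ⟨i, hi⟩ := Function.ne_iff.1 hz
    have hne : Nonempty (Fin d) := ⟨i⟩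
    -- The direction of the largest component gives the best bound, since that component equals the
    -- sup norm of `z`.
    obtain ⟨j, hj⟩ := Finite.exists_max fun i => ‖z i‖
    have hnorm : ‖z‖ = |(z j : ℝ)| := by
      refine le_antisymm ((pi_norm_le_iff_of_nonneg (abs_nonneg _)).2 fun i => ?_) ?_
      · exact (hj i).trans (le_of_eq (Int.norm_eq_abs _))
      · rw [← Int.norm_eq_abs]
        exact norm_le_pi_norm z j
    have hzj : z j ≠ 0 := by
      intro h0
      have := hj i
      rw [h0, norm_zero] at this
      exact hi (norm_le_zero_iff.1 this)
    have h1 := norm_mFourierCoeff_le_of_slices hf hM hq hs hs3 hint hr₀ hslice z j hzj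
    have hge : (1 : ℝ) ≤ |(z j : ℝ)| := by exact_mod_cast Int.one_le_abs hzj
    refine h1.trans ?_
    have h2 : (4 / (r₀ * |(z j : ℝ)|)) ^ s ≤ (8 / r₀) ^ s * weight s z := by
      rw [weight, Real.rpow_neg (by positivity), ← Real.inv_rpow (by positivity),
        ← Real.mul_rpow (by positivity) (by positivity)]
      refine Real.rpow_le_rpow (by positivity) ?_ hs.le
      rw [hnorm, ← div_eq_mul_inv, div_div, div_le_div_iff₀ (by positivity) (by positivity)]
      nlinarith
    calc _ ≤ M * I * ((8 / r₀) ^ s * weight s z) := mul_le_mul_of_nonneg_left h2 (by positivity)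
      _ ≤ _ := by
        have := mul_nonneg hM0 (weight_nonneg s z)
        linarith

end Decay

/-! ### Integrability of negative powers of the distance to the origin of the torus -/

theorem measurePreserving_mk_circle :
    MeasurePreserving (QuotientAddGroup.mk : ℝ → UnitAddCircle)
      (volume.restrict (Set.Ioc (-(1 / 2) : ℝ) (-(1 / 2) + 1))) AddCircle.haarAddCircle := by
  have h := AddCircle.measurePreserving_mk 1 (-(1 / 2))
  rwa [AddCircle.volume_eq_smul_haarAddCircle, ENNReal.ofReal_one, one_smul] at h

theorem ae_circle_ne_zero : ∀ᵐ t : UnitAddCircle, t ≠ 0 := by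
  have h := measurePreserving_mk_circle.measure_preimage
    (s := {0}) (measurableSet_singleton _).nullMeasurableSet
  rw [ae_iff]
  simp only [ne_eq, not_not, Set.ofPred_eq_eq_singleton]
  change AddCircle.haarAddCircle {(0 : UnitAddCircle)} = 0
  rw [← h]
  refine measure_mono_null (t := Set.range fun n : ℤ => (n : ℝ)) ?_
    ((Set.countable_range _).measure_zero _)
  intro x hx
  obtain ⟨n, hn⟩ := (AddCircle.coe_eq_zero_iff (p := (1 : ℝ))).1 hx
  exact ⟨n, by simpa using hn⟩

/-- Jordan's inequality for the sine, applied to `|e^{2πit} - 1| = 2 |sin πt|`. -/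
theorem four_mul_abs_le_norm_fourier_sub_one {t : ℝ} (ht : |t| ≤ 1 / 2) :
    4 * |t| ≤ ‖fourier 1 (t : UnitAddCircle) - 1‖ := by
  have e : fourier 1 (t : UnitAddCircle) = Complex.exp (Complex.I * ((2 * Real.pi * t : ℝ) : ℂ)) := by
    rw [fourier_coe_apply]
    congr 1
    push_cast
    simp
    ring
  have h := Real.mul_abs_le_abs_sin (x := Real.pi * t) (by
    rw [abs_mul, abs_of_pos Real.pi_pos]
    nlinarith [Real.pi_pos])
  rw [e, Complex.norm_exp_I_mul_ofReal_sub_one, norm_mul, Real.norm_eq_abs, Real.norm_eq_abs,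
    show 2 * Real.pi * t / 2 = Real.pi * t by ring, abs_two]
  rw [abs_mul, abs_of_pos Real.pi_pos, ← mul_assoc, div_mul_cancel₀ _ Real.pi_pos.ne'] at h
  linarith

theorem integrable_norm_fourier_sub_one_rpow {p : ℝ} (h0 : 0 ≤ p) (hp : p < 1) :
    Integrable (fun t : UnitAddCircle => ‖fourier 1 t - 1‖ ^ (-p)) := by
  have hmeas : Measurable (fun t : UnitAddCircle => ‖fourier 1 t - 1‖ ^ (-p)) :=
    (((fourier 1).continuous.sub continuous_const).norm.measurable).pow_const _
  refine (measurePreserving_mk_circle.integrable_comp hmeas.aestronglyMeasurable).1 ?_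
  have h1 : IntegrableOn (fun t : ℝ => |t| ^ (-p)) (Set.Ioc (-(1 / 2)) (-(1 / 2) + 1)) := by
    have a1 : IntervalIntegrable (fun t : ℝ => |t| ^ (-p)) volume 0 (1 / 2) := by
      refine (intervalIntegral.intervalIntegrable_rpow' (a := 0) (b := 1 / 2)
        (by linarith : -1 < -p)).congr fun t ht => ?_
      rw [Set.uIoc_of_le (by norm_num)] at ht
      simp only [abs_of_pos ht.1]
    have a2 : IntervalIntegrable (fun t : ℝ => |t| ^ (-p)) volume (-(1 / 2)) 0 := by
      have := a1.comp_sub_left 0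
      simp only [zero_sub, abs_neg, neg_zero] at this
      simpa using this.symm
    have := (a2.trans a1).1
    rwa [show (-(1 / 2) : ℝ) + 1 = 1 / 2 by norm_num]
  refine Integrable.mono' h1 (hmeas.comp AddCircle.measurable_mk').aestronglyMeasurable ?_
  filter_upwards [ae_restrict_mem measurableSet_Ioc] with t ht
  have ht' : |t| ≤ 1 / 2 := abs_le.2 ⟨ht.1.le, by linarith [ht.2]⟩
  have h2 := four_mul_abs_le_norm_fourier_sub_one ht'
  rw [Function.comp_apply, Real.norm_of_nonneg (Real.rpow_nonneg (norm_nonneg _) _)]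
  rcases eq_or_ne t 0 with rfl | h3
  · simp
  · have h4 : 0 < |t| := abs_pos.2 h3
    exact Real.rpow_le_rpow_of_nonpos h4 (by linarith) (by linarith)

/-! ### The periodic substitute for `|k|²` -/

section Quadratic

variable {d : ℕ} {ι : Type*} [Fintype ι]

/-- The periodic function `∑_ρ |e^{ik·ρ} - 1|²`, comparable to `|k|²`. -/
def waveSq (r : ι → Fin d → ℤ) (θ : UnitAddTorus (Fin d)) : ℝ :=
  ∑ ρ, ‖mFourier (r ρ) θ - 1‖ ^ 2

theorem waveSq_nonneg (r : ι → Fin d → ℤ) (θ : UnitAddTorus (Fin d)) : 0 ≤ waveSq r θ :=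
  Finset.sum_nonneg fun _ _ => sq_nonneg _

theorem continuous_waveSq (r : ι → Fin d → ℤ) : Continuous (waveSq r) := by
  unfold waveSq
  fun_prop

theorem norm_mFourier_sub_one_le_sqrt (r : ι → Fin d → ℤ) (θ : UnitAddTorus (Fin d)) (ρ : ι) :
    ‖mFourier (r ρ) θ - 1‖ ≤ √(waveSq r θ) :=
  Real.le_sqrt_of_sq_le (Finset.single_le_sum (f := fun ρ => ‖mFourier (r ρ) θ - 1‖ ^ 2)
    (fun _ _ => sq_nonneg _) (Finset.mem_univ ρ))

theorem norm_mFourier_neg_sub_one (z : Fin d → ℤ) (θ : UnitAddTorus (Fin d)) :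
    ‖mFourier (-z) θ - 1‖ = ‖mFourier z θ - 1‖ := by
  rw [mFourier_neg, ← RCLike.norm_conj, map_sub, Complex.conj_conj, map_one]

theorem sqrt_waveSq_le (r : ι → Fin d → ℤ) (θ : UnitAddTorus (Fin d)) :
    √(waveSq r θ) ≤ 2 * √(Fintype.card ι) := by
  have h : waveSq r θ ≤ 2 ^ 2 * Fintype.card ι := by
    have := Finset.sum_le_card_nsmul Finset.univ (fun ρ => ‖mFourier (r ρ) θ - 1‖ ^ 2) (2 ^ 2)
      fun ρ _ => by
        refine pow_le_pow_left₀ (norm_nonneg _) ?_ 2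
        have := norm_sub_le (mFourier (r ρ) θ) 1
        rw [norm_mFourier_apply, norm_one] at this
        linarith
    rw [nsmul_eq_mul, mul_comm] at this
    exact this
  have := Real.sqrt_le_sqrt h
  rwa [Real.sqrt_mul (by norm_num), Real.sqrt_sq (by norm_num)] at this

/-- If the `r_ρ` generate `ℤ^d`, then every `|e^{ik·z} - 1|` is bounded by `waveSq`. -/
theorem exists_norm_mFourier_sub_one_le {r : ι → Fin d → ℤ}
    (hr : AddSubgroup.closure (Set.range r) = ⊤) (z : Fin d → ℤ) :
    ∃ c : ℝ, 0 ≤ c ∧ ∀ θ, ‖mFourier z θ - 1‖ ≤ c * √(waveSq r θ) := by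
  have hz : z ∈ AddSubgroup.closure (Set.range r) := hr ▸ AddSubgroup.mem_top z
  induction hz using AddSubgroup.closure_induction with
  | mem x hx =>
    obtain ⟨ρ, rfl⟩ := hx
    exact ⟨1, zero_le_one, fun θ => by simpa using norm_mFourier_sub_one_le_sqrt r θ ρ⟩
  | zero => exact ⟨0, le_rfl, fun θ => by simp [mFourier_zero]⟩
  | add x y _ _ hx hy =>
    obtain ⟨c, hc, h⟩ := hx
    obtain ⟨c', hc', h'⟩ := hy
    refine ⟨c + c', add_nonneg hc hc', fun θ => ?_⟩
    have e : mFourier (x + y) θ - 1 =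
        mFourier x θ * (mFourier y θ - 1) + (mFourier x θ - 1) := by
      rw [mFourier_add]
      ring
    rw [e]
    refine (norm_add_le _ _).trans ?_
    rw [norm_mul, norm_mFourier_apply, one_mul]
    linarith [h θ, h' θ]
  | neg x _ hx =>
    obtain ⟨c, hc, h⟩ := hx
    exact ⟨c, hc, fun θ => by rw [norm_mFourier_neg_sub_one]; exact h θ⟩

theorem exists_norm_fourier_sub_one_le {r : ι → Fin d → ℤ}
    (hr : AddSubgroup.closure (Set.range r) = ⊤) :
    ∃ c : ℝ, 0 < c ∧ ∀ θ j, ‖fourier 1 (θ j) - 1‖ ≤ c * √(waveSq r θ) := by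
  classical
  choose c hc h using fun j : Fin d => exists_norm_mFourier_sub_one_le hr (Pi.single j 1)
  refine ⟨1 + ∑ j, c j, add_pos_of_pos_of_nonneg one_pos (Finset.sum_nonneg fun j _ => hc j),
    fun θ j => ?_⟩
  have h1 := h j θ
  rw [mFourier_single] at h1
  refine h1.trans (mul_le_mul_of_nonneg_right ?_ (Real.sqrt_nonneg _))
  have := Finset.single_le_sum (f := c) (fun j _ => hc j) (Finset.mem_univ j)
  linarith

theorem ae_torus_ne_zero : ∀ᵐ θ : UnitAddTorus (Fin d), ∀ j, θ j ≠ 0 := by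
  rw [ae_all_iff]
  intro j
  exact (Measure.tendsto_eval_ae_ae (μ := fun _ : Fin d => (volume : Measure UnitAddCircle))
    (i := j)).eventually ae_circle_ne_zero

theorem norm_fourier_sub_one_pos {t : UnitAddCircle} (ht : t ≠ 0) : 0 < ‖fourier 1 t - 1‖ := by
  rw [norm_pos_iff, sub_ne_zero, fourier_one]
  intro h
  refine ht (AddCircle.injective_toCircle one_ne_zero (Circle.coe_injective ?_))
  rw [h, AddCircle.toCircle_zero, Circle.coe_one]

theorem ae_waveSq_pos {r : ι → Fin d → ℤ} (hr : AddSubgroup.closure (Set.range r) = ⊤)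
    (hd : 0 < d) : ∀ᵐ θ, 0 < waveSq r θ := by
  obtain ⟨c, hc, h⟩ := exists_norm_fourier_sub_one_le hr
  filter_upwards [ae_torus_ne_zero] with θ hθ
  have h1 := (norm_fourier_sub_one_pos (hθ ⟨0, hd⟩)).trans_le (h θ ⟨0, hd⟩)
  exact Real.sqrt_pos.1 (pos_of_mul_pos_right h1 hc.le)

/-- Each `|e^{2πiθ_j} - 1|` is bounded by a multiple of `√waveSq`. Distributing the exponent `s`
equally over the `d` coordinates bounds the integrand by a product of one-dimensional singularities
of order `s / d < 1`. -/
theorem integrable_waveSq_rpow {r : ι → Fin d → ℤ}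
    (hr : AddSubgroup.closure (Set.range r) = ⊤) {s : ℝ} (hs : 0 ≤ s) (hsd : s < d) :
    Integrable fun θ => waveSq r θ ^ (-s / 2) := by
  obtain ⟨c, hc, h⟩ := exists_norm_fourier_sub_one_le hr
  have hd0 : (0 : ℝ) < d := hs.trans_lt hsd
  have h1 : Integrable fun θ : UnitAddTorus (Fin d) =>
      ∏ j, ‖fourier 1 (θ j) - 1‖ ^ (-(s / d)) :=
    Integrable.fintype_prod (f := fun _ (t : UnitAddCircle) => ‖fourier 1 t - 1‖ ^ (-(s / d)))
      fun j => integrable_norm_fourier_sub_one_rpow (by positivity) ((div_lt_one hd0).2 hsd)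
  refine Integrable.mono' (h1.const_mul (c ^ s))
    (((continuous_waveSq r).measurable.pow_const _).aestronglyMeasurable) ?_
  filter_upwards [ae_torus_ne_zero, ae_waveSq_pos hr (by exact_mod_cast hd0)] with θ hθ hq
  rw [Real.norm_of_nonneg (Real.rpow_nonneg hq.le _)]
  have hsq : 0 < √(waveSq r θ) := Real.sqrt_pos.2 hq
  have e1 : waveSq r θ ^ (-s / 2) = ∏ _j : Fin d, √(waveSq r θ) ^ (-(s / d)) := by
    rw [Finset.prod_const, Finset.card_univ, Fintype.card_fin, ← Real.rpow_natCast,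
      ← Real.rpow_mul hsq.le, Real.sqrt_eq_rpow, ← Real.rpow_mul hq.le]
    congr 1
    field_simp
  have e2 : c ^ s = ∏ _j : Fin d, c ^ (s / d) := by
    rw [Finset.prod_const, Finset.card_univ, Fintype.card_fin, ← Real.rpow_natCast,
      ← Real.rpow_mul hc.le]
    congr 1
    field_simp
  rw [e1, e2, ← Finset.prod_mul_distrib]
  refine Finset.prod_le_prod (fun j _ => by positivity) fun j _ => ?_
  have hx := norm_fourier_sub_one_pos (hθ j)
  have hle := h θ j
  have hsd0 : 0 ≤ s / d := by positivity
  calc √(waveSq r θ) ^ (-(s / d)) ≤ (c⁻¹ * ‖fourier 1 (θ j) - 1‖) ^ (-(s / d)) := by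
        refine Real.rpow_le_rpow_of_nonpos (by positivity) ?_ (by linarith)
        rw [inv_mul_le_iff₀ hc]
        exact hle
    _ = c ^ (s / d) * ‖fourier 1 (θ j) - 1‖ ^ (-(s / d)) := by
        rw [Real.mul_rpow (by positivity) hx.le, Real.inv_rpow hc.le, Real.rpow_neg hc.le, inv_inv]

end Quadratic

/-! ### Finite differences and Parseval's identity on the torus -/

section Parseval

variable {d : ℕ} {G : Type*} [NormedAddCommGroup G] [NormedSpace ℂ G]

theorem mFourierCoeff_mFourier (z w : Fin d → ℤ) :
    mFourierCoeff (fun θ => mFourier w θ) z = if z = w then 1 else 0 := by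
  rw [← orthonormal_iff_ite.mp (orthonormal_mFourier (d := Fin d)) z w, ContinuousMap.inner_toLp]
  refine integral_congr_ae (Filter.Eventually.of_forall fun θ => ?_)
  simp only [mFourier_neg, smul_eq_mul]
  ring

/-- Multiplication by `e^{-ik·a} - 1` is the finite difference on the Fourier side. -/
theorem mFourierCoeff_diff {f : UnitAddTorus (Fin d) → G} (hf : Integrable f)
    (a z : Fin d → ℤ) :
    mFourierCoeff (fun θ => (mFourier (-a) θ - 1) • f θ) z =
      mFourierCoeff f (z + a) - mFourierCoeff f z := by
  simp only [mFourierCoeff]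
  rw [← integral_sub (integrable_mFourier_smul hf _) (integrable_mFourier_smul hf _)]
  refine integral_congr_ae (Filter.Eventually.of_forall fun θ => ?_)
  simp only [neg_add, mFourier_add, smul_smul, ← sub_smul]
  congr 1
  ring

/-- Parseval's identity for square integrable functions. -/
theorem hasSum_conj_mFourierCoeff_mul {f g : UnitAddTorus (Fin d) → ℂ} (hf : MemLp f 2 volume)
    (hg : MemLp g 2 volume) :
    HasSum (fun z => starRingEnd ℂ (mFourierCoeff f z) * mFourierCoeff g z)
      (∫ θ, starRingEnd ℂ (f θ) * g θ) := by
  have h := hasSum_prod_mFourierCoeff (hf.toLp f) (hg.toLp g)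
  have e : ∀ {u : UnitAddTorus (Fin d) → ℂ} (hu : MemLp u 2 volume) z,
      mFourierCoeff (hu.toLp u) z = mFourierCoeff u z := by
    intro u hu z
    refine integral_congr_ae ?_
    filter_upwards [hu.coeFn_toLp] with θ hθ
    rw [hθ]
  simp only [e hf, e hg] at h
  convert! h using 1
  refine integral_congr_ae ?_
  filter_upwards [hf.coeFn_toLp, hg.coeFn_toLp] with θ h1 h2
  rw [h1, h2]

theorem memLp_two_of_continuous {f : UnitAddTorus (Fin d) → ℂ} (hf : Continuous f) :
    MemLp f 2 volume := by
  obtain ⟨C, hC⟩ := (isCompact_univ (X := UnitAddTorus (Fin d))).exists_bound_of_continuousOn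
    hf.continuousOn
  exact MemLp.of_bound hf.aestronglyMeasurable C
    (Filter.Eventually.of_forall fun θ => hC θ (Set.mem_univ θ))

end Parseval

/-! ### Stability as a pointwise lower bound for the symbol -/

/-- A stable quadratic form with finite differences `v(z + r_ρ) - v(z)` on the lattice `ℤ^d`. -/
structure LatticeForm (d m : ℕ) (ι : Type) [Fintype ι] where
  /-- The interaction range. -/
  r : ι → Fin d → ℤ
  /-- The coefficients. -/
  W : ι → Fin m → ι → Fin m → ℝ
  W_symm : ∀ ρ i σ j, W ρ i σ j = W σ j ρ i
  /-- Reflection of the interaction range. -/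
  refl : ι → ι
  refl_refl : ∀ ρ, refl (refl ρ) = ρ
  r_refl : ∀ ρ, r (refl ρ) = -r ρ
  W_refl : ∀ ρ i σ j, W (refl ρ) i (refl σ) j = W ρ i σ j
  closure_range : AddSubgroup.closure (Set.range r) = ⊤
  /-- The stability constant. -/
  c : ℝ
  c_pos : 0 < c
  stable : ∀ v : (Fin d → ℤ) → Fin m → ℝ, (Function.support v).Finite →
    c * ∑' z, ∑ ρ, ∑ i, (v (z + r ρ) i - v z i) ^ 2 ≤
      ∑' z, ∑ ρ, ∑ σ, ∑ i, ∑ j,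
        W ρ i σ j * ((v (z + r ρ) i - v z i) * (v (z + r σ) j - v z j))

namespace LatticeForm

variable {d m : ℕ} {ι : Type} [Fintype ι] (L : LatticeForm d m ι)

/-- The Fourier symbol of the form, as a function on the torus. -/
def symbol (θ : UnitAddTorus (Fin d)) : Matrix (Fin m) (Fin m) ℂ :=
  Matrix.of fun i j => ∑ ρ, ∑ σ, (L.W ρ i σ j : ℂ) *
    ((mFourier (-L.r ρ) θ - 1) * (mFourier (L.r σ) θ - 1))

/-- With the sign convention of `mFourierCoeff`, Parseval's identity produces `e^{ik·r_ρ}` and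
`e^{-ik·r_σ}`, the opposite of the signs in the symbol. Point symmetry makes the two versions agree.
-/
theorem symbol_eq_reflected (θ : UnitAddTorus (Fin d)) (i j : Fin m) :
    L.symbol θ i j = ∑ ρ, ∑ σ, (L.W ρ i σ j : ℂ) *
      ((mFourier (L.r ρ) θ - 1) * (mFourier (-L.r σ) θ - 1)) := by
  let e : ι ≃ ι := ⟨L.refl, L.refl, L.refl_refl, L.refl_refl⟩
  rw [symbol, Matrix.of_apply, ← e.sum_comp]
  refine Finset.sum_congr rfl fun ρ _ => ?_
  rw [← e.sum_comp]
  refine Finset.sum_congr rfl fun σ _ => ?_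
  change (L.W (L.refl ρ) i (L.refl σ) j : ℂ) *
    ((mFourier (-L.r (L.refl ρ)) θ - 1) * (mFourier (L.r (L.refl σ)) θ - 1)) = _
  rw [L.W_refl, L.r_refl, L.r_refl, neg_neg]

theorem star_symbol (θ : UnitAddTorus (Fin d)) (i j : Fin m) :
    starRingEnd ℂ (L.symbol θ i j) = L.symbol θ j i := by
  rw [symbol, Matrix.of_apply, Matrix.of_apply, map_sum, Finset.sum_comm]
  simp only [map_sum]
  rw [Finset.sum_comm]
  rw [Finset.sum_comm]
  refine Finset.sum_congr rfl fun σ _ => Finset.sum_congr rfl fun ρ _ => ?_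
  rw [map_mul, map_mul, map_sub, map_sub, map_one, Complex.conj_ofReal, ← mFourier_neg,
    ← mFourier_neg, neg_neg, L.W_symm]
  ring

theorem continuous_symbol (i j : Fin m) : Continuous fun θ => L.symbol θ i j := by
  simp only [symbol, Matrix.of_apply]
  fun_prop

theorem finite_diff_support {X : Type*} [Zero X] {f : (Fin d → ℤ) → X}
    (hf : (Function.support f).Finite) :
    ∃ t : Finset (Fin d → ℤ), ∀ z ∉ t, f z = 0 ∧ ∀ ρ, f (z + L.r ρ) = 0 := by
  classical
  have h : (Function.support f ∪ ⋃ ρ, (fun z => z + L.r ρ) ⁻¹' Function.support f).Finite :=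
    hf.union (Set.finite_iUnion fun ρ => hf.preimage (add_left_injective (L.r ρ)).injOn)
  refine ⟨h.toFinset, fun z hz => ?_⟩
  rw [Set.Finite.mem_toFinset] at hz
  constructor
  · by_contra h0
    exact hz (Or.inl h0)
  · intro ρ
    by_contra h0
    exact hz (Or.inr (Set.mem_iUnion.2 ⟨ρ, h0⟩))

/-- The coefficients `W` are real, so the real part of the sesquilinear form is the sum of the real
forms at the real and imaginary parts of `f`. -/
theorem stable_complex {f : (Fin d → ℤ) → Fin m → ℂ} (hf : (Function.support f).Finite) :
    L.c * ∑' z, ∑ ρ, ∑ i, ‖f (z + L.r ρ) i - f z i‖ ^ 2 ≤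
      (∑' z, ∑ ρ, ∑ σ, ∑ i, ∑ j, (L.W ρ i σ j : ℂ) *
        (starRingEnd ℂ (f (z + L.r ρ) i - f z i) * (f (z + L.r σ) j - f z j))).re := by
  obtain ⟨t, ht⟩ := L.finite_diff_support hf
  have hre : (Function.support fun z i => (f z i).re).Finite := hf.subset fun z hz h0 => hz (by
    ext i
    simp [h0])
  have him : (Function.support fun z i => (f z i).im).Finite := hf.subset fun z hz h0 => hz (by
    ext i
    simp [h0])
  have h1 := L.stable _ hre
  have h2 := L.stable _ him
  rw [tsum_eq_sum (s := t) fun z hz => by simp [(ht z hz).1, (ht z hz).2],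
    tsum_eq_sum (s := t) fun z hz => by simp [(ht z hz).1, (ht z hz).2]] at h1 h2
  rw [tsum_eq_sum (s := t) fun z hz => by simp [(ht z hz).1, (ht z hz).2],
    tsum_eq_sum (s := t) fun z hz => by simp [(ht z hz).1, (ht z hz).2]]
  have h3 := add_le_add h1 h2
  rw [← mul_add, ← Finset.sum_add_distrib, ← Finset.sum_add_distrib] at h3
  convert! h3 using 1
  · congr 1
    refine Finset.sum_congr rfl fun z _ => ?_
    rw [← Finset.sum_add_distrib]
    refine Finset.sum_congr rfl fun ρ _ => ?_
    rw [← Finset.sum_add_distrib]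
    refine Finset.sum_congr rfl fun i _ => ?_
    rw [← Complex.normSq_eq_norm_sq, Complex.normSq_apply, Complex.sub_re, Complex.sub_im]
    ring
  · simp only [Complex.re_sum, ← Finset.sum_add_distrib]
    refine Finset.sum_congr rfl fun z _ => Finset.sum_congr rfl fun ρ _ =>
      Finset.sum_congr rfl fun σ _ => Finset.sum_congr rfl fun i _ =>
      Finset.sum_congr rfl fun j _ => ?_
    rw [Complex.re_ofReal_mul, Complex.mul_re, Complex.conj_re, Complex.conj_im, Complex.sub_re,
      Complex.sub_im, Complex.sub_re, Complex.sub_im]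
    ring

/-- The defect of the lower bound for the symbol in the direction `ξ`. -/
def gap (ξ : Fin m → ℂ) (θ : UnitAddTorus (Fin d)) : ℝ :=
  (∑ i, ∑ j, L.symbol θ i j * (starRingEnd ℂ (ξ i) * ξ j)).re -
    L.c * (waveSq L.r θ * ∑ i, ‖ξ i‖ ^ 2)

theorem continuous_gap (ξ : Fin m → ℂ) : Continuous (L.gap ξ) := by
  have h := L.continuous_symbol
  have h' := continuous_waveSq L.r
  unfold gap
  fun_prop

/-- Stability is tested with the finitely supported function `p(z) ξ`, and Parseval's identity turns
both sides into integrals against `|P|²`, where `P` is the trigonometric polynomial of `p`. -/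
theorem integral_gap_trigPoly_nonneg (ξ : Fin m → ℂ) (p : (Fin d → ℤ) →₀ ℂ) :
    0 ≤ ∫ θ, ‖p.sum (fun z a => a • mFourier z θ)‖ ^ 2 * L.gap ξ θ := by
  set P : UnitAddTorus (Fin d) → ℂ := fun θ => p.sum (fun z a => a • mFourier z θ) with hP
  have hPc : Continuous P := by
    simp only [hP, Finsupp.sum]
    fun_prop
  have hcoeff : ∀ z, mFourierCoeff P z = p z := by
    intro z
    simp only [mFourierCoeff, hP, Finsupp.sum, Finset.smul_sum]
    rw [integral_finsetSum _ fun w _ => Continuous.integrable_of_hasCompactSupport (by fun_prop)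
      (HasCompactSupport.of_compactSpace _)]
    have : ∀ w, ∫ θ, mFourier (-z) θ • p w • mFourier w θ = p w * if z = w then 1 else 0 := by
      intro w
      rw [← mFourierCoeff_mFourier, mFourierCoeff, ← integral_const_mul]
      refine integral_congr_ae (Filter.Eventually.of_forall fun θ => ?_)
      simp only [smul_eq_mul]
      ring
    simp only [this]
    rw [Finset.sum_eq_single z]
    · simp
    · intro w _ hw
      simp [Ne.symm hw]
    · intro hz
      simp [Finsupp.notMem_support_iff.1 hz]
  have hPi : Integrable P := hPc.integrable_of_hasCompactSupport (HasCompactSupport.of_compactSpace _)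
  have hdiff : ∀ ρ z, mFourierCoeff (fun θ => (mFourier (-L.r ρ) θ - 1) • P θ) z =
      p (z + L.r ρ) - p z := fun ρ z => by
    rw [mFourierCoeff_diff hPi, hcoeff, hcoeff]
  have hD : ∀ ρ, Continuous fun θ => (mFourier (-L.r ρ) θ - 1) • P θ := fun ρ => by fun_prop
  have hpars : ∀ ρ σ, HasSum (fun z => starRingEnd ℂ (p (z + L.r ρ) - p z) *
      (p (z + L.r σ) - p z)) (∫ θ, ((mFourier (L.r ρ) θ - 1) * (mFourier (-L.r σ) θ - 1)) *
        (‖P θ‖ ^ 2 : ℝ)) := by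
    intro ρ σ
    have h := hasSum_conj_mFourierCoeff_mul (memLp_two_of_continuous (hD ρ))
      (memLp_two_of_continuous (hD σ))
    simp only [hdiff] at h
    convert! h using 1
    refine integral_congr_ae (Filter.Eventually.of_forall fun θ => ?_)
    simp only [smul_eq_mul, map_mul, map_sub, map_one, ← mFourier_neg, neg_neg]
    rw [← Complex.normSq_eq_norm_sq, ← Complex.mul_conj]
    ring
  set f : (Fin d → ℤ) → Fin m → ℂ := fun z i => p z * ξ i with hf
  have hfs : (Function.support f).Finite := p.hasFiniteSupport.subset fun z hz h0 => hz (by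
    ext i
    simp [hf, h0])
  have hst := L.stable_complex hfs
  have hint : ∀ ρ σ, Integrable fun θ => ((mFourier (L.r ρ) θ - 1) * (mFourier (-L.r σ) θ - 1)) *
        ((‖P θ‖ ^ 2 : ℝ) : ℂ) := fun ρ σ =>
    Continuous.integrable_of_hasCompactSupport (by fun_prop) (HasCompactSupport.of_compactSpace _)
  have hA : ∑' z, ∑ ρ, ∑ σ, ∑ i, ∑ j, (L.W ρ i σ j : ℂ) *
      (starRingEnd ℂ (f (z + L.r ρ) i - f z i) * (f (z + L.r σ) j - f z j)) =
      ∫ θ, (∑ i, ∑ j, L.symbol θ i j * (starRingEnd ℂ (ξ i) * ξ j)) * ((‖P θ‖ ^ 2 : ℝ) : ℂ) := by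
    have h1 := hasSum_sum fun ρ (_ : ρ ∈ Finset.univ) => hasSum_sum fun σ (_ : σ ∈ Finset.univ) =>
      hasSum_sum fun i (_ : i ∈ Finset.univ) => hasSum_sum fun j (_ : j ∈ Finset.univ) =>
        (hpars ρ σ).mul_left ((L.W ρ i σ j : ℂ) * (starRingEnd ℂ (ξ i) * ξ j))
    refine Eq.trans ?_ (h1.tsum_eq.trans ?_)
    · refine tsum_congr fun z => Finset.sum_congr rfl fun ρ _ => Finset.sum_congr rfl fun σ _ =>
        Finset.sum_congr rfl fun i _ => Finset.sum_congr rfl fun j _ => ?_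
      simp only [hf, ← sub_mul, map_mul]
      ring
    · simp only [← integral_const_mul]
      simp_rw [← integral_finsetSum Finset.univ fun j _ => (hint _ _).const_mul _]
      simp_rw [← integral_finsetSum Finset.univ fun i _ =>
        integrable_finsetSum Finset.univ fun j _ => (hint _ _).const_mul _]
      simp_rw [← integral_finsetSum Finset.univ fun σ _ =>
        integrable_finsetSum Finset.univ fun i _ =>
        integrable_finsetSum Finset.univ fun j _ => (hint _ _).const_mul _]
      rw [← integral_finsetSum Finset.univ fun ρ _ =>
        integrable_finsetSum Finset.univ fun σ _ => integrable_finsetSum Finset.univ fun i _ =>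
        integrable_finsetSum Finset.univ fun j _ => (hint _ _).const_mul _]
      refine integral_congr_ae (Filter.Eventually.of_forall fun θ => ?_)
      simp only [L.symbol_eq_reflected, Finset.sum_mul]
      rw [Finset.sum_congr rfl fun ρ _ => Finset.sum_comm, Finset.sum_comm]
      refine Finset.sum_congr rfl fun i _ => ?_
      rw [Finset.sum_congr rfl fun ρ _ => Finset.sum_comm, Finset.sum_comm]
      refine Finset.sum_congr rfl fun j _ => Finset.sum_congr rfl fun ρ _ =>
        Finset.sum_congr rfl fun σ _ => ?_
      ring
  have hB : ((∑' z, ∑ ρ, ∑ i, ‖f (z + L.r ρ) i - f z i‖ ^ 2 : ℝ)) =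
      ∫ θ, (waveSq L.r θ * ∑ i, ‖ξ i‖ ^ 2) * ‖P θ‖ ^ 2 := by
    have hre : ∀ ρ, HasSum (fun z => ‖p (z + L.r ρ) - p z‖ ^ 2)
        (∫ θ, ‖mFourier (L.r ρ) θ - 1‖ ^ 2 * ‖P θ‖ ^ 2) := by
      intro ρ
      have h := Complex.hasSum_re (hpars ρ ρ)
      have e : (∫ θ, ((mFourier (L.r ρ) θ - 1) * (mFourier (-L.r ρ) θ - 1)) *
          ((‖P θ‖ ^ 2 : ℝ) : ℂ)) = ((∫ θ, ‖mFourier (L.r ρ) θ - 1‖ ^ 2 * ‖P θ‖ ^ 2 : ℝ) : ℂ) := by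
        rw [← integral_complex_ofReal]
        refine integral_congr_ae (Filter.Eventually.of_forall fun θ => ?_)
        have : mFourier (-L.r ρ) θ - 1 = starRingEnd ℂ (mFourier (L.r ρ) θ - 1) := by
          rw [mFourier_neg, map_sub, map_one]
        simp only [this, Complex.mul_conj, Complex.normSq_eq_norm_sq]
        push_cast
        rfl
      rw [e, Complex.ofReal_re] at h
      refine h.congr_fun fun z => ?_
      rw [mul_comm, Complex.mul_conj, Complex.ofReal_re, Complex.normSq_eq_norm_sq]
    have hint' : ∀ ρ, Integrable fun θ => ‖mFourier (L.r ρ) θ - 1‖ ^ 2 * ‖P θ‖ ^ 2 := fun ρ =>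
      Continuous.integrable_of_hasCompactSupport (by fun_prop) (HasCompactSupport.of_compactSpace _)
    have h1 := hasSum_sum fun ρ (_ : ρ ∈ Finset.univ) => hasSum_sum fun i (_ : i ∈ Finset.univ) =>
        (hre ρ).mul_left (‖ξ i‖ ^ 2)
    refine Eq.trans ?_ (h1.tsum_eq.trans ?_)
    · refine tsum_congr fun z => Finset.sum_congr rfl fun ρ _ => Finset.sum_congr rfl fun i _ => ?_
      simp only [hf, ← sub_mul, norm_mul]
      ring
    · simp only [← integral_const_mul]
      simp_rw [← integral_finsetSum Finset.univ fun i _ => (hint' _).const_mul _]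
      rw [← integral_finsetSum Finset.univ fun ρ _ =>
        integrable_finsetSum Finset.univ fun i _ => (hint' _).const_mul _]
      refine integral_congr_ae (Filter.Eventually.of_forall fun θ => ?_)
      simp only [waveSq, Finset.sum_mul]
      refine Finset.sum_congr rfl fun ρ _ => ?_
      rw [Finset.mul_sum, Finset.sum_mul]
      refine Finset.sum_congr rfl fun i _ => ?_
      ring
  have hsym := L.continuous_symbol
  have hcont : Continuous fun θ => (∑ i, ∑ j, L.symbol θ i j * (starRingEnd ℂ (ξ i) * ξ j)) *
      ((‖P θ‖ ^ 2 : ℝ) : ℂ) := by fun_prop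
  have hintA : Integrable fun θ => (∑ i, ∑ j, L.symbol θ i j * (starRingEnd ℂ (ξ i) * ξ j)) *
      ((‖P θ‖ ^ 2 : ℝ) : ℂ) :=
    hcont.integrable_of_hasCompactSupport (HasCompactSupport.of_compactSpace _)
  have hw := continuous_waveSq L.r
  have hcontB : Continuous fun θ => (waveSq L.r θ * ∑ i, ‖ξ i‖ ^ 2) * ‖P θ‖ ^ 2 := by fun_prop
  have hintB : Integrable fun θ => (waveSq L.r θ * ∑ i, ‖ξ i‖ ^ 2) * ‖P θ‖ ^ 2 :=
    hcontB.integrable_of_hasCompactSupport (HasCompactSupport.of_compactSpace _)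
  rw [hA, hB, ← integral_const_mul, show ∀ z : ℂ, z.re = RCLike.re z from fun _ => rfl,
    ← integral_re hintA] at hst
  rw [← sub_nonneg, ← integral_sub hintA.re (hintB.const_mul _)] at hst
  convert! hst using 1
  refine integral_congr_ae (Filter.Eventually.of_forall fun θ => ?_)
  simp only [gap, RCLike.re_eq_complex_re]
  rw [Complex.re_mul_ofReal]
  ring

/-- Trigonometric polynomials are uniformly dense and the inequality is a closed condition on `P`.
-/
theorem integral_gap_nonneg (ξ : Fin m → ℂ) (P : C(UnitAddTorus (Fin d), ℂ)) :
    0 ≤ ∫ θ, ‖P θ‖ ^ 2 * L.gap ξ θ := by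
  have hg := L.continuous_gap ξ
  obtain ⟨B, hB⟩ := (isCompact_univ (X := UnitAddTorus (Fin d))).exists_bound_of_continuousOn
    hg.continuousOn
  have hclosed : IsClosed {P : C(UnitAddTorus (Fin d), ℂ) | 0 ≤ ∫ θ, ‖P θ‖ ^ 2 * L.gap ξ θ} := by
    refine isClosed_le continuous_const (continuous_iff_continuousAt.2 fun P₀ => ?_)
    refine continuousAt_of_dominated (bound := fun _ => (‖P₀‖ + 1) ^ 2 * B)
      (Filter.Eventually.of_forall fun Q =>
        Continuous.aestronglyMeasurable (by fun_prop)) ?_ (integrable_const _)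
      (Filter.Eventually.of_forall fun θ => Continuous.continuousAt (by fun_prop))
    filter_upwards [Metric.ball_mem_nhds P₀ one_pos] with Q hQ
    refine Filter.Eventually.of_forall fun θ => ?_
    rw [norm_mul, norm_pow, norm_norm]
    have h1 : ‖Q θ‖ ≤ ‖P₀‖ + 1 := by
      rw [mem_ball_iff_norm] at hQ
      have := norm_add_le (Q - P₀) P₀
      rw [sub_add_cancel] at this
      linarith [Q.norm_coe_le_norm θ]
    exact mul_le_mul (pow_le_pow_left₀ (norm_nonneg _) h1 2) (hB θ (Set.mem_univ θ))
      (norm_nonneg _) (by positivity)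
  have hmem : P ∈ (Submodule.span ℂ (Set.range <| mFourier (d := Fin d))).topologicalClosure := by
    rw [span_mFourier_closure_eq_top]
    trivial
  refine closure_minimal (fun Q hQ => ?_) hclosed hmem
  obtain ⟨p, rfl⟩ := (Finsupp.mem_span_range_iff_exists_finsupp).1 hQ
  have := L.integral_gap_trigPoly_nonneg ξ p
  rw [Set.mem_ofPred_eq]
  convert! this using 5 with θ
  simp [Finsupp.sum]

/-- Testing with the negative part of the continuous function `gap` gives minus the integral of its
cube, which would be negative if `gap` were negative somewhere. -/
theorem gap_nonneg (ξ : Fin m → ℂ) (θ : UnitAddTorus (Fin d)) : 0 ≤ L.gap ξ θ := by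
  by_contra hneg
  rw [not_le] at hneg
  have hg := L.continuous_gap ξ
  let P : C(UnitAddTorus (Fin d), ℂ) := ⟨fun θ => ((max (-L.gap ξ θ) 0 : ℝ) : ℂ), by fun_prop⟩
  have h1 := L.integral_gap_nonneg ξ P
  have hpos : 0 < ∫ θ, (max (-L.gap ξ θ) 0) ^ 3 := by
    refine Continuous.integral_pos_of_hasCompactSupport_nonneg_nonzero (x := θ) (by fun_prop)
      (HasCompactSupport.of_compactSpace _) (fun θ => ?_) ?_
    · have : 0 ≤ max (-L.gap ξ θ) 0 := le_max_right _ _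
      simp only [Pi.zero_apply]
      positivity
    · rw [max_eq_left (by linarith)]
      exact pow_ne_zero _ (by linarith)
  have e : ∫ θ, ‖P θ‖ ^ 2 * L.gap ξ θ = -∫ θ, (max (-L.gap ξ θ) 0) ^ 3 := by
    rw [← integral_neg]
    refine integral_congr_ae (Filter.Eventually.of_forall fun θ => ?_)
    simp only [P, ContinuousMap.coe_mk, Complex.norm_real, Real.norm_eq_abs, sq_abs]
    rcases le_total (L.gap ξ θ) 0 with h | h
    · rw [max_eq_left (by linarith)]; ring
    · rw [max_eq_right (by linarith)]; ring
  rw [e] at h1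
  linarith

end LatticeForm

/-! ### Norms and inverse square roots of Hermitian operators -/

section Matrix

variable {m : ℕ}

theorem exists_norm_toEuclideanCLM_le (m : ℕ) :
    ∃ K : ℝ, 0 ≤ K ∧ ∀ (A : Matrix (Fin m) (Fin m) ℂ) (B : ℝ), (∀ i j, ‖A i j‖ ≤ B) →
      ‖Matrix.toEuclideanCLM (𝕜 := ℂ) A‖ ≤ K * B := by
  refine ⟨∑ i : Fin m, ∑ j : Fin m, ‖Matrix.toEuclideanCLM (𝕜 := ℂ) (Matrix.single i j (1 : ℂ))‖,
    by positivity, fun A B hA => ?_⟩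
  have e : Matrix.toEuclideanCLM (𝕜 := ℂ) A =
      ∑ i, ∑ j, A i j • Matrix.toEuclideanCLM (𝕜 := ℂ) (Matrix.single i j (1 : ℂ)) := by
    conv_lhs => rw [Matrix.matrix_eq_sum_single A]
    simp only [map_sum, ← map_smul, Matrix.smul_single, smul_eq_mul, mul_one]
  rw [e, Finset.sum_mul]
  refine (norm_sum_le _ _).trans (Finset.sum_le_sum fun i _ => ?_)
  rw [Finset.sum_mul]
  refine (norm_sum_le _ _).trans (Finset.sum_le_sum fun j _ => ?_)
  rw [norm_smul, mul_comm]
  exact mul_le_mul_of_nonneg_left (hA i j) (norm_nonneg _)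

theorem inner_toEuclideanCLM (A : Matrix (Fin m) (Fin m) ℂ) (ξ η : Amp m) :
    inner ℂ ξ (Matrix.toEuclideanCLM (𝕜 := ℂ) A η) =
      ∑ i, ∑ j, A i j * (starRingEnd ℂ (ξ i) * η j) := by
  have e : ∀ i, (Matrix.toEuclideanCLM (𝕜 := ℂ) A η) i = ∑ j, A i j * η j := fun i => by
    rw [Matrix.ofLp_toEuclideanCLM]
    rfl
  rw [PiLp.inner_apply]
  refine Finset.sum_congr rfl fun i _ => ?_
  rw [e, RCLike.inner_apply, Finset.sum_mul]
  refine Finset.sum_congr rfl fun j _ => ?_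
  ring

/-- The norm of a self-adjoint operator with numerical range in `[0, t]`. -/
theorem norm_le_of_re_inner_mem {V : Type*} [NormedAddCommGroup V] [InnerProductSpace ℂ V]
    [CompleteSpace V] {B : V →L[ℂ] V} (hB : IsSelfAdjoint B) {t : ℝ} (ht : 0 ≤ t)
    (h0 : ∀ ξ, 0 ≤ (inner ℂ ξ (B ξ)).re) (h1 : ∀ ξ, (inner ℂ ξ (B ξ)).re ≤ t * ‖ξ‖ ^ 2) :
    ‖B‖ ≤ t := by
  have hpos : 0 ≤ B := by
    rw [ContinuousLinearMap.nonneg_iff_isPositive, ContinuousLinearMap.isPositive_def']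
    refine ⟨hB, fun ξ => ?_⟩
    rw [ContinuousLinearMap.reApplyInnerSelf_apply, inner_re_symm]
    exact h0 ξ
  rw [CStarAlgebra.norm_le_iff_le_algebraMap B ht hpos, ContinuousLinearMap.le_def,
    ContinuousLinearMap.isPositive_def']
  refine ⟨(IsSelfAdjoint.algebraMap _ (IsSelfAdjoint.all t)).sub hB, fun ξ => ?_⟩
  rw [ContinuousLinearMap.reApplyInnerSelf_apply, ← inner_conj_symm]
  have := h1 ξ
  have e : (algebraMap ℝ (V →L[ℂ] V) t) ξ = (t : ℂ) • ξ := by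
    rw [Algebra.algebraMap_eq_smul_one]
    simp
  simp only [sub_apply, inner_sub_right, e, inner_smul_right, inner_self_eq_norm_sq_to_K,
    RCLike.re_eq_complex_re, Complex.conj_re, Complex.sub_re]
  have e2 : ((t : ℂ) * ((‖ξ‖ : ℝ) : ℂ) ^ 2).re = t * ‖ξ‖ ^ 2 := by
    rw [← Complex.ofReal_pow, ← Complex.ofReal_mul, Complex.ofReal_re]
  have e3 : ((t : ℂ) * ((‖ξ‖ : ℝ) : ℂ) ^ 2).re - (inner ℂ ξ (B ξ)).re ≥ 0 := by
    rw [e2]; linarith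
  exact e3

theorem isSelfAdjoint_one_sub_inv_smul {V : Type*} [NormedAddCommGroup V] [InnerProductSpace ℂ V]
    [CompleteSpace V] {B : V →L[ℂ] V} (hB : IsSelfAdjoint B) (s : ℝ) :
    IsSelfAdjoint (1 - (s : ℂ)⁻¹ • B) := by
  refine (IsSelfAdjoint.one _).sub (IsSelfAdjoint.smul ?_ hB)
  rw [isSelfAdjoint_iff, Complex.star_def, map_inv₀, Complex.conj_ofReal]

/-- The lower bound keeps the spectrum away from `0`, so `x ^ (-1/2)` is continuous on it and the
functional calculus is multiplicative there. -/
theorem cfc_invSqrt_conj {V : Type*} [NormedAddCommGroup V] [InnerProductSpace ℂ V]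
    [CompleteSpace V] {B : V →L[ℂ] V} (hB : IsSelfAdjoint B) {s : ℝ} (hs : 0 < s)
    (h : ∀ ξ, s * ‖ξ‖ ^ 2 ≤ (inner ℂ ξ (B ξ)).re) :
    cfc (fun x : ℝ => x ^ (-(1 / 2) : ℝ)) B * (B * cfc (fun x : ℝ => x ^ (-(1 / 2) : ℝ)) B) = 1 := by
  have hle : algebraMap ℝ (V →L[ℂ] V) s ≤ B := by
    rw [ContinuousLinearMap.le_def, ContinuousLinearMap.isPositive_def']
    refine ⟨hB.sub (IsSelfAdjoint.algebraMap _ (IsSelfAdjoint.all s)), fun ξ => ?_⟩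
    have e : (algebraMap ℝ (V →L[ℂ] V) s) ξ = (s : ℂ) • ξ := by
      rw [Algebra.algebraMap_eq_smul_one]
      simp
    have := h ξ
    rw [ContinuousLinearMap.reApplyInnerSelf_apply, ← inner_conj_symm]
    simp only [sub_apply, inner_sub_right, e, inner_smul_right, inner_self_eq_norm_sq_to_K,
      RCLike.re_eq_complex_re, Complex.conj_re, Complex.sub_re]
    have e2 : ((s : ℂ) * ((‖ξ‖ : ℝ) : ℂ) ^ 2).re = s * ‖ξ‖ ^ 2 := by
      rw [← Complex.ofReal_pow, ← Complex.ofReal_mul, Complex.ofReal_re]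
    have e3 : (inner ℂ ξ (B ξ)).re - ((s : ℂ) * ((‖ξ‖ : ℝ) : ℂ) ^ 2).re ≥ 0 := by
      rw [e2]; linarith
    exact e3
  have hspec : ∀ x ∈ spectrum ℝ B, 0 < x := fun x hx =>
    hs.trans_le ((algebraMap_le_iff_le_spectrum (a := B)).1 hle x hx)
  have hc : ContinuousOn (fun x : ℝ => x ^ (-(1 / 2) : ℝ)) (spectrum ℝ B) := fun x hx =>
    (Real.continuousAt_rpow_const _ _ (Or.inl (hspec x hx).ne')).continuousWithinAt
  have hm : cfc (fun x : ℝ => x ^ (-(1 / 2) : ℝ) * (x * x ^ (-(1 / 2) : ℝ))) B =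
      cfc (fun x : ℝ => x ^ (-(1 / 2) : ℝ)) B * (B * cfc (fun x : ℝ => x ^ (-(1 / 2) : ℝ)) B) := by
    rw [cfc_mul _ (fun x : ℝ => x * x ^ (-(1 / 2) : ℝ)) B hc (continuousOn_id.mul hc),
      cfc_mul (fun x : ℝ => x) _ B continuousOn_id hc, cfc_id' ℝ B hB]
  rw [← hm, ← cfc_one ℝ B hB]
  refine cfc_congr fun x hx => ?_
  have hx0 := hspec x hx
  rw [Pi.one_apply, mul_left_comm, ← Real.rpow_add hx0]
  norm_num
  rw [Real.rpow_neg_one, mul_inv_cancel₀ hx0.ne']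

end Matrix

/-! ### Holomorphic extension of the symbol along coordinate lines -/

namespace LatticeForm

variable {d m : ℕ} {ι : Type} [Fintype ι] (L : LatticeForm d m ι)

/-- The symbol as an operator. -/
def op (θ : UnitAddTorus (Fin d)) : Amp m →L[ℂ] Amp m :=
  Matrix.toEuclideanCLM (𝕜 := ℂ) (L.symbol θ)

/-- The inverse square root of the symbol. -/
def invSqrt (θ : UnitAddTorus (Fin d)) : Amp m →L[ℂ] Amp m :=
  cfc (fun x : ℝ => x ^ (-(1 / 2) : ℝ)) (L.op θ)

theorem isSelfAdjoint_op (θ : UnitAddTorus (Fin d)) : IsSelfAdjoint (L.op θ) := by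
  rw [isSelfAdjoint_iff, op, ← map_star]
  congr 1
  ext i j
  rw [Matrix.star_apply]
  exact L.star_symbol θ j i

theorem re_inner_op_ge (θ : UnitAddTorus (Fin d)) (ξ : Amp m) :
    L.c * waveSq L.r θ * ‖ξ‖ ^ 2 ≤ (inner ℂ ξ (L.op θ ξ)).re := by
  have := L.gap_nonneg ξ θ
  rw [gap] at this
  rw [op, inner_toEuclideanCLM, EuclideanSpace.norm_sq_eq]
  linarith

/-- The holomorphic extension of `t ↦ e^{ik·z}(θ + t e_j)`. -/
def sliceWave (j : Fin d) (θ : UnitAddTorus (Fin d)) (z : Fin d → ℤ) (ζ : ℂ) : ℂ :=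
  mFourier z θ * Complex.exp (2 * Real.pi * Complex.I * z j * ζ)

theorem sliceWave_ofReal (j : Fin d) (θ : UnitAddTorus (Fin d)) (z : Fin d → ℤ) (t : ℝ) :
    sliceWave j θ z t = mFourier z (θ + Pi.single j (t : UnitAddCircle)) := by
  rw [sliceWave, mFourier_apply_add, mFourier_single_apply]

theorem norm_sliceWave_sub_le (j : Fin d) (θ : UnitAddTorus (Fin d)) {z : Fin d → ℤ} {ζ : ℂ}
    {D : ℝ} (hD : 2 * Real.pi * |(z j : ℝ)| ≤ D) (h : D * ‖ζ‖ ≤ 1) :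
    ‖sliceWave j θ z ζ - mFourier z θ‖ ≤ 2 * D * ‖ζ‖ := by
  have hw : ‖2 * Real.pi * Complex.I * z j * ζ‖ ≤ D * ‖ζ‖ := by
    rw [norm_mul]
    refine mul_le_mul_of_nonneg_right (le_trans (le_of_eq ?_) hD) (norm_nonneg _)
    simp [abs_of_pos Real.pi_pos]
  rw [sliceWave, ← mul_sub_one, norm_mul, norm_mFourier_apply, one_mul]
  refine (Complex.norm_exp_sub_one_le (hw.trans h)).trans ?_
  linarith

/-- The holomorphic extension of `t ↦ symbol (θ + t e_j)`. -/
def sliceSymbol (j : Fin d) (θ : UnitAddTorus (Fin d)) (ζ : ℂ) : Matrix (Fin m) (Fin m) ℂ :=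
  Matrix.of fun i k => ∑ ρ, ∑ σ, (L.W ρ i σ k : ℂ) *
    ((sliceWave j θ (-L.r ρ) ζ - 1) * (sliceWave j θ (L.r σ) ζ - 1))

theorem sliceSymbol_ofReal (j : Fin d) (θ : UnitAddTorus (Fin d)) (t : ℝ) :
    L.sliceSymbol j θ t = L.symbol (θ + Pi.single j (t : UnitAddCircle)) := by
  ext i k
  simp only [sliceSymbol, symbol, Matrix.of_apply, sliceWave_ofReal]

theorem sliceSymbol_zero (j : Fin d) (θ : UnitAddTorus (Fin d)) :
    L.sliceSymbol j θ 0 = L.symbol θ := by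
  ext i k
  simp [sliceSymbol, symbol, sliceWave]

theorem differentiable_toEuclideanCLM_sliceSymbol (j : Fin d) (θ : UnitAddTorus (Fin d)) :
    Differentiable ℂ fun ζ => Matrix.toEuclideanCLM (𝕜 := ℂ) (L.sliceSymbol j θ ζ) := by
  have h : ∀ i k, Differentiable ℂ fun ζ => L.sliceSymbol j θ ζ i k := by
    intro i k
    simp only [sliceSymbol, Matrix.of_apply, sliceWave]
    fun_prop
  have e : (fun ζ => Matrix.toEuclideanCLM (𝕜 := ℂ) (L.sliceSymbol j θ ζ)) = fun ζ =>
      ∑ i, ∑ k, L.sliceSymbol j θ ζ i k •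
        Matrix.toEuclideanCLM (𝕜 := ℂ) (Matrix.single i k (1 : ℂ)) := by
    ext1 ζ
    conv_lhs => rw [Matrix.matrix_eq_sum_single (L.sliceSymbol j θ ζ)]
    simp only [map_sum, ← map_smul, Matrix.smul_single, smul_eq_mul, mul_one]
  rw [e]
  fun_prop

theorem exists_sum_abs_coeff_le :
    ∃ Wt : ℝ, 0 ≤ Wt ∧ ∀ i j, ∑ ρ, ∑ σ, |L.W ρ i σ j| ≤ Wt := by
  refine ⟨∑ i, ∑ j, ∑ ρ, ∑ σ, |L.W ρ i σ j|, by positivity, fun i j => ?_⟩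
  refine le_trans ?_ (Finset.single_le_sum (f := fun i => ∑ j, ∑ ρ, ∑ σ, |L.W ρ i σ j|)
    (fun _ _ => by positivity) (Finset.mem_univ i))
  exact Finset.single_le_sum (f := fun j => ∑ ρ, ∑ σ, |L.W ρ i σ j|)
    (fun _ _ => by positivity) (Finset.mem_univ j)

theorem exists_two_pi_mul_abs_le :
    ∃ D : ℝ, 1 ≤ D ∧ ∀ ρ j, 2 * Real.pi * |(L.r ρ j : ℝ)| ≤ D := by
  have hpi := Real.pi_pos
  refine ⟨1 + ∑ ρ, ∑ j, 2 * Real.pi * |(L.r ρ j : ℝ)|, le_add_of_nonneg_right (by positivity),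
    fun ρ j => ?_⟩
  have h1 := Finset.single_le_sum (f := fun j => 2 * Real.pi * |(L.r ρ j : ℝ)|)
    (fun _ _ => by positivity) (Finset.mem_univ j)
  have h2 := Finset.single_le_sum (f := fun ρ => ∑ j, 2 * Real.pi * |(L.r ρ j : ℝ)|)
    (fun _ _ => by positivity) (Finset.mem_univ ρ)
  linarith [h1.trans h2]

theorem norm_sum_coeff_mul_le {Wt : ℝ} (hW : ∀ i j, ∑ ρ, ∑ σ, |L.W ρ i σ j| ≤ Wt) {t : ℝ}
    (ht : 0 ≤ t) {g : ι → ι → ℂ} (hg : ∀ ρ σ, ‖g ρ σ‖ ≤ t) (i j : Fin m) :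
    ‖∑ ρ, ∑ σ, (L.W ρ i σ j : ℂ) * g ρ σ‖ ≤ Wt * t := by
  refine le_trans ?_ (mul_le_mul_of_nonneg_right (hW i j) ht)
  rw [Finset.sum_mul]
  refine (norm_sum_le _ _).trans (Finset.sum_le_sum fun ρ _ => ?_)
  rw [Finset.sum_mul]
  refine (norm_sum_le _ _).trans (Finset.sum_le_sum fun σ _ => ?_)
  rw [norm_mul, Complex.norm_real, Real.norm_eq_abs]
  exact mul_le_mul_of_nonneg_left (hg ρ σ) (abs_nonneg _)

theorem exists_norm_op_le : ∃ C : ℝ, 0 ≤ C ∧ ∀ θ, ‖L.op θ‖ ≤ C * waveSq L.r θ := by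
  obtain ⟨K, hK0, hK⟩ := exists_norm_toEuclideanCLM_le m
  obtain ⟨Wt, hWt0, hWt⟩ := L.exists_sum_abs_coeff_le
  refine ⟨K * Wt, by positivity, fun θ => ?_⟩
  refine (hK (L.symbol θ) (Wt * waveSq L.r θ) fun i k => ?_).trans (le_of_eq (by ring))
  rw [symbol, Matrix.of_apply]
  refine L.norm_sum_coeff_mul_le hWt (waveSq_nonneg _ _) (fun ρ σ => ?_) i k
  rw [norm_mul, norm_mFourier_neg_sub_one, ← Real.mul_self_sqrt (waveSq_nonneg L.r θ)]
  exact mul_le_mul (norm_mFourier_sub_one_le_sqrt _ _ _) (norm_mFourier_sub_one_le_sqrt _ _ _)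
    (norm_nonneg _) (Real.sqrt_nonneg _)

theorem norm_mul_sub_mul_le {a b a₀ b₀ : ℂ} {w t : ℝ} (ht : 0 ≤ t) (ht1 : t ≤ 1) (hw : 0 ≤ w)
    (ha : ‖a - a₀‖ ≤ 2 * t * w) (hb : ‖b - b₀‖ ≤ 2 * t * w) (ha₀ : ‖a₀ - 1‖ ≤ w)
    (hb₀ : ‖b₀ - 1‖ ≤ w) :
    ‖(a - 1) * (b - 1) - (a₀ - 1) * (b₀ - 1)‖ ≤ 8 * t * (w * w) := by
  have e : (a - 1) * (b - 1) - (a₀ - 1) * (b₀ - 1) =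
      (a - a₀) * (b - 1) + (a₀ - 1) * (b - b₀) := by ring
  have hb3 : ‖b - 1‖ ≤ 3 * w := by
    have := norm_add_le (b - b₀) (b₀ - 1)
    rw [sub_add_sub_cancel] at this
    have h2 : t * w ≤ 1 * w := mul_le_mul_of_nonneg_right ht1 hw
    linarith
  rw [e]
  refine (norm_add_le _ _).trans ?_
  rw [norm_mul, norm_mul]
  have h3 := mul_le_mul ha hb3 (norm_nonneg _) (by positivity)
  have h4 := mul_le_mul ha₀ hb (norm_nonneg _) hw
  linarith

/-- With `w = √waveSq`, each factor `e^{ik·r} - 1` has size at most `w` and changes by `O(t w)` on a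
disc of radius `t w`. A product of two factors changes by `O(t w²)`, a small fraction of the size of
the symbol. -/
theorem exists_norm_sliceSymbol_sub_le :
    ∃ C r₁ : ℝ, 0 ≤ C ∧ 0 < r₁ ∧ ∀ θ j ζ t, 0 ≤ t → t ≤ r₁ → ‖ζ‖ ≤ t * √(waveSq L.r θ) →
      ‖Matrix.toEuclideanCLM (𝕜 := ℂ) (L.sliceSymbol j θ ζ) - L.op θ‖ ≤
        C * t * waveSq L.r θ := by
  obtain ⟨K, hK0, hK⟩ := exists_norm_toEuclideanCLM_le m
  obtain ⟨Wt, hWt0, hWt⟩ := L.exists_sum_abs_coeff_le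
  obtain ⟨D, hD1, hD⟩ := L.exists_two_pi_mul_abs_le
  obtain ⟨Q, hQ⟩ : ∃ Q : ℝ, Q = 2 * √(Fintype.card ι) := ⟨_, rfl⟩
  have hQ0 : 0 ≤ Q := by rw [hQ]; positivity
  -- `Q` bounds `√waveSq` on the torus, so this choice makes `D * ‖ζ‖ ≤ 1`, the range in which `e^x
  -- - 1` is linearly bounded.
  refine ⟨K * (Wt * (8 * D)), 1 / (D * (Q + 1)), by positivity, by positivity, ?_⟩
  intro θ j ζ t ht0 ht hζ
  rw [le_div_iff₀ (by positivity)] at ht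
  obtain ⟨w, hw⟩ : ∃ w : ℝ, w = √(waveSq L.r θ) := ⟨_, rfl⟩
  have hw0 : 0 ≤ w := by rw [hw]; exact Real.sqrt_nonneg _
  have hww : w * w = waveSq L.r θ := by rw [hw]; exact Real.mul_self_sqrt (waveSq_nonneg _ _)
  have hwQ : w ≤ Q := by rw [hw, hQ]; exact sqrt_waveSq_le L.r θ
  rw [← hw] at hζ
  have hDt0 : 0 ≤ D * t := by positivity
  have hDt : D * t ≤ 1 := by
    have : 0 ≤ D * t * Q := by positivity
    linarith
  have hDζ : D * ‖ζ‖ ≤ D * t * w := by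
    rw [mul_assoc]
    exact mul_le_mul_of_nonneg_left hζ (by linarith)
  have hDζ1 : D * ‖ζ‖ ≤ 1 := by
    have : D * t * w ≤ D * t * Q := mul_le_mul_of_nonneg_left hwQ hDt0
    linarith
  rw [op, ← map_sub, ← hww]
  refine (hK _ (Wt * (8 * (D * t) * (w * w))) fun i k => ?_).trans (le_of_eq (by ring))
  have e : (L.sliceSymbol j θ ζ - L.symbol θ) i k = ∑ ρ, ∑ σ, (L.W ρ i σ k : ℂ) *
      ((sliceWave j θ (-L.r ρ) ζ - 1) * (sliceWave j θ (L.r σ) ζ - 1) -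
        (mFourier (-L.r ρ) θ - 1) * (mFourier (L.r σ) θ - 1)) := by
    rw [Matrix.sub_apply, sliceSymbol, symbol, Matrix.of_apply, Matrix.of_apply,
      ← Finset.sum_sub_distrib]
    simp only [← Finset.sum_sub_distrib, mul_sub]
  rw [e]
  refine L.norm_sum_coeff_mul_le hWt (by positivity) (fun ρ σ => ?_) i k
  refine norm_mul_sub_mul_le hDt0 hDt hw0 ?_ ?_ ?_ ?_
  · have := norm_sliceWave_sub_le j θ (z := -L.r ρ) (D := D) (by simpa using hD ρ j) hDζ1
    linarith
  · have := norm_sliceWave_sub_le j θ (hD σ j) hDζ1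
    linarith
  · rw [norm_mFourier_neg_sub_one, hw]
    exact norm_mFourier_sub_one_le_sqrt _ _ _
  · rw [hw]
    exact norm_mFourier_sub_one_le_sqrt _ _ _

/-- Divided by `C₁ * waveSq`, the symbol has numerical range in `[2 δ, 1]`: below by stability,
above by the norm bound. -/
theorem norm_one_sub_op_le {C₁ δ : ℝ} (hC₁ : 0 < C₁) (hδ : L.c = 2 * δ * C₁) (hδ1 : 2 * δ ≤ 1)
    {θ : UnitAddTorus (Fin d)} (hq : 0 < waveSq L.r θ) (hop : ‖L.op θ‖ ≤ C₁ * waveSq L.r θ) :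
    ‖1 - ((C₁ * waveSq L.r θ : ℝ) : ℂ)⁻¹ • L.op θ‖ ≤ 1 - 2 * δ := by
  have hCq : 0 < C₁ * waveSq L.r θ := by positivity
  have hsa : IsSelfAdjoint (1 - ((C₁ * waveSq L.r θ : ℝ) : ℂ)⁻¹ • L.op θ) := by
    exact isSelfAdjoint_one_sub_inv_smul (L.isSelfAdjoint_op θ) _
  have hin : ∀ ξ : Amp m, (inner ℂ ξ ((1 - ((C₁ * waveSq L.r θ : ℝ) : ℂ)⁻¹ • L.op θ) ξ)).re =
      ‖ξ‖ ^ 2 - (C₁ * waveSq L.r θ)⁻¹ * (inner ℂ ξ (L.op θ ξ)).re := by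
    intro ξ
    rw [sub_apply, inner_sub_right, Complex.sub_re, smul_apply,
      inner_smul_right, ← Complex.ofReal_inv, Complex.re_ofReal_mul,
      one_apply_eq_self, inner_self_eq_norm_sq_to_K]
    congr 1
    exact (congrArg Complex.re (Complex.ofReal_pow ‖ξ‖ 2).symm).trans (Complex.ofReal_re _)
  refine norm_le_of_re_inner_mem hsa (by linarith) (fun ξ => ?_) fun ξ => ?_
  · rw [hin, sub_nonneg, inv_mul_le_iff₀ hCq]
    refine (Complex.re_le_norm _).trans ((norm_inner_le_norm _ _).trans ?_)
    have := (L.op θ).le_of_opNorm_le hop ξ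
    have := mul_le_mul_of_nonneg_left this (norm_nonneg ξ)
    linarith
  · have h1 := L.re_inner_op_ge θ ξ
    have h2 : (C₁ * waveSq L.r θ)⁻¹ * (L.c * waveSq L.r θ * ‖ξ‖ ^ 2) = 2 * δ * ‖ξ‖ ^ 2 := by
      rw [hδ]; field_simp
    have h3 := mul_le_mul_of_nonneg_left h1 (inv_nonneg.2 hCq.le)
    rw [h2] at h3
    rw [hin]
    linarith

/-- Relative to the scale `C₁ |k|²`, the symbol is a contraction away from the identity, also on
complex discs of radius proportional to `|k|`. -/
theorem exists_contraction :
    ∃ C₁ r r₀ : ℝ, 0 < C₁ ∧ 0 ≤ r ∧ r < 1 ∧ 0 < r₀ ∧ ∀ θ, 0 < waveSq L.r θ → ∀ j ζ,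
      ‖ζ‖ < r₀ * √(waveSq L.r θ) →
        ‖1 - ((C₁ * waveSq L.r θ : ℝ) : ℂ)⁻¹ •
          Matrix.toEuclideanCLM (𝕜 := ℂ) (L.sliceSymbol j θ ζ)‖ ≤ r := by
  obtain ⟨C, hC0, hC⟩ := L.exists_norm_op_le
  obtain ⟨C', r₁, hC'0, hr₁, hC'⟩ := L.exists_norm_sliceSymbol_sub_le
  have hc := L.c_pos
  obtain ⟨C₁, hC₁⟩ : ∃ C₁, C₁ = C + L.c := ⟨_, rfl⟩
  have hC₁0 : 0 < C₁ := by rw [hC₁]; positivity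
  obtain ⟨δ, hδ⟩ : ∃ δ, δ = L.c / (2 * C₁) := ⟨_, rfl⟩
  have hδ0 : 0 < δ := by rw [hδ]; positivity
  have hδ1 : 2 * δ ≤ 1 := by
    rw [hδ, mul_div_assoc', div_le_one (by positivity)]
    linarith
  have hδc : L.c = 2 * δ * C₁ := by rw [hδ]; field_simp
  -- Of the margin `2 δ` available on the torus itself, half is spent on the excursion into the
  -- complex disc.
  refine ⟨C₁, 1 - δ, min r₁ (δ * C₁ / (C' + 1)), hC₁0, by linarith, by linarith,
    lt_min hr₁ (by positivity), fun θ hq j ζ hζ => ?_⟩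
  have hCq : 0 < C₁ * waveSq L.r θ := by positivity
  have hop : ‖L.op θ‖ ≤ C₁ * waveSq L.r θ := (hC θ).trans
    (mul_le_mul_of_nonneg_right (by linarith) hq.le)
  have hB0 := L.norm_one_sub_op_le hC₁0 hδc hδ1 hq hop
  have hdiff := hC' θ j ζ _ (le_min hr₁.le (by positivity)) (min_le_left _ _) hζ.le
  have hle : C' * min r₁ (δ * C₁ / (C' + 1)) * waveSq L.r θ ≤ C₁ * waveSq L.r θ * δ := by
    have h1 : C' * min r₁ (δ * C₁ / (C' + 1)) ≤ δ * C₁ := by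
      refine (mul_le_mul_of_nonneg_left (min_le_right _ _) hC'0).trans ?_
      rw [mul_div_assoc', div_le_iff₀ (by positivity)]
      have : 0 ≤ δ * C₁ := by positivity
      linarith
    have := mul_le_mul_of_nonneg_right h1 hq.le
    linarith
  have e : 1 - ((C₁ * waveSq L.r θ : ℝ) : ℂ)⁻¹ •
      Matrix.toEuclideanCLM (𝕜 := ℂ) (L.sliceSymbol j θ ζ) =
      (1 - ((C₁ * waveSq L.r θ : ℝ) : ℂ)⁻¹ • L.op θ) - ((C₁ * waveSq L.r θ : ℝ) : ℂ)⁻¹ •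
        (Matrix.toEuclideanCLM (𝕜 := ℂ) (L.sliceSymbol j θ ζ) - L.op θ) := by
    rw [smul_sub]; abel
  rw [e]
  refine (norm_sub_le _ _).trans ?_
  have h6 : ‖((C₁ * waveSq L.r θ : ℝ) : ℂ)⁻¹ •
      (Matrix.toEuclideanCLM (𝕜 := ℂ) (L.sliceSymbol j θ ζ) - L.op θ)‖ ≤ δ := by
    rw [norm_smul, norm_inv, Complex.norm_real, Real.norm_of_nonneg hCq.le, inv_mul_le_iff₀ hCq]
    exact hdiff.trans hle
  linarith

theorem isSelfAdjoint_invSqrt (θ : UnitAddTorus (Fin d)) : IsSelfAdjoint (L.invSqrt θ) :=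
  cfc_predicate _ _

theorem invSqrt_mul_op_mul_invSqrt {θ : UnitAddTorus (Fin d)} (hq : 0 < waveSq L.r θ) :
    L.invSqrt θ * (L.op θ * L.invSqrt θ) = 1 :=
  cfc_invSqrt_conj (L.isSelfAdjoint_op θ) (mul_pos L.c_pos hq) (L.re_inner_op_ge θ)

end LatticeForm

/-! ### The symbols of `F` and of its finite differences -/

namespace LatticeForm

variable {d m : ℕ} {ι : Type} [Fintype ι] (L : LatticeForm d m ι)

/-- The holomorphic extension of the inverse square root along a coordinate direction. -/
def sliceInvSqrt (C₁ : ℝ) (j : Fin d) (θ : UnitAddTorus (Fin d)) (ζ : ℂ) : Amp m →L[ℂ] Amp m :=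
  (((C₁ * waveSq L.r θ) ^ (-(1 / 2) : ℝ) : ℝ) : ℂ) •
    invSqrtSeries (1 - ((C₁ * waveSq L.r θ : ℝ) : ℂ)⁻¹ •
      Matrix.toEuclideanCLM (𝕜 := ℂ) (L.sliceSymbol j θ ζ))

theorem mul_rpow_neg_half {C q : ℝ} (hC : 0 < C) (hq : 0 < q) :
    (C * q) ^ (-(1 / 2) : ℝ) = (√C)⁻¹ * (√q)⁻¹ := by
  rw [Real.rpow_neg (by positivity), ← Real.sqrt_eq_rpow, Real.sqrt_mul hC.le, mul_inv]

/-- By `exists_contraction` the series of `(1 - B)^{-1/2}` converges uniformly on the whole disc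
after rescaling by `C₁ * waveSq`; undoing the rescaling contributes the factor `(√waveSq)⁻¹`. -/
theorem exists_sliceInvSqrt : ∃ C₁ r₀ B : ℝ, 0 < C₁ ∧ 0 < r₀ ∧ 0 ≤ B ∧
    ∀ θ, 0 < waveSq L.r θ → ∀ j,
      DifferentiableOn ℂ (L.sliceInvSqrt C₁ j θ) (Metric.ball 0 (r₀ * √(waveSq L.r θ))) ∧
      (∀ ζ, ‖ζ‖ < r₀ * √(waveSq L.r θ) →
        ‖L.sliceInvSqrt C₁ j θ ζ‖ ≤ B * (√(waveSq L.r θ))⁻¹) ∧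
      ∀ t : ℝ, |t| < r₀ * √(waveSq L.r θ) →
        L.sliceInvSqrt C₁ j θ t = L.invSqrt (θ + Pi.single j (t : UnitAddCircle)) := by
  obtain ⟨C₁, r, r₀, hC₁, hr0, hr1, hr₀, h⟩ := L.exists_contraction
  refine ⟨C₁, r₀, (√C₁)⁻¹ * ∑' n, |invSqrtCoeff n| * r ^ n, hC₁, hr₀, ?_, fun θ hq j =>
    ⟨?_, fun ζ hζ => ?_, fun t ht => ?_⟩⟩
  · exact mul_nonneg (by positivity) (tsum_nonneg fun n => by positivity)
  · have hd : DifferentiableOn ℂ (fun ζ => invSqrtSeries (1 - ((C₁ * waveSq L.r θ : ℝ) : ℂ)⁻¹ •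
        Matrix.toEuclideanCLM (𝕜 := ℂ) (L.sliceSymbol j θ ζ)))
        (Metric.ball 0 (r₀ * √(waveSq L.r θ))) := by
      refine differentiableOn_invSqrtSeries Metric.isOpen_ball ?_ hr0 hr1 fun ζ hζ =>
        h θ hq j ζ (mem_ball_zero_iff.1 hζ)
      exact ((differentiable_const _).sub
        ((L.differentiable_toEuclideanCLM_sliceSymbol j θ).const_smul
          (((C₁ * waveSq L.r θ : ℝ) : ℂ)⁻¹))).differentiableOn
    exact hd.const_smul (((C₁ * waveSq L.r θ) ^ (-(1 / 2) : ℝ) : ℝ) : ℂ)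
  · rw [sliceInvSqrt, norm_smul, Complex.norm_real, Real.norm_of_nonneg (by positivity),
      mul_rpow_neg_half hC₁ hq, mul_right_comm]
    exact mul_le_mul_of_nonneg_right (mul_le_mul_of_nonneg_left
      (norm_invSqrtSeries_le (h θ hq j ζ hζ) hr1) (by positivity)) (by positivity)
  · have hc := h θ hq j t (by rwa [Complex.norm_real])
    rw [sliceSymbol_ofReal] at hc
    rw [sliceInvSqrt, sliceSymbol_ofReal, invSqrt,
      cfc_invSqrt_eq (L.isSelfAdjoint_op _) (mul_pos hC₁ hq) hr1 hc]
    rfl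

theorem exists_norm_invSqrt_le (hd : 0 < d) :
    ∃ B : ℝ, 0 ≤ B ∧ ∀ θ, 0 < waveSq L.r θ → ‖L.invSqrt θ‖ ≤ B * (√(waveSq L.r θ))⁻¹ := by
  obtain ⟨C₁, r₀, B, hC₁, hr₀, hB, h⟩ := L.exists_sliceInvSqrt
  refine ⟨B, hB, fun θ hq => ?_⟩
  obtain ⟨-, h2, h3⟩ := h θ hq ⟨0, hd⟩
  have e := h3 0 (by rw [abs_zero]; exact mul_pos hr₀ (Real.sqrt_pos.2 hq))
  have b := h2 0 (by rw [norm_zero]; exact mul_pos hr₀ (Real.sqrt_pos.2 hq))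
  rw [Complex.ofReal_zero] at e
  rw [e] at b
  simpa using b

theorem continuous_op : Continuous L.op := by
  have h : ∀ i k, Continuous fun θ => L.symbol θ i k := fun i k => L.continuous_symbol i k
  have e : L.op = fun θ =>
      ∑ i, ∑ k, L.symbol θ i k •
        Matrix.toEuclideanCLM (𝕜 := ℂ) (Matrix.single i k (1 : ℂ)) := by
    ext1 θ
    rw [op]
    conv_lhs => rw [Matrix.matrix_eq_sum_single (L.symbol θ)]
    simp only [map_sum, ← map_smul, Matrix.smul_single, smul_eq_mul, mul_one]
  rw [e]
  exact continuous_finsetSum _ fun i _ => continuous_finsetSum _ fun k _ =>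
    (h i k).smul continuous_const

/-- Where `waveSq` is positive, that is almost everywhere, the functional calculus is a limit of
polynomials in the continuous function `op` with measurable scalar factors. -/
theorem aestronglyMeasurable_invSqrt (hd : 0 < d) : AEStronglyMeasurable L.invSqrt := by
  obtain ⟨C₁, r, r₀, hC₁, hr0, hr1, hr₀, h⟩ := L.exists_contraction
  have hs : AEStronglyMeasurable fun θ => C₁ * waveSq L.r θ :=
    (continuous_const.mul (continuous_waveSq L.r)).aestronglyMeasurable
  have hm : ∀ f : ℝ → ℂ, Measurable f → AEStronglyMeasurable fun θ => f (C₁ * waveSq L.r θ) :=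
    fun f hf => (hf.comp_aemeasurable hs.aemeasurable).aestronglyMeasurable
  refine aestronglyMeasurable_of_tendsto_ae Filter.atTop
    (f := fun N θ => (((C₁ * waveSq L.r θ) ^ (-(1 / 2) : ℝ) : ℝ) : ℂ) •
      ∑ n ∈ Finset.range N, (invSqrtCoeff n : ℂ) •
        (1 - ((C₁ * waveSq L.r θ : ℝ) : ℂ)⁻¹ • L.op θ) ^ n) (fun N => ?_) ?_
  · refine (hm (fun x => ((x ^ (-(1 / 2) : ℝ) : ℝ) : ℂ)) (by fun_prop)).smul ?_
    refine Finset.aestronglyMeasurable_fun_sum _ fun n _ => ?_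
    have h1 : AEStronglyMeasurable fun θ => ((C₁ * waveSq L.r θ : ℝ) : ℂ)⁻¹ • L.op θ :=
      (hm (fun x => ((x : ℝ) : ℂ)⁻¹) (by fun_prop)).smul L.continuous_op.aestronglyMeasurable
    have h2 : AEStronglyMeasurable fun θ =>
        (1 - ((C₁ * waveSq L.r θ : ℝ) : ℂ)⁻¹ • L.op θ : Amp m →L[ℂ] Amp m) :=
      aestronglyMeasurable_const.sub h1
    exact (h2.pow n).const_smul (invSqrtCoeff n : ℂ)
  · filter_upwards [ae_waveSq_pos L.closure_range hd] with θ hq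
    have hc := h θ hq ⟨0, hd⟩ 0 (by rw [norm_zero]; exact mul_pos hr₀ (Real.sqrt_pos.2 hq))
    rw [sliceSymbol_zero] at hc
    rw [invSqrt, cfc_invSqrt_eq (L.isSelfAdjoint_op _) (mul_pos hC₁ hq) hr1 hc]
    exact ((hasSum_invSqrtSeries hc hr1).tendsto_sum_nat).const_smul _

/-- The symbol of the inverse square root followed by a finite difference. -/
def diffSymbol (z : Fin d → ℤ) (θ : UnitAddTorus (Fin d)) : Amp m →L[ℂ] Amp m :=
  (mFourier (-z) θ - 1) • L.invSqrt θ

theorem aestronglyMeasurable_diffSymbol (hd : 0 < d) (z : Fin d → ℤ) :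
    AEStronglyMeasurable (L.diffSymbol z) :=
  AEStronglyMeasurable.smul (f := fun θ => mFourier (-z) θ - 1)
    ((by fun_prop : Continuous fun θ => mFourier (-z) θ - 1).aestronglyMeasurable)
    (L.aestronglyMeasurable_invSqrt hd)

/-- The first order zero of `e^{-ik·z} - 1` at the origin compensates the singularity `|k|^{-1}` of
the inverse square root, on the torus and on the complex discs. -/
theorem exists_diffSymbol_bound (hd : 0 < d) (z : Fin d → ℤ) : ∃ M r₀ : ℝ, 0 < r₀ ∧
    (∀ θ, ‖L.diffSymbol z θ‖ ≤ M) ∧ ∀ θ, 0 < waveSq L.r θ → ∀ j, ∃ φ : ℂ → Amp m →L[ℂ] Amp m,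
      DifferentiableOn ℂ φ (Metric.ball 0 (r₀ * √(waveSq L.r θ))) ∧
      (∀ ζ ∈ Metric.ball 0 (r₀ * √(waveSq L.r θ)), ‖φ ζ‖ ≤ M) ∧
      ∀ t : ℝ, |t| < r₀ * √(waveSq L.r θ) →
        φ t = L.diffSymbol z (θ + Pi.single j (t : UnitAddCircle)) := by
  obtain ⟨C₁, r₁, B, hC₁, hr₁, hB, h⟩ := L.exists_sliceInvSqrt
  obtain ⟨B', hB', h'⟩ := L.exists_norm_invSqrt_le hd
  obtain ⟨c, hc, hcw⟩ := exists_norm_mFourier_sub_one_le L.closure_range (-z)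
  obtain ⟨D, hD⟩ : ∃ D : ℝ, D = 1 + ∑ j, 2 * Real.pi * |(z j : ℝ)| := ⟨_, rfl⟩
  have hD1 : 1 ≤ D := by
    rw [hD]
    exact le_add_of_nonneg_right (by have := Real.pi_pos; positivity)
  have hDz : ∀ j, 2 * Real.pi * |((-z) j : ℝ)| ≤ D := fun j => by
    have hpi := Real.pi_pos
    have := Finset.single_le_sum (f := fun j => 2 * Real.pi * |(z j : ℝ)|)
      (fun _ _ => by positivity) (Finset.mem_univ j)
    rw [Pi.neg_apply, Int.cast_neg, abs_neg, hD]
    linarith [this]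
  obtain ⟨Q, hQ⟩ : ∃ Q : ℝ, Q = 2 * √(Fintype.card ι) := ⟨_, rfl⟩
  have hQ0 : 0 ≤ Q := by rw [hQ]; positivity
  obtain ⟨r₀, hr₀⟩ : ∃ r₀ : ℝ, r₀ = min r₁ (1 / (D * (Q + 1))) := ⟨_, rfl⟩
  have hr₀0 : 0 < r₀ := by rw [hr₀]; exact lt_min hr₁ (by positivity)
  have hr₀1 : r₀ ≤ r₁ := by rw [hr₀]; exact min_le_left _ _
  have hr₀2 : r₀ * (D * (Q + 1)) ≤ 1 := by
    rw [← le_div_iff₀ (by positivity), hr₀]; exact min_le_right _ _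
  have key : ∀ {w x y A E : ℝ}, 0 < w → 0 ≤ E → 0 ≤ y → x ≤ A * w → y ≤ E * w⁻¹ → 0 ≤ A →
      x * y ≤ A * E := by
    intro w x y A E hw hE hy hx hy' hA
    refine (mul_le_mul hx hy' hy (by positivity)).trans (le_of_eq ?_)
    field_simp
  refine ⟨max (c * B') ((c + 2 * D * r₀) * B), r₀, hr₀0, fun θ => ?_, fun θ hq j =>
    ⟨fun ζ => (sliceWave j θ (-z) ζ - 1) • L.sliceInvSqrt C₁ j θ ζ, ?_, fun ζ hζ => ?_,
      fun t ht => ?_⟩⟩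
  · refine le_max_of_le_left ?_
    rw [diffSymbol, norm_smul]
    -- Where `waveSq` vanishes so does `e^{-ik·z} - 1`; the value that the functional calculus
    -- assigns to the inverse square root there is irrelevant.
    rcases (waveSq_nonneg L.r θ).eq_or_lt with hq | hq
    · have := hcw θ
      rw [← hq, Real.sqrt_zero, mul_zero] at this
      rw [le_antisymm this (norm_nonneg _), zero_mul]
      positivity
    · exact key (Real.sqrt_pos.2 hq) hB' (norm_nonneg _) (hcw θ) (h' θ hq) hc
  · have h1 : Differentiable ℂ fun ζ => sliceWave j θ (-z) ζ - 1 := by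
      unfold sliceWave
      fun_prop
    have h2 := (h θ hq j).1.mono (Metric.ball_subset_ball
      (mul_le_mul_of_nonneg_right hr₀1 (Real.sqrt_nonneg (waveSq L.r θ))))
    exact h1.differentiableOn.smul h2
  · refine le_max_of_le_right ?_
    rw [mem_ball_zero_iff] at hζ
    have hw := Real.sqrt_pos.2 hq
    have hwQ : √(waveSq L.r θ) ≤ Q := by rw [hQ]; exact sqrt_waveSq_le L.r θ
    rw [norm_smul]
    refine key hw hB (norm_nonneg _) ?_ ((h θ hq j).2.1 ζ (hζ.trans_le
      (mul_le_mul_of_nonneg_right hr₀1 hw.le))) (by positivity)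
    have h1 : D * ‖ζ‖ ≤ 1 := by
      have e1 : r₀ * √(waveSq L.r θ) ≤ r₀ * (Q + 1) :=
        mul_le_mul_of_nonneg_left (by linarith) hr₀0.le
      have e2 := mul_le_mul_of_nonneg_left (hζ.le.trans e1) (by linarith : 0 ≤ D)
      linarith
    have h2 := norm_sliceWave_sub_le j θ (hDz j) h1
    have h3 := norm_add_le (sliceWave j θ (-z) ζ - mFourier (-z) θ) (mFourier (-z) θ - 1)
    rw [sub_add_sub_cancel] at h3
    have h4 := hcw θ
    have h5 : 2 * D * ‖ζ‖ ≤ 2 * D * (r₀ * √(waveSq L.r θ)) :=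
      mul_le_mul_of_nonneg_left hζ.le (by linarith)
    linarith
  · have := (h θ hq j).2.2 t (ht.trans_le (mul_le_mul_of_nonneg_right hr₀1 (Real.sqrt_nonneg _)))
    simp only
    rw [sliceWave_ofReal, this, diffSymbol]

theorem exists_norm_mFourierCoeff_diffSymbol_le (hd : 0 < d) {s : ℝ} (hs : 0 < s) (hsd : s < d)
    (hs3 : s ≤ 3) (z : Fin d → ℤ) :
    ∃ c, 0 ≤ c ∧ ∀ n, ‖mFourierCoeff (L.diffSymbol z) n‖ ≤ c * weight s n := by
  obtain ⟨M, r₀, hr₀, h1, h2⟩ := L.exists_diffSymbol_bound hd z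
  exact exists_norm_mFourierCoeff_le_weight (L.aestronglyMeasurable_diffSymbol hd z) h1
    (ae_waveSq_pos L.closure_range hd) hs hs3
    (integrable_waveSq_rpow L.closure_range hs.le hsd) hr₀ h2

/-- The singularity is of order `|k|^{-1}`, integrable from dimension two on. -/
theorem integrable_invSqrt (hd : 1 < d) : Integrable L.invSqrt := by
  obtain ⟨B, hB, h⟩ := L.exists_norm_invSqrt_le (by omega)
  refine ((integrable_waveSq_rpow L.closure_range zero_le_one
    (by exact_mod_cast hd : (1 : ℝ) < d)).const_mul B).mono'
    (L.aestronglyMeasurable_invSqrt (by omega)) ?_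
  filter_upwards [ae_waveSq_pos L.closure_range (by omega : 0 < d)] with θ hq
  refine (h θ hq).trans (le_of_eq ?_)
  rw [neg_div, Real.rpow_neg hq.le, ← Real.sqrt_eq_rpow]

theorem memLp_diffSymbol (hd : 0 < d) (z : Fin d → ℤ) (p : ENNReal) :
    MemLp (L.diffSymbol z) p := by
  obtain ⟨M, r₀, hr₀, h1, -⟩ := L.exists_diffSymbol_bound hd z
  exact MemLp.of_bound (L.aestronglyMeasurable_diffSymbol hd z) M (Filter.Eventually.of_forall h1)

end LatticeForm

/-! ### Fourier series of square summable families of amplitudes -/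

section FourierSeries

variable {d m : ℕ}

theorem memLp_mFourier_smul (z : Fin d → ℤ) (a : Amp m) :
    MemLp (fun θ => mFourier z θ • a) 2 (volume : Measure (UnitAddTorus (Fin d))) :=
  MemLp.of_bound (by fun_prop : Continuous fun θ => mFourier z θ • a).aestronglyMeasurable ‖a‖
    (Filter.Eventually.of_forall fun θ => by rw [norm_smul, norm_mFourier_apply, one_mul])

/-- The embedding of the amplitude `a` as the wave `e^{ik·z} a`. -/
def waveEmbedding (m : ℕ) (z : Fin d → ℤ) :
    Amp m →ₗᵢ[ℂ] Lp (Amp m) 2 (volume : Measure (UnitAddTorus (Fin d))) where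
  toFun a := (memLp_mFourier_smul z a).toLp _
  map_add' a b := by
    rw [← MemLp.toLp_add]
    exact MemLp.toLp_congr _ _ (Filter.Eventually.of_forall fun θ => smul_add _ _ _)
  map_smul' c a := by
    rw [RingHom.id_apply, ← MemLp.toLp_const_smul]
    exact MemLp.toLp_congr _ _ (Filter.Eventually.of_forall fun θ => smul_comm _ _ _)
  norm_map' a := by
    change ‖(memLp_mFourier_smul z a).toLp _‖ = _
    rw [Lp.norm_toLp, eLpNorm_congr_norm_ae (g := fun _ => a) (Filter.Eventually.of_forall
      fun θ => by rw [norm_smul, norm_mFourier_apply, one_mul]),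
      eLpNorm_const _ (by norm_num) (IsProbabilityMeasure.ne_zero _), measure_univ, ENNReal.one_rpow,
      mul_one, toReal_enorm]

theorem coeFn_waveEmbedding (z : Fin d → ℤ) (a : Amp m) :
    waveEmbedding m z a =ᵐ[volume] fun θ => mFourier z θ • a :=
  (memLp_mFourier_smul z a).coeFn_toLp

theorem integral_mFourier_neg_mul_mFourier (z w : Fin d → ℤ) :
    ∫ θ : UnitAddTorus (Fin d), mFourier (-z) θ * mFourier w θ = if z = w then 1 else 0 :=
  mFourierCoeff_mFourier z w

theorem orthogonalFamily_waveEmbedding {N : Type*} {coord : N → Fin d → ℤ}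
    (hc : Function.Injective coord) :
    OrthogonalFamily ℂ (fun _ : N => Amp m) fun n => waveEmbedding m (coord n) := by
  intro n n' hn a b
  rw [L2.inner_def]
  have : ∀ᵐ θ : UnitAddTorus (Fin d), inner ℂ (waveEmbedding m (coord n) a θ)
      (waveEmbedding m (coord n') b θ) =
      (mFourier (-coord n) θ * mFourier (coord n') θ) * inner ℂ a b := by
    filter_upwards [coeFn_waveEmbedding (coord n) a, coeFn_waveEmbedding (coord n') b] with θ h h'
    rw [h, h', inner_smul_left, inner_smul_right, mFourier_neg]
    ring
  rw [integral_congr_ae this, integral_mul_const, integral_mFourier_neg_mul_mFourier,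
    if_neg fun e => hn (hc e), zero_mul]

/-- The Fourier series of a square summable family, as a function on the torus. -/
def fourierSeries {N : Type*} {coord : N → Fin d → ℤ} (hc : Function.Injective coord) :
    lp (fun _ : N => Amp m) 2 →ₗᵢ[ℂ] Lp (Amp m) 2 (volume : Measure (UnitAddTorus (Fin d))) :=
  (orthogonalFamily_waveEmbedding hc).linearIsometry

theorem fourierSeries_single {N : Type*} [DecidableEq N] {coord : N → Fin d → ℤ}
    (hc : Function.Injective coord) (n : N) (a : Amp m) :
    fourierSeries hc (lp.single 2 n a) =ᵐ[volume] fun θ => mFourier (coord n) θ • a := by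
  rw [fourierSeries, OrthogonalFamily.linearIsometry_apply_single]
  exact coeFn_waveEmbedding _ _

end FourierSeries

/-! ### The family that represents the differences of `Fv` -/

namespace LatticeForm

variable {d m : ℕ} {ι : Type} [Fintype ι] (L : LatticeForm d m ι)

theorem memLp_frameSymbol (hd : 0 < d) (k z : Fin d → ℤ) (i : Fin m) :
    MemLp (fun θ => mFourier k θ •
      ContinuousLinearMap.adjoint (L.diffSymbol z θ) (EuclideanSpace.single i 1)) 2 := by
  obtain ⟨M, r₀, hr₀, h1, -⟩ := L.exists_diffSymbol_bound hd z
  refine MemLp.of_bound (C := M) ?_ (Filter.Eventually.of_forall fun θ => ?_)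
  · refine AEStronglyMeasurable.smul (f := fun θ => mFourier k θ)
      (mFourier k).continuous.aestronglyMeasurable ?_
    exact ((ContinuousLinearMap.apply ℂ (Amp m) (EuclideanSpace.single i (1 : ℂ))).continuous.comp
      (ContinuousLinearMap.adjoint (𝕜 := ℂ) (E := Amp m)
        (F := Amp m)).continuous).comp_aestronglyMeasurable (L.aestronglyMeasurable_diffSymbol hd z)
  · rw [norm_smul, norm_mFourier_apply, one_mul]
    refine (ContinuousLinearMap.le_opNorm _ _).trans ?_
    rw [LinearIsometryEquiv.norm_map, PiLp.norm_single, norm_one, mul_one]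
    exact h1 θ

variable {N : Type*} {coord : N → Fin d → ℤ} (hc : Function.Injective coord)

/-- The frame vector with `⟨frame k z i, v⟩ = (D_z F v)_i (k)`. -/
def frame (hd : 0 < d) (k z : Fin d → ℤ) (i : Fin m) : lp (fun _ : N => Amp m) 2 :=
  ContinuousLinearMap.adjoint (fourierSeries (m := m) hc).toContinuousLinearMap
    ((L.memLp_frameSymbol hd k z i).toLp _)

theorem inner_frame (hd : 0 < d) (k z : Fin d → ℤ) (i : Fin m) (v : lp (fun _ : N => Amp m) 2) :
    inner ℂ (L.frame hc hd k z i) v =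
      mFourierCoeff (fun θ => L.diffSymbol z θ (fourierSeries hc v θ) i) k := by
  rw [frame, ContinuousLinearMap.adjoint_inner_left, L2.inner_def, mFourierCoeff]
  refine integral_congr_ae ?_
  filter_upwards [(L.memLp_frameSymbol hd k z i).coeFn_toLp] with θ h
  rw [h, inner_smul_left, ContinuousLinearMap.adjoint_inner_left, EuclideanSpace.inner_single_left,
    map_one, one_mul, mFourier_neg, smul_eq_mul]
  rfl

theorem integrable_diffSymbol (hd : 0 < d) (z : Fin d → ℤ) : Integrable (L.diffSymbol z) :=
  memLp_one_iff_integrable.1 (L.memLp_diffSymbol hd z 1)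

theorem inner_frame_single [DecidableEq N] (hd : 0 < d) (k z : Fin d → ℤ) (i : Fin m) (n : N)
    (a : Amp m) :
    inner ℂ (L.frame hc hd k z i) (lp.single 2 n a) =
      mFourierCoeff (L.diffSymbol z) (k - coord n) a i := by
  have hint := integrable_mFourier_smul (L.integrable_diffSymbol hd z) (-(k - coord n))
  rw [inner_frame, mFourierCoeff, mFourierCoeff, ContinuousLinearMap.integral_apply hint]
  have := (EuclideanSpace.proj (𝕜 := ℂ) i).integral_comp_comm (hint.apply_continuousLinearMap a)
  refine Eq.trans ?_ this
  refine integral_congr_ae ?_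
  filter_upwards [fourierSeries_single hc n a] with θ h
  rw [h, neg_sub, sub_eq_add_neg, add_comm, mFourier_add]
  simp only [map_smul, smul_apply, PiLp.smul_apply, smul_eq_mul, PiLp.proj_apply, mul_assoc]

/-- `inner_frame_single` is tested with the value of the frame vector at `n` itself, and one factor
of its norm is divided out. -/
theorem norm_frame_apply_le (hd : 0 < d) (k z : Fin d → ℤ) (i : Fin m) (n : N) :
    ‖L.frame hc hd k z i n‖ ≤ ‖mFourierCoeff (L.diffSymbol z) (k - coord n)‖ := by
  classical
  have h := L.inner_frame_single hc hd k z i n (L.frame hc hd k z i n)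
  rw [lp.inner_single_right, inner_self_eq_norm_sq_to_K] at h
  have h2 : ‖L.frame hc hd k z i n‖ ^ 2 ≤
      ‖mFourierCoeff (L.diffSymbol z) (k - coord n)‖ * ‖L.frame hc hd k z i n‖ := by
    have e := (PiLp.norm_apply_le (mFourierCoeff (L.diffSymbol z) (k - coord n)
      (L.frame hc hd k z i n)) i).trans (ContinuousLinearMap.le_opNorm _ (L.frame hc hd k z i n))
    rw [← h] at e
    simpa using e
  rcases (norm_nonneg (L.frame hc hd k z i n)).eq_or_lt with h0 | h0
  · rw [← h0]; exact norm_nonneg _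
  · rw [sq] at h2
    exact le_of_mul_le_mul_right h2 h0

theorem hasSum_frame (hd : 0 < d) (k z : Fin d → ℤ) (i : Fin m) (v : lp (fun _ : N => Amp m) 2) :
    HasSum (fun n => mFourierCoeff (L.diffSymbol z) (k - coord n) (v n) i)
      (inner ℂ (L.frame hc hd k z i) v) := by
  classical
  have h := (lp.hasSum_single (by norm_num) v).mapL (innerSL ℂ (L.frame hc hd k z i))
  simp only [innerSL_apply_apply, inner_frame_single] at h
  exact h

/-- Two vectors that decay with exponent `s` around `k` and `k'` are multiplied pointwise.
`weight_mul_le` extracts `weight t (k - k')`, and the leftover exponent `2 * s - t > d` is summable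
over the lattice, hence over its subset `N`. -/
theorem exists_norm_inner_frame_le (hd : 0 < d) {s t : ℝ} (hs : 0 < s) (hsd : s < d) (hs3 : s ≤ 3)
    (ht : 0 ≤ t) (hts : t ≤ s) (hst : d < 2 * s - t) (z z' : Fin d → ℤ) :
    ∃ κ, 0 ≤ κ ∧ ∀ k i k' i', ‖inner ℂ (L.frame hc hd k z i) (L.frame hc hd k' z' i')‖ ≤
      κ * weight t (k - k') := by
  obtain ⟨c, hc0, hcz⟩ := L.exists_norm_mFourierCoeff_diffSymbol_le hd hs hsd hs3 z
  obtain ⟨c', hc'0, hcz'⟩ := L.exists_norm_mFourierCoeff_diffSymbol_le hd hs hsd hs3 z'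
  obtain ⟨S, hS⟩ : ∃ S, S = ∑' y : Fin d → ℤ, weight (2 * s - t) y := ⟨_, rfl⟩
  have hS0 : 0 ≤ S := by rw [hS]; exact tsum_nonneg fun y => weight_nonneg _ _
  refine ⟨c * c' * (2 ^ t * (S + S)), by positivity, fun k i k' i' => ?_⟩
  have hsum : Summable fun y : Fin d → ℤ => c * c' * (2 ^ t * weight t (k - k') *
      (weight (2 * s - t) (y - k) + weight (2 * s - t) (y - k'))) :=
    (((summable_weight_sub hst k).add (summable_weight_sub hst k')).mul_left _).mul_left _
  have hval : ∑' y : Fin d → ℤ, c * c' * (2 ^ t * weight t (k - k') *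
      (weight (2 * s - t) (y - k) + weight (2 * s - t) (y - k'))) =
      c * c' * (2 ^ t * (S + S)) * weight t (k - k') := by
    rw [tsum_mul_left, tsum_mul_left, ((summable_weight_sub hst k).tsum_add
      (summable_weight_sub hst k')), tsum_weight_sub, tsum_weight_sub, ← hS]
    ring
  have hterm : ∀ n, ‖inner ℂ (L.frame hc hd k z i n) (L.frame hc hd k' z' i' n)‖ ≤
      c * c' * (2 ^ t * weight t (k - k') *
        (weight (2 * s - t) (coord n - k) + weight (2 * s - t) (coord n - k'))) := by
    intro n
    have h1 := (L.norm_frame_apply_le hc hd k z i n).trans (hcz _)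
    have h2 := (L.norm_frame_apply_le hc hd k' z' i' n).trans (hcz' _)
    refine (norm_inner_le_norm _ _).trans ((mul_le_mul h1 h2 (norm_nonneg _)
      (mul_nonneg hc0 (weight_nonneg _ _))).trans ?_)
    rw [mul_mul_mul_comm]
    refine mul_le_mul_of_nonneg_left ?_ (by positivity)
    have := weight_mul_le ht hts (k - coord n) (coord n - k')
    rw [sub_add_sub_cancel, weight_sub_comm s (coord n) k',
      weight_sub_comm (2 * s - t) k (coord n)] at this
    exact this
  have hsN := hsum.comp_injective hc
  rw [lp.inner_eq_tsum]
  refine (tsum_of_norm_bounded hsN.hasSum hterm).trans ?_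
  rw [← hval]
  exact tsum_comp_le_tsum_of_inj hsum (fun y => by
    have := weight_nonneg t (k - k')
    have := weight_nonneg (2 * s - t) (y - k)
    have := weight_nonneg (2 * s - t) (y - k')
    positivity) hc

theorem memLp_diffSymbol_apply (hd : 0 < d) (z : Fin d → ℤ) (v : lp (fun _ : N => Amp m) 2)
    (i : Fin m) : MemLp (fun θ => L.diffSymbol z θ (fourierSeries hc v θ) i) 2 := by
  obtain ⟨M, r₀, hr₀, h1, -⟩ := L.exists_diffSymbol_bound hd z
  refine MemLp.of_le_mul (c := M) (Lp.memLp (fourierSeries hc v)) ?_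
    (Filter.Eventually.of_forall fun θ => ?_)
  · exact (EuclideanSpace.proj (𝕜 := ℂ) i).continuous.comp_aestronglyMeasurable
      ((ContinuousLinearMap.id ℂ (Amp m →L[ℂ] Amp m)).aestronglyMeasurable_comp₂
        (L.aestronglyMeasurable_diffSymbol hd z) (Lp.aestronglyMeasurable _))
  · exact (PiLp.norm_apply_le _ i).trans (ContinuousLinearMap.le_of_opNorm_le _ (h1 θ) _)

/-- Bessel's inequality for the frame. -/
theorem exists_sum_norm_inner_frame_sq_le (hd : 0 < d) (z : Fin d → ℤ) : ∃ B, 0 ≤ B ∧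
    ∀ i (v : lp (fun _ : N => Amp m) 2), Summable (fun k => ‖inner ℂ (L.frame hc hd k z i) v‖ ^ 2) ∧
      ∑' k, ‖inner ℂ (L.frame hc hd k z i) v‖ ^ 2 ≤ B * ‖v‖ ^ 2 := by
  obtain ⟨M, r₀, hr₀, h1, -⟩ := L.exists_diffSymbol_bound hd z
  refine ⟨M ^ 2, by positivity, fun i v => ?_⟩
  have hf := L.memLp_diffSymbol_apply hc hd z v i
  have hsq : ∀ x : ℂ, starRingEnd ℂ x * x = ((‖x‖ ^ 2 : ℝ) : ℂ) := fun x => by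
    rw [Complex.conj_mul', Complex.ofReal_pow]
  have h := hasSum_conj_mFourierCoeff_mul hf hf
  simp only [hsq] at h
  rw [integral_complex_ofReal] at h
  have h' := Complex.hasSum_ofReal.1 h
  simp only [inner_frame]
  refine ⟨h'.summable, h'.tsum_eq.le.trans ?_⟩
  have hv : ∫ θ, ‖fourierSeries hc v θ‖ ^ 2 = ‖v‖ ^ 2 := by
    have e := L2.inner_def (𝕜 := ℂ) (fourierSeries hc v) (fourierSeries hc v)
    simp only [inner_self_eq_norm_sq_to_K, LinearIsometry.norm_map] at e
    have e2 : ∫ θ, ((‖fourierSeries hc v θ‖ ^ 2 : ℝ) : ℂ) = ((‖v‖ ^ 2 : ℝ) : ℂ) := by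
      push_cast
      exact e.symm
    rw [integral_complex_ofReal] at e2
    exact_mod_cast e2
  rw [← hv, ← integral_const_mul]
  refine integral_mono hf.integrable_norm_pow' (((Lp.memLp _).integrable_norm_pow').const_mul _)
    fun θ => ?_
  have h2 := (PiLp.norm_apply_le _ i).trans
    (ContinuousLinearMap.le_of_opNorm_le _ (h1 θ) (fourierSeries hc v θ))
  have h3 := pow_le_pow_left₀ (norm_nonneg _) h2 2
  rwa [mul_pow] at h3

/-- The identity `ĥ^{-1/2} ĥ ĥ^{-1/2} = 1` is inserted and the middle factor expanded by its
definition. Integrated over the torus, this makes the homogeneous Hessian the identity. -/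
theorem inner_eq_sum_diffSymbol {θ : UnitAddTorus (Fin d)} (hq : 0 < waveSq L.r θ) (ξ η : Amp m) :
    inner ℂ ξ η = ∑ ρ, ∑ σ, ∑ i, ∑ j, (L.W ρ i σ j : ℂ) *
      (starRingEnd ℂ (L.diffSymbol (L.r ρ) θ ξ i) * L.diffSymbol (L.r σ) θ η j) := by
  have h1 : inner ℂ ξ η = inner ℂ (L.invSqrt θ ξ) (L.op θ (L.invSqrt θ η)) := by
    have h2 := congrArg (fun B : Amp m →L[ℂ] Amp m => B η) (L.invSqrt_mul_op_mul_invSqrt hq)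
    have h3 : ContinuousLinearMap.adjoint (L.invSqrt θ) = L.invSqrt θ :=
      (L.isSelfAdjoint_invSqrt θ).star_eq
    have h4 := ContinuousLinearMap.adjoint_inner_left (L.invSqrt θ) (L.op θ (L.invSqrt θ η)) ξ
    rw [h3] at h4
    rw [h4]
    exact congrArg (inner ℂ ξ) h2.symm
  rw [h1, op, inner_toEuclideanCLM]
  have e : ∀ ρ ξ i, L.diffSymbol (L.r ρ) θ ξ i = (mFourier (-L.r ρ) θ - 1) * L.invSqrt θ ξ i :=
    fun ρ ξ i => by simp [diffSymbol]
  simp only [e, symbol_eq_reflected, Finset.sum_mul, map_mul, map_sub, map_one, mFourier_neg,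
    Complex.conj_conj]
  calc _ = ∑ i, ∑ ρ, ∑ j, ∑ σ, (L.W ρ i σ j : ℂ) * ((mFourier (L.r ρ) θ - 1) *
        ((starRingEnd ℂ) (mFourier (L.r σ) θ) - 1)) *
          ((starRingEnd ℂ) (L.invSqrt θ ξ i) * L.invSqrt θ η j) :=
        Finset.sum_congr rfl fun i _ => Finset.sum_comm
    _ = ∑ ρ, ∑ i, ∑ σ, ∑ j, (L.W ρ i σ j : ℂ) * ((mFourier (L.r ρ) θ - 1) *
        ((starRingEnd ℂ) (mFourier (L.r σ) θ) - 1)) *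
          ((starRingEnd ℂ) (L.invSqrt θ ξ i) * L.invSqrt θ η j) := by
        rw [Finset.sum_comm]
        exact Finset.sum_congr rfl fun ρ _ => Finset.sum_congr rfl fun i _ => Finset.sum_comm
    _ = _ := by
        refine Finset.sum_congr rfl fun ρ _ => ?_
        rw [Finset.sum_comm]
        refine Finset.sum_congr rfl fun σ _ => Finset.sum_congr rfl fun i _ =>
          Finset.sum_congr rfl fun j _ => ?_
        ring

theorem inner_eq_sum_integral (hd : 0 < d) (v w : lp (fun _ : N => Amp m) 2) :
    inner ℂ v w = ∑ x : ι × ι × Fin m × Fin m, (L.W x.1 x.2.2.1 x.2.1 x.2.2.2 : ℂ) *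
      ∫ θ, starRingEnd ℂ (L.diffSymbol (L.r x.1) θ (fourierSeries hc v θ) x.2.2.1) *
        L.diffSymbol (L.r x.2.1) θ (fourierSeries hc w θ) x.2.2.2 := by
  have hI : ∀ x : ι × ι × Fin m × Fin m, Integrable fun θ =>
      starRingEnd ℂ (L.diffSymbol (L.r x.1) θ (fourierSeries hc v θ) x.2.2.1) *
        L.diffSymbol (L.r x.2.1) θ (fourierSeries hc w θ) x.2.2.2 := fun x =>
    (L.memLp_diffSymbol_apply hc hd (L.r x.1) v x.2.2.1).star.integrable_mul
      (L.memLp_diffSymbol_apply hc hd (L.r x.2.1) w x.2.2.2)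
  simp only [← integral_const_mul]
  rw [← integral_finsetSum _ fun x _ => (hI x).const_mul _,
    ← (fourierSeries hc).inner_map_map v w, L2.inner_def]
  refine integral_congr_ae ?_
  filter_upwards [ae_waveSq_pos L.closure_range hd] with θ hq
  simp only [Fintype.sum_prod_type]
  exact L.inner_eq_sum_diffSymbol hq _ _

/-- The homogeneous Hessian is the identity in the frame. -/
theorem hasSum_frame_form (hd : 0 < d) (v w : lp (fun _ : N => Amp m) 2) :
    HasSum (fun k => ∑ ρ, ∑ σ, ∑ i, ∑ j, (L.W ρ i σ j : ℂ) *
      (starRingEnd ℂ (inner ℂ (L.frame hc hd k (L.r ρ) i) v) *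
        inner ℂ (L.frame hc hd k (L.r σ) j) w)) (inner ℂ v w) := by
  rw [L.inner_eq_sum_integral hc hd]
  simp only [inner_frame, Fintype.sum_prod_type]
  exact hasSum_sum fun ρ _ => hasSum_sum fun σ _ => hasSum_sum fun i _ => hasSum_sum fun j _ =>
    (hasSum_conj_mFourierCoeff_mul (L.memLp_diffSymbol_apply hc hd (L.r ρ) v i)
      (L.memLp_diffSymbol_apply hc hd (L.r σ) w j)).mul_left _

end LatticeForm

end SiteEntropy

namespace SiteEntropy

/-! ### Bounded operators from forms in a Bessel family -/

section BesselForm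

variable {d : ℕ} {P H : Type*} [Fintype P] [NormedAddCommGroup H] [InnerProductSpace ℂ H]
  {b : (Fin d → ℤ) → P → H} {B : ℝ}

/-- A Bessel bound for each component family gives one for the total coefficient size. -/
theorem exists_bessel_coeffSize (h : ∀ p, ∃ B, 0 ≤ B ∧ ∀ v : H,
    Summable (fun k => ‖inner ℂ (b k p) v‖ ^ 2) ∧ ∑' k, ‖inner ℂ (b k p) v‖ ^ 2 ≤ B * ‖v‖ ^ 2) :
    ∃ B, 0 ≤ B ∧ ∀ v : H, Summable (fun k => coeffSize b v k ^ 2) ∧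
      ∑' k, coeffSize b v k ^ 2 ≤ B * ‖v‖ ^ 2 := by
  choose B hB hs using h
  refine ⟨Fintype.card P * ∑ p, B p, mul_nonneg (Nat.cast_nonneg _)
    (Finset.sum_nonneg fun p _ => hB p), fun v => ?_⟩
  have hle : ∀ k, coeffSize b v k ^ 2 ≤ Fintype.card P * ∑ p, ‖inner ℂ (b k p) v‖ ^ 2 :=
    fun k => sq_sum_le_card_mul_sum_sq
  have hsum : Summable fun k => (Fintype.card P : ℝ) * ∑ p, ‖inner ℂ (b k p) v‖ ^ 2 :=
    (summable_sum fun p _ => (hs p v).1).mul_left _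
  have hsum' := hsum.of_nonneg_of_le (fun k => sq_nonneg _) hle
  refine ⟨hsum', (hsum'.tsum_le_tsum hle hsum).trans ?_⟩
  rw [tsum_mul_left, Summable.tsum_finsetSum fun p _ => (hs p v).1, mul_assoc, Finset.sum_mul]
  exact mul_le_mul_of_nonneg_left (Finset.sum_le_sum fun p _ => (hs p v).2) (Nat.cast_nonneg _)

theorem summable_and_norm_tsum_form_le {C : (Fin d → ℤ) → P → P → ℂ} {c : ℝ}
    (hC : ∀ k p q, ‖C k p q‖ ≤ c)
    (hb : ∀ v : H, Summable (fun k => coeffSize b v k ^ 2) ∧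
      ∑' k, coeffSize b v k ^ 2 ≤ B * ‖v‖ ^ 2) (hB : 0 ≤ B) (hc : 0 ≤ c) (v w : H) :
    Summable (fun k => ∑ p, ∑ q, C k p q *
      (starRingEnd ℂ (inner ℂ (b k p) v) * inner ℂ (b k q) w)) ∧
    ‖∑' k, ∑ p, ∑ q, C k p q *
      (starRingEnd ℂ (inner ℂ (b k p) v) * inner ℂ (b k q) w)‖ ≤ c * B * ‖v‖ * ‖w‖ := by
  have hCS := summable_mul_and_tsum_mul_le_sqrt (fun k => coeffSize_nonneg b v k)
    (fun k => coeffSize_nonneg b w k) (hb v).1 (hb w).1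
  have hle := fun k => norm_form_term_le (hC k) v w k (b := b)
  refine ⟨(hCS.1.mul_left c).of_norm_bounded hle,
    (tsum_of_norm_bounded (hCS.1.mul_left c).hasSum hle).trans ?_⟩
  rw [tsum_mul_left, mul_assoc, mul_assoc]
  refine mul_le_mul_of_nonneg_left (hCS.2.trans ?_) hc
  refine (mul_le_mul (Real.sqrt_le_sqrt (hb v).2) (Real.sqrt_le_sqrt (hb w).2)
    (Real.sqrt_nonneg _) (Real.sqrt_nonneg _)).trans (le_of_eq ?_)
  rw [Real.sqrt_mul hB, Real.sqrt_mul hB, Real.sqrt_sq (norm_nonneg _), Real.sqrt_sq (norm_nonneg _),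
    mul_mul_mul_comm, Real.mul_self_sqrt hB]

/-- A bounded coefficient field in a Bessel family defines a bounded operator. -/
theorem exists_operator_of_form [CompleteSpace H] {C : (Fin d → ℤ) → P → P → ℂ} {c : ℝ}
    (hC : ∀ k p q, ‖C k p q‖ ≤ c)
    (hb : ∀ v : H, Summable (fun k => coeffSize b v k ^ 2) ∧
      ∑' k, coeffSize b v k ^ 2 ≤ B * ‖v‖ ^ 2) (hB : 0 ≤ B) (hc : 0 ≤ c) :
    ∃ T : H →L[ℂ] H, ∀ v w : H, HasSum (fun k => ∑ p, ∑ q, C k p q *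
      (starRingEnd ℂ (inner ℂ (b k p) v) * inner ℂ (b k q) w)) (inner ℂ v (T w)) := by
  have hs := fun v w => (summable_and_norm_tsum_form_le hC hb hB hc v w).1
  let Q : H →ₗ⋆[ℂ] H →ₗ[ℂ] ℂ := LinearMap.mk₂'ₛₗ (starRingEnd ℂ) (RingHom.id ℂ)
    (fun v w => ∑' k, ∑ p, ∑ q, C k p q *
      (starRingEnd ℂ (inner ℂ (b k p) v) * inner ℂ (b k q) w))
    (fun v v' w => by
      rw [← (hs v w).tsum_add (hs v' w)]
      simp only [inner_add_right, map_add, add_mul, mul_add, Finset.sum_add_distrib])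
    (fun a v w => by
      rw [smul_eq_mul, ← tsum_mul_left]
      simp only [inner_smul_right, map_mul, Finset.mul_sum, mul_assoc, mul_left_comm])
    (fun v w w' => by
      rw [← (hs v w).tsum_add (hs v w')]
      simp only [inner_add_right, mul_add, Finset.sum_add_distrib])
    (fun a v w => by
      rw [RingHom.id_apply, smul_eq_mul, ← tsum_mul_left]
      simp only [inner_smul_right, Finset.mul_sum, mul_left_comm])
  let Q' : H →L⋆[ℂ] H →L[ℂ] ℂ := Q.mkContinuous₂ (c * B) fun v w =>
    (summable_and_norm_tsum_form_le hC hb hB hc v w).2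
  refine ⟨ContinuousLinearMap.adjoint (InnerProductSpace.continuousLinearMapOfBilin Q'),
    fun v w => ?_⟩
  rw [ContinuousLinearMap.adjoint_inner_right, InnerProductSpace.continuousLinearMapOfBilin_apply]
  exact (hs v w).hasSum

theorem isSelfAdjoint_of_form [CompleteSpace H] {C : (Fin d → ℤ) → P → P → ℂ}
    (hC : ∀ k p q, starRingEnd ℂ (C k p q) = C k q p) {T : H →L[ℂ] H}
    (hT : ∀ v w : H, HasSum (fun k => ∑ p, ∑ q, C k p q *
      (starRingEnd ℂ (inner ℂ (b k p) v) * inner ℂ (b k q) w)) (inner ℂ v (T w))) :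
    IsSelfAdjoint T := by
  rw [ContinuousLinearMap.isSelfAdjoint_iff_isSymmetric]
  intro v w
  change inner ℂ (T v) w = inner ℂ v (T w)
  rw [← inner_conj_symm]
  refine HasSum.unique ?_ (hT v w)
  have := (hT w v).mapL (Complex.conjCLE : ℂ →L[ℝ] ℂ)
  have e : (Complex.conjCLE : ℂ →L[ℝ] ℂ) (inner ℂ w (T v)) = starRingEnd ℂ (inner ℂ w (T v)) := rfl
  rw [e] at this
  convert this using 1
  funext k
  simp only [ContinuousLinearEquiv.coe_coe, Complex.conjCLE_apply, map_sum, map_mul, hC,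
    Complex.conj_conj]
  rw [Finset.sum_comm]
  refine Finset.sum_congr rfl fun p _ => Finset.sum_congr rfl fun q _ => ?_
  ring

end BesselForm

/-- An invertible matrix as an equivalence from `ℝ^d` with the sup norm to Euclidean space. -/
def matrixEquiv {d : ℕ} {B B' : Matrix (Fin d) (Fin d) ℝ} (h : B * B' = 1) (h' : B' * B = 1) :
    (Fin d → ℝ) ≃L[ℝ] Space d :=
  (Matrix.toLin'OfInv h' h).toContinuousLinearEquiv.trans (EuclideanSpace.equiv (Fin d) ℝ).symm

theorem matrixEquiv_apply {d : ℕ} {B B' : Matrix (Fin d) (Fin d) ℝ} (h : B * B' = 1)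
    (h' : B' * B = 1) (t : Fin d → ℝ) : matrixEquiv h h' t = WithLp.toLp 2 (B.mulVec t) := by
  simp [matrixEquiv, Matrix.toLin'OfInv]

/-! ### Integer coordinates on the Bravais lattice -/

namespace Crystal

variable {d m : ℕ} (M : Crystal d m)

theorem A_mul_inv : M.A * M.A⁻¹ = 1 := Matrix.mul_nonsing_inv _ (Ne.isUnit M.A_nonsingular)

theorem inv_mul_A : M.A⁻¹ * M.A = 1 := Matrix.nonsing_inv_mul _ (Ne.isUnit M.A_nonsingular)

/-- The lattice point `A z`. -/
def lat : (Fin d → ℤ) →+ Space d where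
  toFun z := WithLp.toLp 2 (M.A.mulVec fun i => (z i : ℝ))
  map_zero' := by
    rw [← WithLp.toLp_zero 2]
    congr 1
    simp only [Pi.zero_apply, Int.cast_zero]
    exact Matrix.mulVec_zero M.A
  map_add' z w := by
    rw [← WithLp.toLp_add, ← Matrix.mulVec_add]
    congr 2
    ext i
    simp

theorem lat_eq (z : Fin d → ℤ) :
    M.lat z = matrixEquiv M.A_mul_inv M.inv_mul_A fun i => (z i : ℝ) :=
  (matrixEquiv_apply _ _ _).symm

theorem lat_injective : Function.Injective M.lat := by
  intro z w h
  rw [lat_eq, lat_eq] at h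
  have := (matrixEquiv M.A_mul_inv M.inv_mul_A).injective h
  ext i
  exact_mod_cast congrFun this i

theorem mem_bravais {x : Space d} : x ∈ bravais M.A ↔ ∃ z, M.lat z = x :=
  ⟨fun ⟨z, h⟩ => ⟨z, h.symm⟩, fun ⟨z, h⟩ => ⟨z, h.symm⟩⟩

theorem lat_mem_bravais (z : Fin d → ℤ) : M.lat z ∈ bravais M.A := ⟨z, rfl⟩

/-- The integer coordinates of a lattice point. -/
def coord : Space d → Fin d → ℤ := Function.invFun M.lat

theorem coord_lat (z : Fin d → ℤ) : M.coord (M.lat z) = z :=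
  Function.leftInverse_invFun M.lat_injective z

theorem lat_coord {x : Space d} (hx : x ∈ bravais M.A) : M.lat (M.coord x) = x := by
  obtain ⟨z, rfl⟩ := M.mem_bravais.1 hx
  rw [coord_lat]

theorem norm_intCast {d : ℕ} (z : Fin d → ℤ) : ‖fun i => (z i : ℝ)‖ = ‖z‖ := by
  refine le_antisymm ((pi_norm_le_iff_of_nonneg (norm_nonneg _)).2 fun i => ?_)
    ((pi_norm_le_iff_of_nonneg (norm_nonneg _)).2 fun i => ?_)
  · rw [Int.norm_cast_real]
    exact norm_le_pi_norm z i
  · rw [← Int.norm_cast_real]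
    exact norm_le_pi_norm (fun i => (z i : ℝ)) i

theorem exists_norm_lat_le : ∃ c : ℝ, 0 < c ∧ ∀ z, ‖M.lat z‖ ≤ c * ‖z‖ ∧ ‖z‖ ≤ c * ‖M.lat z‖ := by
  let e := matrixEquiv M.A_mul_inv M.inv_mul_A
  refine ⟨‖(e : (Fin d → ℝ) →L[ℝ] Space d)‖ + ‖(e.symm : Space d →L[ℝ] Fin d → ℝ)‖ + 1,
    by positivity, fun z => ⟨?_, ?_⟩⟩
  · rw [lat_eq, ← norm_intCast z]
    refine ((e : (Fin d → ℝ) →L[ℝ] Space d).le_opNorm _).trans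
      (mul_le_mul_of_nonneg_right ?_ (norm_nonneg _))
    linarith [norm_nonneg (e.symm : Space d →L[ℝ] Fin d → ℝ)]
  · have h := (e.symm : Space d →L[ℝ] Fin d → ℝ).le_opNorm (M.lat z)
    have h2 : (e.symm : Space d →L[ℝ] Fin d → ℝ) (M.lat z) = fun i => (z i : ℝ) :=
      (congrArg e.symm (M.lat_eq z)).trans (e.symm_apply_apply _)
    rw [h2, norm_intCast] at h
    refine h.trans (mul_le_mul_of_nonneg_right ?_ (norm_nonneg _))
    linarith [norm_nonneg (e : (Fin d → ℝ) →L[ℝ] Space d)]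

theorem finite_norm_lat_lt (R : ℝ) : {z | ‖M.lat z‖ < R}.Finite := by
  obtain ⟨c, hc, h⟩ := M.exists_norm_lat_le
  refine ((isCompact_closedBall (0 : Fin d → ℤ) (c * R)).finite_of_discrete).subset fun z hz => ?_
  rw [mem_closedBall_zero_iff]
  exact (h z).2.trans (mul_le_mul_of_nonneg_left (le_of_lt hz) hc.le)

/-- The integer coordinates of a site. -/
def siteCoord (l : M.sites) : Fin d → ℤ := M.coord l.1

theorem lat_siteCoord (l : M.sites) : M.lat (M.siteCoord l) = l.1 :=
  M.lat_coord (M.sites_subset l.2)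

theorem siteCoord_injective : Function.Injective M.siteCoord := fun l l' h =>
  Subtype.ext (by rw [← lat_siteCoord, ← lat_siteCoord, h])

theorem mem_bravais_of_mem_range {ρ : Space d} (h : ρ ∈ M.range) : ρ ∈ bravais M.A := by
  rw [← M.span_range]
  exact AddSubgroup.subset_closure h

theorem mem_bravais_of_mem_siteRange {l : M.sites} {ρ : Space d} (h : ρ ∈ M.siteRange l) :
    ρ ∈ bravais M.A := by
  rw [mem_bravais]
  obtain ⟨z, hz⟩ := M.mem_bravais.1 (M.sites_subset (M.add_mem_sites l ρ h))
  refine ⟨z - M.siteCoord l, ?_⟩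
  rw [map_sub, hz, lat_siteCoord, add_sub_cancel_left]

theorem siteCoord_add (l : M.sites) {ρ : Space d} (h : ρ ∈ M.siteRange l) :
    M.siteCoord ⟨l.1 + ρ, M.add_mem_sites l ρ h⟩ = M.siteCoord l + M.coord ρ := by
  refine M.lat_injective ?_
  rw [lat_siteCoord, map_add, lat_siteCoord, M.lat_coord (M.mem_bravais_of_mem_siteRange h)]

theorem coord_neg {x : Space d} (hx : x ∈ bravais M.A) : M.coord (-x) = -M.coord x := by
  refine M.lat_injective ?_
  rw [map_neg, M.lat_coord hx]
  obtain ⟨z, rfl⟩ := M.mem_bravais.1 hx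
  rw [← map_neg, M.lat_coord (M.lat_mem_bravais _)]

theorem closure_range_coord :
    AddSubgroup.closure (Set.range fun ρ : M.range => M.coord ρ.1) = ⊤ := by
  have h : (AddSubgroup.closure (Set.range fun ρ : M.range => M.coord ρ.1)).map M.lat =
      AddSubgroup.closure (M.range : Set (Space d)) := by
    rw [AddMonoidHom.map_closure]
    congr 1
    ext x
    constructor
    · rintro ⟨_, ⟨ρ, rfl⟩, rfl⟩
      rw [M.lat_coord (M.mem_bravais_of_mem_range ρ.2)]
      exact ρ.2
    · intro hx
      exact ⟨_, ⟨⟨x, hx⟩, rfl⟩, M.lat_coord (M.mem_bravais_of_mem_range hx)⟩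
  rw [eq_top_iff]
  intro z _
  have hz : M.lat z ∈ AddSubgroup.closure (M.range : Set (Space d)) := by
    rw [← SetLike.mem_coe, M.span_range]
    exact M.lat_mem_bravais z
  rw [← h] at hz
  obtain ⟨w, hw, e⟩ := hz
  rwa [← M.lat_injective e]

/-- The lattice coordinates as an equivalence. -/
def latEquiv : (Fin d → ℤ) ≃ bravais M.A :=
  Equiv.ofBijective (fun z => ⟨M.lat z, M.lat_mem_bravais z⟩)
    ⟨fun _ _ h => M.lat_injective (congrArg Subtype.val h),
      fun ⟨x, hx⟩ => ⟨M.coord x, Subtype.ext (M.lat_coord hx)⟩⟩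

end Crystal

/-! ### Second derivatives of site potentials -/

section Potential

variable {d m : ℕ} {S : Finset (Space d)}

theorem stencil_eq_sum (a : Stencil m S) :
    a = ∑ ρ : S, ∑ i : Fin m, a ρ i • basisStencil ρ i := by
  classical
  ext τ j
  simp only [Finset.sum_apply, Pi.smul_apply, WithLp.ofLp_sum, PiLp.smul_apply, smul_eq_mul]
  rw [Finset.sum_eq_single τ, Finset.sum_eq_single j]
  · simp [basisStencil]
  · intro i _ hij
    simp [basisStencil, hij.symm]
  · simp
  · intro ρ _ hρ
    refine Finset.sum_eq_zero fun i _ => ?_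
    simp [basisStencil, hρ.symm]
  · simp

theorem basisStencil_norm_le (ρ : S) (i : Fin m) : ‖(basisStencil ρ i : Stencil m S)‖ ≤ 1 := by
  refine (pi_norm_le_iff_of_nonneg zero_le_one).2 fun τ => ?_
  rw [basisStencil]
  split_ifs <;> simp

theorem fderiv_fderiv_eq_sum (W : Stencil m S → ℝ) (g a b : Stencil m S) :
    fderiv ℝ (fderiv ℝ W) g a b =
      ∑ ρ, ∑ σ, ∑ i, ∑ j, secondPartial W g ρ i σ j * (a ρ i * b σ j) := by
  conv_lhs => rw [stencil_eq_sum a, stencil_eq_sum b]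
  simp only [map_sum, map_smul, sum_apply, smul_apply, smul_eq_mul, Finset.mul_sum]
  rw [Finset.sum_congr rfl fun σ _ => Finset.sum_comm, Finset.sum_comm]
  refine Finset.sum_congr rfl fun ρ _ => Finset.sum_congr rfl fun σ _ => ?_
  rw [Finset.sum_comm]
  refine Finset.sum_congr rfl fun i _ => Finset.sum_congr rfl fun j _ => ?_
  rw [secondPartial]
  ring

theorem secondPartial_symm {W : Stencil m S → ℝ} (hW : ContDiff ℝ 3 W) (g : Stencil m S)
    (ρ : S) (i : Fin m) (σ : S) (j : Fin m) :
    secondPartial W g ρ i σ j = secondPartial W g σ j ρ i := by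
  have h := hW.contDiffAt (x := g)
  exact h.isSymmSndFDerivAt (by rw [minSmoothness_of_isRCLikeNormedField]; norm_num) _ _

/-- Second derivatives are Lipschitz on balls. -/
theorem exists_secondPartial_sub_le {W : Stencil m S → ℝ} (hW : ContDiff ℝ 3 W) (R : ℝ) :
    ∃ C, 0 ≤ C ∧ ∀ g g' : Stencil m S, ‖g‖ ≤ R → ‖g'‖ ≤ R → ∀ ρ i σ j,
      |secondPartial W g ρ i σ j - secondPartial W g' ρ i σ j| ≤ C * ‖g - g'‖ := by
  have h2 : ContDiff ℝ 1 (fderiv ℝ (fderiv ℝ W)) :=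
    (hW.fderiv_right (m := 2) (by norm_num)).fderiv_right (by norm_num)
  obtain ⟨C, hC⟩ := (isCompact_closedBall (0 : Stencil m S) R).exists_bound_of_continuousOn
    (h2.continuous_fderiv one_ne_zero).continuousOn
  refine ⟨max C 0, le_max_right _ _, fun g g' hg hg' ρ i σ j => ?_⟩
  have h3 := (convex_closedBall (0 : Stencil m S) R).norm_image_sub_le_of_norm_fderiv_le
    (fun x _ => (h2.differentiable one_ne_zero).differentiableAt)
    (fun x hx => (hC x hx).trans (le_max_left C 0)) (mem_closedBall_zero_iff.2 hg')
    (mem_closedBall_zero_iff.2 hg)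
  have h4 := ContinuousLinearMap.le_opNorm_of_le (fderiv ℝ (fderiv ℝ W) g - fderiv ℝ (fderiv ℝ W) g')
    (basisStencil_norm_le ρ i)
  have h5 := ContinuousLinearMap.le_opNorm_of_le
    ((fderiv ℝ (fderiv ℝ W) g - fderiv ℝ (fderiv ℝ W) g') (basisStencil ρ i))
    (basisStencil_norm_le σ j)
  rw [mul_one] at h4 h5
  exact (h5.trans h4).trans h3

/-- The invariance `W ∘ J = W` is differentiated twice, at the fixed point `0` of the linear map
`J`. -/
theorem secondPartial_comp_linear (W : Stencil m S → ℝ) (hW : ContDiff ℝ 3 W)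
    (J : Stencil m S →L[ℝ] Stencil m S) (h : ∀ g, W (J g) = W g) (a b : Stencil m S) :
    fderiv ℝ (fderiv ℝ W) 0 (J a) (J b) = fderiv ℝ (fderiv ℝ W) 0 a b := by
  have hd : Differentiable ℝ W := hW.differentiable (by norm_num)
  have hd2 : Differentiable ℝ (fderiv ℝ W) :=
    (hW.fderiv_right (m := 2) (by norm_num)).differentiable (by norm_num)
  have h1 : ∀ g c, fderiv ℝ W (J g) (J c) = fderiv ℝ W g c := by
    intro g c
    have := ((hd (J g)).hasFDerivAt.comp g J.hasFDerivAt)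
    have e : W ∘ J = W := funext h
    rw [e] at this
    rw [this.fderiv]
    rfl
  have h2 : HasFDerivAt (fun g => fderiv ℝ W (J g) (J b))
      (((fderiv ℝ (fderiv ℝ W) (J 0)).comp J).flip (J b)) 0 := by
    have := ((hd2 (J 0)).hasFDerivAt.comp (0 : Stencil m S) J.hasFDerivAt).clm_apply
      (hasFDerivAt_const (J b) (0 : Stencil m S))
    refine this.congr_fderiv ?_
    ext x
    simp
  have h3 : HasFDerivAt (fun g => fderiv ℝ W g b) ((fderiv ℝ (fderiv ℝ W) 0).flip b) 0 := by
    have := ((hd2 0).hasFDerivAt).clm_apply (hasFDerivAt_const b (0 : Stencil m S))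
    refine this.congr_fderiv ?_
    ext x
    simp
  simp only [h1] at h2
  have := congrArg (fun Q : Stencil m S →L[ℝ] ℝ => Q a) (h2.unique h3)
  simpa using this

end Potential

end SiteEntropy

namespace SiteEntropy

open MeasureTheory UnitAddTorus

attribute [local instance] circleMeasureSpace isAddHaarMeasure_circle isProbabilityMeasure_circle

/-! ### The homogeneous crystal as a lattice form -/

namespace Crystal

variable {d m : ℕ} (M : Crystal d m)

/-- The reflection of the interaction range. -/
def reflect (ρ : M.range) : M.range := ⟨-ρ.1, M.neg_mem_range ρ.1 ρ.2⟩

theorem reflect_reflect (ρ : M.range) : M.reflect (M.reflect ρ) = ρ :=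
  Subtype.ext (neg_neg _)

/-- Point symmetry is invariance of `V` under a linear map that sends basis stencils to the
negatives of the reflected ones; the two signs cancel in a second derivative. -/
theorem secondPartial_reflect (ρ : M.range) (i : Fin m) (σ : M.range) (j : Fin m) :
    secondPartial M.V 0 (M.reflect ρ) i (M.reflect σ) j = secondPartial M.V 0 ρ i σ j := by
  let J : Stencil m M.range →L[ℝ] Stencil m M.range :=
    ContinuousLinearMap.pi fun ρ => -ContinuousLinearMap.proj (M.reflect ρ)
  have hJ : ∀ ρ i, J (basisStencil ρ i) = -basisStencil (M.reflect ρ) i := by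
    intro ρ i
    funext τ
    change -basisStencil ρ i (M.reflect τ) = -basisStencil (M.reflect ρ) i τ
    rw [basisStencil, basisStencil]
    have : M.reflect τ = ρ ↔ τ = M.reflect ρ :=
      ⟨fun h => by rw [← h, reflect_reflect], fun h => by rw [h, reflect_reflect]⟩
    simp only [this]
  have h := secondPartial_comp_linear M.V M.V_smooth J M.V_symm (basisStencil ρ i)
    (basisStencil σ j)
  rw [hJ, hJ] at h
  simpa [secondPartial] using h

theorem stable_int {c : ℝ} (hc : ∀ v : Space d → Space m, (Function.support v).Finite →
    c * ∑' l : bravais M.A, ∑ ρ : M.range, ‖v (l.1 + ρ.1) - v l.1‖ ^ 2 ≤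
      ∑' l : bravais M.A, fderiv ℝ (fderiv ℝ M.V) 0
        (fun ρ => v (l.1 + ρ.1) - v l.1) (fun ρ => v (l.1 + ρ.1) - v l.1))
    (v : (Fin d → ℤ) → Fin m → ℝ) (hv : (Function.support v).Finite) :
    c * ∑' z, ∑ ρ : M.range, ∑ i, (v (z + M.coord ρ.1) i - v z i) ^ 2 ≤
      ∑' z, ∑ ρ : M.range, ∑ σ : M.range, ∑ i, ∑ j, secondPartial M.V 0 ρ i σ j *
        ((v (z + M.coord ρ.1) i - v z i) * (v (z + M.coord σ.1) j - v z j)) := by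
  classical
  let v' : Space d → Space m := fun x => if x ∈ bravais M.A then WithLp.toLp 2 (v (M.coord x)) else 0
  have hv' : ∀ z, v' (M.lat z) = WithLp.toLp 2 (v z) := fun z => by
    simp only [v', if_pos (M.lat_mem_bravais z), coord_lat]
  have hadd : ∀ z (ρ : M.range), M.lat z + ρ.1 = M.lat (z + M.coord ρ.1) := fun z ρ => by
    rw [map_add, M.lat_coord (M.mem_bravais_of_mem_range ρ.2)]
  have hfin : (Function.support v').Finite := by
    refine (hv.image M.lat).subset fun x hx => ?_
    by_cases hxb : x ∈ bravais M.A
    · refine ⟨M.coord x, fun h0 => hx ?_, M.lat_coord hxb⟩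
      simp only [v', if_pos hxb, h0]
      rfl
    · exact absurd (if_neg hxb) hx
  have h := hc v' hfin
  rw [← M.latEquiv.tsum_eq, ← M.latEquiv.tsum_eq] at h
  have e : ∀ z (ρ : M.range), v' ((M.latEquiv z).1 + ρ.1) - v' (M.latEquiv z).1 =
      WithLp.toLp 2 (v (z + M.coord ρ.1) - v z) := fun z ρ => by
    change v' (M.lat z + ρ.1) - v' (M.lat z) = _
    rw [hadd, hv', hv', WithLp.toLp_sub]
  simp only [e, fderiv_fderiv_eq_sum, EuclideanSpace.norm_sq_eq, Real.norm_eq_abs, sq_abs,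
    Pi.sub_apply] at h
  exact h

/-- The homogeneous Hessian in lattice coordinates. -/
def latticeForm (hstab : M.HomStable) : LatticeForm d m M.range where
  r ρ := M.coord ρ.1
  W := secondPartial M.V 0
  W_symm := secondPartial_symm M.V_smooth 0
  refl := M.reflect
  refl_refl := M.reflect_reflect
  r_refl ρ := M.coord_neg (M.mem_bravais_of_mem_range ρ.2)
  W_refl := M.secondPartial_reflect
  closure_range := M.closure_range_coord
  c := hstab.choose
  c_pos := hstab.choose_spec.1
  stable := M.stable_int hstab.choose_spec.2

/-! ### The Brillouin zone as a fundamental cell of the dual torus -/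

/-- Wave vectors in the coordinates of the dual lattice. -/
def waveVector : (Fin d → ℝ) ≃L[ℝ] Space d :=
  matrixEquiv (B := (2 * Real.pi) • M.A⁻¹.transpose) (B' := (2 * Real.pi)⁻¹ • M.A.transpose)
    (by rw [Matrix.smul_mul, Matrix.mul_smul, smul_smul, mul_inv_cancel₀ (by positivity), one_smul,
      ← Matrix.transpose_mul, M.A_mul_inv, Matrix.transpose_one])
    (by rw [Matrix.smul_mul, Matrix.mul_smul, smul_smul, inv_mul_cancel₀ (by positivity), one_smul,
      ← Matrix.transpose_mul, M.inv_mul_A, Matrix.transpose_one])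

theorem measurableEmbedding_waveVector : MeasurableEmbedding M.waveVector :=
  M.waveVector.toHomeomorph.measurableEmbedding

theorem waveVector_apply (t : Fin d → ℝ) :
    M.waveVector t = WithLp.toLp 2 ((2 * Real.pi) • M.A⁻¹.transpose.mulVec t) := by
  rw [waveVector, matrixEquiv_apply, Matrix.smul_mulVec]

/-- The projection to the torus. -/
def toTorus (t : Fin d → ℝ) : UnitAddTorus (Fin d) := fun i => (t i : UnitAddCircle)

theorem inner_waveVector_lat (t : Fin d → ℝ) (z : Fin d → ℤ) :
    inner ℝ (M.waveVector t) (M.lat z) = 2 * Real.pi * ∑ i, t i * z i := by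
  rw [waveVector_apply, lat_eq, matrixEquiv_apply, EuclideanSpace.inner_eq_star_dotProduct]
  simp only [star_trivial, dotProduct_smul, smul_eq_mul]
  congr 1
  rw [Matrix.dotProduct_mulVec, Matrix.vecMul_transpose, Matrix.mulVec_mulVec, M.inv_mul_A,
    Matrix.one_mulVec]
  exact Finset.sum_congr rfl fun i _ => mul_comm _ _

theorem planeWave_waveVector_lat (t : Fin d → ℝ) (z : Fin d → ℤ) :
    planeWave (M.waveVector t) (M.lat z) = mFourier z (toTorus t) := by
  rw [planeWave, inner_waveVector_lat, mFourier]
  simp only [ContinuousMap.coe_mk, toTorus, fourier_coe_apply]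
  rw [← Complex.exp_sum]
  congr 1
  push_cast
  rw [Finset.mul_sum, Finset.mul_sum]
  refine Finset.sum_congr rfl fun i _ => ?_
  ring

theorem symbolInvSqrt_waveVector (hstab : M.HomStable) (t : Fin d → ℝ) :
    M.symbolInvSqrt (M.waveVector t) = (M.latticeForm hstab).invSqrt (toTorus t) := by
  rw [symbolInvSqrt, LatticeForm.invSqrt, LatticeForm.op]
  congr 2
  ext i j
  rw [symbol, LatticeForm.symbol, Matrix.of_apply, Matrix.of_apply]
  refine Finset.sum_congr rfl fun ρ _ => Finset.sum_congr rfl fun σ _ => ?_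
  have hρ := M.lat_coord (M.mem_bravais_of_mem_range ρ.2)
  have hσ := M.lat_coord (M.mem_bravais_of_mem_range σ.2)
  rw [← planeWave_waveVector_lat, ← planeWave_waveVector_lat, map_neg]
  change _ = _ * ((planeWave _ (-M.lat (M.coord ρ.1)) - 1) * (planeWave _ (M.lat (M.coord σ.1)) - 1))
  rw [hρ, hσ]
  rfl

theorem preimage_brillouin :
    M.waveVector ⁻¹' M.brillouin = Set.univ.pi fun _ => Set.Ioo (-(1 / 2) : ℝ) (-(1 / 2) + 1) := by
  ext t
  simp only [Set.mem_preimage, brillouin, Set.mem_ofPred_eq, Set.mem_univ_pi]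
  constructor
  · rintro ⟨s, hs, h⟩ i
    have : t = (1 / 2 : ℝ) • s := by
      refine M.waveVector.injective ?_
      rw [h, map_smul, waveVector_apply, ← WithLp.toLp_smul, smul_smul]
      congr 2
      ring
    rw [this, Pi.smul_apply, smul_eq_mul]
    constructor <;> linarith [(hs i).1, (hs i).2]
  · intro h
    refine ⟨(2 : ℝ) • t, fun i => ?_, ?_⟩
    · rw [Pi.smul_apply, smul_eq_mul]
      constructor <;> linarith [(h i).1, (h i).2]
    · rw [waveVector_apply, Matrix.mulVec_smul, smul_smul, mul_comm]

theorem measurePreserving_toTorus : MeasurePreserving (toTorus (d := d))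
    (volume.restrict (Set.univ.pi fun _ => Set.Ioo (-(1 / 2) : ℝ) (-(1 / 2) + 1))) volume := by
  have h : (volume.restrict (Set.univ.pi fun _ => Set.Ioo (-(1 / 2) : ℝ) (-(1 / 2) + 1)) :
      Measure (Fin d → ℝ)) =
      Measure.pi fun _ => volume.restrict (Set.Ioc (-(1 / 2) : ℝ) (-(1 / 2) + 1)) := by
    rw [volume_pi, Measure.restrict_pi_pi]
    simp only [restrict_Ioo_eq_restrict_Ioc]
  rw [h]
  exact measurePreserving_pi _ _ fun _ => measurePreserving_mk_circle

/-- Uniqueness of Haar measure gives the Jacobian of the linear change of variables without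
computing it. Only its being finite and nonzero matters, as it drops out of the average that defines
the kernel. -/
theorem exists_restrict_brillouin : ∃ c : ENNReal, c ≠ 0 ∧ c ≠ ⊤ ∧
    (volume.restrict M.brillouin : Measure (Space d)) =
      c • (volume.restrict (Set.univ.pi fun _ => Set.Ioo (-(1 / 2) : ℝ) (-(1 / 2) + 1))).map
        M.waveVector := by
  have := M.waveVector.isAddHaarMeasure_map (volume : Measure (Fin d → ℝ))
  obtain ⟨r, hr⟩ : ∃ r : NNReal, (volume : Measure (Space d)) =
      r • (volume : Measure (Fin d → ℝ)).map M.waveVector :=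
    ⟨_, Measure.isAddLeftInvariant_eq_smul _ _⟩
  refine ⟨r, fun h0 => ?_, ENNReal.coe_ne_top, ?_⟩
  · rw [ENNReal.coe_eq_zero] at h0
    rw [h0, zero_smul] at hr
    exact isOpen_univ.measure_ne_zero (volume : Measure (Space d)) Set.univ_nonempty (by simp [hr])
  · rw [hr, Measure.restrict_smul,
      M.measurableEmbedding_waveVector.restrict_map, ← preimage_brillouin]
    rfl

theorem integrableOn_symbolInvSqrt (hd : 1 < d) (hstab : M.HomStable) :
    IntegrableOn M.symbolInvSqrt M.brillouin := by
  obtain ⟨c, h0, h1, h⟩ := M.exists_restrict_brillouin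
  have e : M.symbolInvSqrt ∘ M.waveVector = (M.latticeForm hstab).invSqrt ∘ toTorus :=
    funext fun t => M.symbolInvSqrt_waveVector hstab t
  have hint : Integrable (M.symbolInvSqrt ∘ M.waveVector)
      (volume.restrict (Set.univ.pi fun _ => Set.Ioo (-(1 / 2) : ℝ) (-(1 / 2) + 1))) := by
    rw [e]
    exact measurePreserving_toTorus.integrable_comp_of_integrable
      ((M.latticeForm hstab).integrable_invSqrt hd)
  rw [IntegrableOn, h]
  exact Integrable.smul_measure (ε := Amp m →L[ℂ] Amp m)
    (M.measurableEmbedding_waveVector.integrable_map_iff.2 hint) h1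

theorem kernel_lat (hd : 1 < d) (hstab : M.HomStable) (z : Fin d → ℤ) :
    M.kernel (M.lat z) = mFourierCoeff (M.latticeForm hstab).invSqrt z := by
  obtain ⟨c, h0, h1, h⟩ := M.exists_restrict_brillouin
  have hQ := measurePreserving_toTorus (d := d)
  have hint : Integrable (fun θ => mFourier (-z) θ • (M.latticeForm hstab).invSqrt θ) :=
    integrable_mFourier_smul ((M.latticeForm hstab).integrable_invSqrt hd) _
  have e : ∀ t, planeWave (M.waveVector t) (-M.lat z) • M.symbolInvSqrt (M.waveVector t) =
      mFourier (-z) (toTorus t) • (M.latticeForm hstab).invSqrt (toTorus t) := fun t => by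
    rw [← map_neg, planeWave_waveVector_lat, M.symbolInvSqrt_waveVector hstab]
  have hp : IsProbabilityMeasure ((volume.restrict (Set.univ.pi fun _ : Fin d =>
      Set.Ioo (-(1 / 2) : ℝ) (-(1 / 2) + 1))).map M.waveVector) := by
    have : IsProbabilityMeasure (volume.restrict (Set.univ.pi fun _ : Fin d =>
        Set.Ioo (-(1 / 2) : ℝ) (-(1 / 2) + 1))) := ⟨by
      rw [← Set.preimage_univ (f := toTorus (d := d)), hQ.measure_preimage nullMeasurableSet_univ,
        measure_univ]⟩
    exact Measure.isProbabilityMeasure_map M.waveVector.continuous.aemeasurable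
  rw [kernel, average, h, Measure.smul_apply, smul_eq_mul, measure_univ, mul_one, smul_smul,
    ENNReal.inv_mul_cancel h0 h1, one_smul, M.measurableEmbedding_waveVector.integral_map]
  refine (integral_congr_ae (Filter.Eventually.of_forall e)).trans ?_
  rw [mFourierCoeff, ← hQ.map_eq, integral_map hQ.measurable.aemeasurable]
  rw [hQ.map_eq]
  exact hint.aestronglyMeasurable

end Crystal

/-! ### A common index set for all interaction ranges -/

section Pad

variable {d m : ℕ}

/-- The second partial derivatives of a site potential, extended by zero to all displacements. -/
def padCoeff {S : Finset (Space d)} (W : Stencil m S → ℝ) (g : Stencil m S) (x : Space d)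
    (i : Fin m) (y : Space d) (j : Fin m) : ℝ :=
  open Classical in
  if h : x ∈ S ∧ y ∈ S then secondPartial W g ⟨x, h.1⟩ i ⟨y, h.2⟩ j else 0

theorem padCoeff_symm {S : Finset (Space d)} {W : Stencil m S → ℝ} (hW : ContDiff ℝ 3 W)
    (g : Stencil m S) (x : Space d) (i : Fin m) (y : Space d) (j : Fin m) :
    padCoeff W g x i y j = padCoeff W g y j x i := by
  unfold padCoeff
  by_cases h : x ∈ S ∧ y ∈ S
  · rw [dif_pos h, dif_pos h.symm, secondPartial_symm hW]
  · rw [dif_neg h, dif_neg fun h' => h h'.symm]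

theorem sum_padCoeff_mul {S S' : Finset (Space d)} (hS : S ⊆ S') (W : Stencil m S → ℝ)
    (g : Stencil m S) (f : Space d → Fin m → Space d → Fin m → ℂ) :
    ∑ p : S' × Fin m, ∑ q : S' × Fin m, (padCoeff W g p.1 p.2 q.1 q.2 : ℂ) *
      f p.1 p.2 q.1 q.2 =
    ∑ ρ : S, ∑ σ : S, ∑ i, ∑ j, (secondPartial W g ρ i σ j : ℂ) * f ρ i σ j := by
  have key : ∀ F : Space d → ℂ, (∀ x, x ∉ S → F x = 0) → ∑ x : S', F x = ∑ x : S, F x := by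
    intro F hF
    rw [Finset.sum_coe_sort S' F, Finset.sum_coe_sort S F]
    exact (Finset.sum_subset hS fun x _ hx => hF x hx).symm
  have h0 : ∀ x i y j, ¬ (x ∈ S ∧ y ∈ S) → padCoeff W g x i y j = 0 := fun x i y j h => dif_neg h
  have h1 : ∀ (ρ σ : S) i j, padCoeff W g ρ i σ j = secondPartial W g ρ i σ j :=
    fun ρ σ i j => dif_pos ⟨ρ.2, σ.2⟩
  simp only [Fintype.sum_prod_type]
  rw [key (fun x => ∑ i, ∑ y : S', ∑ j, (padCoeff W g x i y j : ℂ) * f x i y j) fun x hx => by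
    refine Finset.sum_eq_zero fun i _ => Finset.sum_eq_zero fun y _ => Finset.sum_eq_zero fun j _ => ?_
    rw [h0 _ _ _ _ fun h => hx h.1, Complex.ofReal_zero, zero_mul]]
  refine Finset.sum_congr rfl fun ρ _ => ?_
  rw [Finset.sum_comm]
  rw [key (fun y => ∑ i, ∑ j, (padCoeff W g ρ i y j : ℂ) * f ρ i y j) fun y hy => by
    refine Finset.sum_eq_zero fun i _ => Finset.sum_eq_zero fun j _ => ?_
    rw [h0 _ _ _ _ fun h => hy h.2, Complex.ofReal_zero, zero_mul]]
  simp only [h1]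

theorem exists_padCoeff_sub_le {S : Finset (Space d)} {W : Stencil m S → ℝ} (hW : ContDiff ℝ 3 W)
    (R : ℝ) : ∃ C, 0 ≤ C ∧ ∀ g g' : Stencil m S, ‖g‖ ≤ R → ‖g'‖ ≤ R → ∀ x i y j,
      |padCoeff W g x i y j - padCoeff W g' x i y j| ≤ C * ‖g - g'‖ := by
  obtain ⟨C, hC0, hC⟩ := exists_secondPartial_sub_le hW R
  refine ⟨C, hC0, fun g g' hg hg' x i y j => ?_⟩
  unfold padCoeff
  by_cases h : x ∈ S ∧ y ∈ S
  · rw [dif_pos h, dif_pos h]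
    exact hC g g' hg hg' _ _ _ _
  · rw [dif_neg h, dif_neg h, sub_zero, abs_zero]
    positivity

/-- A version of `exists_padCoeff_sub_le` for potentials that agree up to the name of their
interaction range. -/
theorem padCoeff_sub_le_of_eq {S S' : Finset (Space d)} (h : S = S') {W : Stencil m S → ℝ}
    {W' : Stencil m S' → ℝ} (hW : ∀ g, W' g = W fun ρ => g ⟨ρ.1, h ▸ ρ.2⟩) {C R : ℝ}
    (hC : ∀ g g' : Stencil m S, ‖g‖ ≤ R → ‖g'‖ ≤ R → ∀ x i y j,
      |padCoeff W g x i y j - padCoeff W g' x i y j| ≤ C * ‖g - g'‖)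
    {g g' : Stencil m S'} (hg : ‖g‖ ≤ R) (hg' : ‖g'‖ ≤ R) (x : Space d) (i : Fin m) (y : Space d)
    (j : Fin m) : |padCoeff W' g x i y j - padCoeff W' g' x i y j| ≤ C * ‖g - g'‖ := by
  subst h
  obtain rfl : W' = W := funext hW
  exact hC g g' hg hg' x i y j

theorem padCoeff_zero_of_eq {S S' : Finset (Space d)} (h : S = S') {W : Stencil m S → ℝ}
    {W' : Stencil m S' → ℝ} (hW : ∀ g, W' g = W fun ρ => g ⟨ρ.1, h ▸ ρ.2⟩) :
    padCoeff W' 0 = padCoeff W 0 := by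
  subst h
  obtain rfl : W' = W := funext hW
  rfl

end Pad

/-! ### The Hessian coefficients and their deviation from the homogeneous ones -/

namespace Crystal

variable {d m : ℕ} (M : Crystal d m)

theorem finite_core : {l : M.sites | ‖l.1‖ < M.Rdef}.Finite := by
  refine Set.Finite.of_finite_image ((M.finite_norm_lat_lt M.Rdef).subset ?_)
    M.siteCoord_injective.injOn
  rintro _ ⟨l, hl, rfl⟩
  rwa [Set.mem_ofPred_eq, lat_siteCoord]

/-- All displacements that occur in some interaction range. -/
def displacements : Finset (Space d) :=
  open Classical in M.range ∪ M.finite_core.toFinset.biUnion M.siteRange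

theorem range_subset_displacements : M.range ⊆ M.displacements :=
  open Classical in Finset.subset_union_left

theorem siteRange_subset_displacements (l : M.sites) : M.siteRange l ⊆ M.displacements := by
  classical
  by_cases hl : ‖l.1‖ < M.Rdef
  · exact (Finset.subset_biUnion_of_mem M.siteRange
      (M.finite_core.mem_toFinset.2 hl)).trans Finset.subset_union_right
  · obtain ⟨h, -⟩ := M.homogeneous l (not_lt.1 hl)
    rw [← h]
    exact M.range_subset_displacements

theorem exists_site_of_le {k : Fin d → ℤ} (hk : M.Rdef ≤ ‖M.lat k‖) :
    ∃ l, M.siteCoord l = k :=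
  ⟨⟨M.lat k, M.mem_sites _ (M.lat_mem_bravais k) hk⟩, M.coord_lat k⟩

/-- The coefficients of the Hessian at `u`, indexed by the lattice. -/
def hessianCoeff (u : M.sites → Space m) (k : Fin d → ℤ) (p q : M.displacements × Fin m) : ℝ :=
  open Classical in
  if h : ∃ l, M.siteCoord l = k then
    padCoeff (M.siteV h.choose) (M.diff u h.choose) p.1 p.2 q.1 q.2 else 0

/-- The coefficients of the homogeneous Hessian. -/
def homCoeff (p q : M.displacements × Fin m) : ℝ := padCoeff M.V 0 p.1 p.2 q.1 q.2

theorem hessianCoeff_siteCoord (u : M.sites → Space m) (l : M.sites)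
    (p q : M.displacements × Fin m) : M.hessianCoeff u (M.siteCoord l) p q =
      padCoeff (M.siteV l) (M.diff u l) p.1 p.2 q.1 q.2 := by
  have h : ∃ l', M.siteCoord l' = M.siteCoord l := ⟨l, rfl⟩
  rw [hessianCoeff, dif_pos h, M.siteCoord_injective h.choose_spec]

theorem hessianCoeff_of_notMem (u : M.sites → Space m) {k : Fin d → ℤ}
    (hk : k ∉ Set.range M.siteCoord) (p q : M.displacements × Fin m) :
    M.hessianCoeff u k p q = 0 := dif_neg hk

theorem hessianCoeff_symm (u : M.sites → Space m) (k : Fin d → ℤ)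
    (p q : M.displacements × Fin m) : M.hessianCoeff u k p q = M.hessianCoeff u k q p := by
  by_cases hk : k ∈ Set.range M.siteCoord
  · obtain ⟨l, rfl⟩ := hk
    rw [hessianCoeff_siteCoord, hessianCoeff_siteCoord, padCoeff_symm (M.siteV_smooth l)]
  · rw [hessianCoeff_of_notMem _ _ hk, hessianCoeff_of_notMem _ _ hk]

/-- The size of the deviation from the homogeneous Hessian. -/
def deviation (u : M.sites → Space m) (k : Fin d → ℤ) : ℝ :=
  ∑ p, ∑ q, |M.hessianCoeff u k p q - M.homCoeff p q|

theorem deviation_nonneg (u : M.sites → Space m) (k : Fin d → ℤ) : 0 ≤ M.deviation u k :=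
  Finset.sum_nonneg fun _ _ => Finset.sum_nonneg fun _ _ => abs_nonneg _

theorem abs_sub_le_deviation (u : M.sites → Space m) (k : Fin d → ℤ)
    (p q : M.displacements × Fin m) :
    |M.hessianCoeff u k p q - M.homCoeff p q| ≤ M.deviation u k :=
  (Finset.single_le_sum (f := fun q => |M.hessianCoeff u k p q - M.homCoeff p q|)
    (fun _ _ => abs_nonneg _) (Finset.mem_univ q)).trans
    (Finset.single_le_sum (f := fun p => ∑ q, |M.hessianCoeff u k p q - M.homCoeff p q|)
      (fun _ _ => Finset.sum_nonneg fun _ _ => abs_nonneg _) (Finset.mem_univ p))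

theorem norm_diff_sq_le (u : M.sites → Space m) (l : M.sites) :
    ‖M.diff u l‖ ^ 2 ≤ ∑ ρ : M.siteRange l, ‖M.diff u l ρ‖ ^ 2 := by
  rw [← Real.sqrt_le_sqrt_iff (by positivity), Real.sqrt_sq (norm_nonneg _)]
  refine (pi_norm_le_iff_of_nonneg (Real.sqrt_nonneg _)).2 fun ρ => ?_
  refine Real.le_sqrt_of_sq_le ?_
  exact Finset.single_le_sum (f := fun ρ => ‖M.diff u l ρ‖ ^ 2) (fun _ _ => sq_nonneg _)
    (Finset.mem_univ ρ)

/-- Far from the defect, the Hessian coefficients are Lipschitz in the strain. -/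
theorem exists_hessianCoeff_sub_le (R : ℝ) : ∃ C, 0 ≤ C ∧ ∀ (u u' : M.sites → Space m) (l : M.sites),
    M.Rdef ≤ ‖l.1‖ → ‖M.diff u l‖ ≤ R → ‖M.diff u' l‖ ≤ R → ∀ p q,
      |M.hessianCoeff u (M.siteCoord l) p q - M.hessianCoeff u' (M.siteCoord l) p q| ≤
        C * ‖M.diff u l - M.diff u' l‖ := by
  obtain ⟨C, hC0, hC⟩ := exists_padCoeff_sub_le M.V_smooth R
  refine ⟨C, hC0, fun u u' l hl hu hu' p q => ?_⟩
  obtain ⟨h, hV⟩ := M.homogeneous l hl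
  rw [hessianCoeff_siteCoord, hessianCoeff_siteCoord]
  exact padCoeff_sub_le_of_eq h hV hC hu hu' _ _ _ _

theorem hessianCoeff_zero {l : M.sites} (hl : M.Rdef ≤ ‖l.1‖) (p q : M.displacements × Fin m) :
    M.hessianCoeff 0 (M.siteCoord l) p q = M.homCoeff p q := by
  obtain ⟨h, hV⟩ := M.homogeneous l hl
  have e : M.diff (0 : M.sites → Space m) l = 0 := funext fun ρ => sub_self _
  rw [hessianCoeff_siteCoord, e, homCoeff, padCoeff_zero_of_eq h hV]

theorem diff_zero (l : M.sites) : M.diff (0 : M.sites → Space m) l = 0 :=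
  funext fun _ => sub_self _

theorem FiniteEnergy.norm_diff_le {u : M.sites → Space m} (hu : M.FiniteEnergy u) (l : M.sites) :
    ‖M.diff u l‖ ≤ √(∑' l : M.sites, ∑ ρ : M.siteRange l, ‖M.diff u l ρ‖ ^ 2) :=
  Real.le_sqrt_of_sq_le ((M.norm_diff_sq_le u l).trans
    (hu.le_tsum l fun _ _ => Finset.sum_nonneg fun _ _ => sq_nonneg _))

/-- Outside the core the deviation is Lipschitz in the strain, which is square summable by finite
energy. The core contains finitely many lattice points, so its arbitrary potentials and missing
sites do no harm. -/
theorem summable_deviation_sq {u : M.sites → Space m} (hu : M.FiniteEnergy u) :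
    Summable fun k => M.deviation u k ^ 2 := by
  obtain ⟨C, hC0, hC⟩ := M.exists_hessianCoeff_sub_le
    (√(∑' l : M.sites, ∑ ρ : M.siteRange l, ‖M.diff u l ρ‖ ^ 2))
  obtain ⟨N, hN⟩ : ∃ N : ℝ, N = Fintype.card (M.displacements × Fin m) := ⟨_, rfl⟩
  have hN0 : 0 ≤ N := by rw [hN]; positivity
  have hext : Summable (Function.extend M.siteCoord
      (fun l => ∑ ρ : M.siteRange l, ‖M.diff u l ρ‖ ^ 2) 0) :=
    (summable_extend_zero M.siteCoord_injective).2 hu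
  refine (hext.mul_left ((N * (N * C)) ^ 2)).of_norm_bounded_eventually ?_
  rw [Filter.eventually_cofinite]
  refine (M.finite_norm_lat_lt M.Rdef).subset fun k hk => ?_
  by_contra hk'
  refine hk ?_
  have hk2 : M.Rdef ≤ ‖M.lat k‖ := not_lt.1 hk'
  obtain ⟨l, rfl⟩ := M.exists_site_of_le hk2
  rw [lat_siteCoord] at hk2
  rw [M.siteCoord_injective.extend_apply, Real.norm_of_nonneg (sq_nonneg _)]
  have hdev : M.deviation u (M.siteCoord l) ≤ N * (N * C) * ‖M.diff u l‖ := by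
    have : ∀ p q, |M.hessianCoeff u (M.siteCoord l) p q - M.homCoeff p q| ≤ C * ‖M.diff u l‖ := by
      intro p q
      have := hC u 0 l hk2 (FiniteEnergy.norm_diff_le M hu l)
        (by rw [diff_zero, norm_zero]; positivity) p q
      rwa [M.hessianCoeff_zero hk2, diff_zero, sub_zero] at this
    refine (Finset.sum_le_sum fun p _ => Finset.sum_le_sum fun q _ => this p q).trans (le_of_eq ?_)
    simp only [Finset.sum_const, Finset.card_univ, nsmul_eq_mul, ← hN]
    ring
  refine (pow_le_pow_left₀ (M.deviation_nonneg _ _) hdev 2).trans ?_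
  rw [mul_pow]
  exact mul_le_mul_of_nonneg_left (M.norm_diff_sq_le u l) (by positivity)

end Crystal

/-! ### The conjugated Hessian in the frame -/

namespace Crystal

variable {d m : ℕ} (M : Crystal d m)

theorem coeff_invSqrt_sub (hd : 1 < d) (hstab : M.HomStable)
    (a z : Fin d → ℤ) :
    mFourierCoeff ((M.latticeForm hstab).diffSymbol a) z =
      M.kernel (M.lat (z + a)) - M.kernel (M.lat z) := by
  rw [M.kernel_lat hd hstab, M.kernel_lat hd hstab]
  exact mFourierCoeff_diff ((M.latticeForm hstab).integrable_invSqrt hd) a z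

/-- The frame of finite differences of `F`, starting at the lattice point `k`. -/
def gridFrame (hd : 1 < d) (hstab : M.HomStable)
    (k z : Fin d → ℤ) (i : Fin m) : M.L2 :=
  (M.latticeForm hstab).frame M.siteCoord_injective (zero_lt_one.trans hd) k z i

theorem hasSum_gridFrame (hd : 1 < d) (hstab : M.HomStable)
    (k z : Fin d → ℤ) (i : Fin m) (v : M.L2) :
    HasSum (fun n : M.sites => ((M.kernel (M.lat (k + z) - n.1) - M.kernel (M.lat k - n.1)) (v n)) i)
      (inner ℂ (M.gridFrame hd hstab k z i) v) := by
  refine ((M.latticeForm hstab).hasSum_frame M.siteCoord_injective (zero_lt_one.trans hd)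
    k z i v).congr_fun fun n => ?_
  rw [M.coeff_invSqrt_sub hd hstab, sub_add_eq_add_sub, map_sub, map_sub, lat_siteCoord]

/-- The normalisation `F(-n)` makes `Fv(ℓ)` the difference of the convolution between the origin and
`ℓ`, hence a frame coefficient based at `0`. The lattice point `0` need not be a site. -/
theorem hasSum_applyF (hd : 1 < d) (hstab : M.HomStable)
    (v : M.L2) (l : M.sites) (i : Fin m) :
    HasSum (fun n : M.sites => ((M.kernel (l.1 - n.1) - M.kernel (-n.1)) (v n)) i)
      (inner ℂ (M.gridFrame hd hstab 0 (M.siteCoord l) i) v) := by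
  have h := M.hasSum_gridFrame hd hstab 0 (M.siteCoord l) i v
  simpa only [zero_add, map_zero, zero_sub, lat_siteCoord] using h

theorem summable_applyF (hd : 1 < d) (hstab : M.HomStable)
    (v : M.L2) (l : M.sites) :
    Summable fun n : M.sites => (M.kernel (l.1 - n.1) - M.kernel (-n.1)) (v n) := by
  have h : Summable fun n : M.sites =>
      (EuclideanSpace.equiv (Fin m) ℂ) ((M.kernel (l.1 - n.1) - M.kernel (-n.1)) (v n)) :=
    Pi.summable.2 fun i => (M.hasSum_applyF hd hstab v l i).summable
  exact (ContinuousLinearEquiv.summable (EuclideanSpace.equiv (Fin m) ℂ)).1 h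

theorem applyF_apply (hd : 1 < d) (hstab : M.HomStable)
    (v : M.L2) (l : M.sites) (i : Fin m) :
    M.applyF v l i = inner ℂ (M.gridFrame hd hstab 0 (M.siteCoord l) i) v := by
  rw [← (M.hasSum_applyF hd hstab v l i).tsum_eq, applyF]
  exact (EuclideanSpace.proj (𝕜 := ℂ) i).map_tsum (M.summable_applyF hd hstab v l)

/-- The normalisation cancels in differences, so the Hessian sees `Fv` only through the frame
vectors based at `l`. -/
theorem diff_applyF (hd : 1 < d) (hstab : M.HomStable)
    (v : M.L2) (l : M.sites) (ρ : M.siteRange l) (i : Fin m) :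
    M.diff (M.applyF v) l ρ i =
      inner ℂ (M.gridFrame hd hstab (M.siteCoord l) (M.coord ρ.1) i) v := by
  have h1 := M.hasSum_applyF hd hstab v ⟨l.1 + ρ.1, M.add_mem_sites l ρ.1 ρ.2⟩ i
  have h2 := M.hasSum_applyF hd hstab v l i
  rw [← applyF_apply] at h1 h2
  have h3 := M.hasSum_gridFrame hd hstab (M.siteCoord l) (M.coord ρ.1) i v
  rw [← M.siteCoord_add l ρ.2] at h3
  simp only [lat_siteCoord] at h3
  refine (h1.sub h2).unique (h3.congr_fun fun n => ?_)
  simp only [sub_apply, PiLp.sub_apply]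
  ring

/-- The frame indexed by the displacements of the crystal. -/
def diffFrame (hd : 1 < d) (hstab : M.HomStable)
    (k : Fin d → ℤ) (p : M.displacements × Fin m) : M.L2 :=
  M.gridFrame hd hstab k (M.coord p.1) p.2

theorem hessianForm_applyF (hd : 1 < d) (hstab : M.HomStable)
    (u : M.sites → Space m) (v w : M.L2) (l : M.sites) :
    hessianForm (M.siteV l) (M.diff u l) (M.diff (M.applyF v) l) (M.diff (M.applyF w) l) =
      ∑ p, ∑ q, (M.hessianCoeff u (M.siteCoord l) p q : ℂ) *
        (starRingEnd ℂ (inner ℂ (M.diffFrame hd hstab (M.siteCoord l) p) v) *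
          inner ℂ (M.diffFrame hd hstab (M.siteCoord l) q) w) := by
  simp only [hessianForm, M.diff_applyF hd hstab, hessianCoeff_siteCoord, diffFrame]
  exact (sum_padCoeff_mul (M.siteRange_subset_displacements l) (M.siteV l) (M.diff u l)
    fun x i y j => starRingEnd ℂ (inner ℂ (M.gridFrame hd hstab (M.siteCoord l) (M.coord x) i) v) *
      inner ℂ (M.gridFrame hd hstab (M.siteCoord l) (M.coord y) j) w).symm

theorem isConjHessian_iff (hd : 1 < d) (hstab : M.HomStable)
    (u : M.sites → Space m) (T : M.L2 →L[ℂ] M.L2) :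
    M.IsConjHessian u T ↔ ∀ v w : M.L2, HasSum (fun k => ∑ p, ∑ q, (M.hessianCoeff u k p q : ℂ) *
      (starRingEnd ℂ (inner ℂ (M.diffFrame hd hstab k p) v) *
        inner ℂ (M.diffFrame hd hstab k q) w)) (inner ℂ v (T w)) := by
  refine forall_congr' fun v => forall_congr' fun w => ?_
  rw [← M.siteCoord_injective.hasSum_iff fun k hk => ?_]
  · simp only [hessianForm_applyF _ hd hstab]
    rfl
  · simp only [M.hessianCoeff_of_notMem u hk, Complex.ofReal_zero, zero_mul, Finset.sum_const_zero]

theorem hasSum_homCoeff (hd : 1 < d) (hstab : M.HomStable)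
    (v w : M.L2) :
    HasSum (fun k => ∑ p, ∑ q, (M.homCoeff p q : ℂ) *
      (starRingEnd ℂ (inner ℂ (M.diffFrame hd hstab k p) v) *
        inner ℂ (M.diffFrame hd hstab k q) w)) (inner ℂ v w) := by
  refine ((M.latticeForm hstab).hasSum_frame_form M.siteCoord_injective (zero_lt_one.trans hd)
    v w).congr_fun fun k => ?_
  exact sum_padCoeff_mul M.range_subset_displacements M.V 0
    fun x i y j => starRingEnd ℂ (inner ℂ (M.gridFrame hd hstab k (M.coord x) i) v) *
      inner ℂ (M.gridFrame hd hstab k (M.coord y) j) w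

theorem exists_bessel_diffFrame (hd : 1 < d) (hstab : M.HomStable) :
    ∃ B, 0 ≤ B ∧ ∀ v : M.L2,
    Summable (fun k => coeffSize (M.diffFrame hd hstab) v k ^ 2) ∧
      ∑' k, coeffSize (M.diffFrame hd hstab) v k ^ 2 ≤ B * ‖v‖ ^ 2 := by
  refine exists_bessel_coeffSize fun p => ?_
  obtain ⟨B, hB, h⟩ := (M.latticeForm hstab).exists_sum_norm_inner_frame_sq_le
    M.siteCoord_injective (zero_lt_one.trans hd) (M.coord p.1)
  exact ⟨B, hB, fun v => h p.2 v⟩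

theorem exists_norm_inner_diffFrame_le (hd : 1 < d) (hstab : M.HomStable)
    {s t : ℝ} (hs : 0 < s) (hsd : s < d) (hs3 : s ≤ 3)
    (ht : 0 ≤ t) (hts : t ≤ s) (hst : d < 2 * s - t) :
    ∃ κ, 0 ≤ κ ∧ ∀ k p k' q, ‖inner ℂ (M.diffFrame hd hstab k p) (M.diffFrame hd hstab k' q)‖ ≤
      κ * weight t (k - k') := by
  have h := fun p q : M.displacements × Fin m =>
    (M.latticeForm hstab).exists_norm_inner_frame_le M.siteCoord_injective (zero_lt_one.trans hd)
      hs hsd hs3 ht hts hst (M.coord p.1) (M.coord q.1)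
  choose κ hκ0 hκ using h
  refine ⟨∑ p, ∑ q, κ p q, Finset.sum_nonneg fun p _ => Finset.sum_nonneg fun q _ => hκ0 p q,
    fun k p k' q => (hκ p q k p.2 k' q.2).trans (mul_le_mul_of_nonneg_right ?_ (weight_nonneg _ _))⟩
  exact (Finset.single_le_sum (f := κ p) (fun q _ => hκ0 p q) (Finset.mem_univ q)).trans
    (Finset.single_le_sum (f := fun p => ∑ q, κ p q)
      (fun p _ => Finset.sum_nonneg fun q _ => hκ0 p q) (Finset.mem_univ p))

theorem exists_coeffSize_delta_le (hd : 1 < d) (hstab : M.HomStable)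
    {s : ℝ} (hs : 0 < s) (hsd : s < d) (hs3 : s ≤ 3) :
    ∃ α, 0 ≤ α ∧ ∀ l i k, coeffSize (M.diffFrame hd hstab) (M.delta l i) k ≤
      α * weight s (k - M.siteCoord l) := by
  classical
  have h := fun p : M.displacements × Fin m =>
    (M.latticeForm hstab).exists_norm_mFourierCoeff_diffSymbol_le (zero_lt_one.trans hd) hs hsd hs3
      (M.coord p.1)
  choose c hc0 hc using h
  refine ⟨∑ p, c p, Finset.sum_nonneg fun p _ => hc0 p, fun l i k => ?_⟩
  rw [coeffSize, Finset.sum_mul]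
  refine Finset.sum_le_sum fun p _ => ?_
  have e := (M.latticeForm hstab).inner_frame_single M.siteCoord_injective (zero_lt_one.trans hd)
    k (M.coord p.1) p.2 l (EuclideanSpace.single i (1 : ℂ))
  have e' : inner ℂ (M.diffFrame hd hstab k p) (M.delta l i) =
      (mFourierCoeff ((M.latticeForm hstab).diffSymbol (M.coord p.1)) (k - M.siteCoord l)
        (EuclideanSpace.single i (1 : ℂ))) p.2 := by
    rw [← e, diffFrame, gridFrame, delta]
  rw [e']
  refine (PiLp.norm_apply_le _ _).trans ((ContinuousLinearMap.le_opNorm _ _).trans ?_)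
  rw [PiLp.norm_single, norm_one, mul_one]
  exact hc p _

theorem exists_norm_hessianCoeff_le {u : M.sites → Space m} (hu : M.FiniteEnergy u) :
    ∃ c, 0 ≤ c ∧ ∀ k p q, ‖(M.hessianCoeff u k p q : ℂ)‖ ≤ c := by
  refine ⟨√(∑' k, M.deviation u k ^ 2) + ∑ p, ∑ q, |M.homCoeff p q|, by positivity,
    fun k p q => ?_⟩
  rw [Complex.norm_real, Real.norm_eq_abs]
  have h1 : M.deviation u k ≤ √(∑' k, M.deviation u k ^ 2) :=
    Real.le_sqrt_of_sq_le ((M.summable_deviation_sq hu).le_tsum k fun _ _ => sq_nonneg _)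
  have h2 : |M.homCoeff p q| ≤ ∑ p, ∑ q, |M.homCoeff p q| :=
    (Finset.single_le_sum (f := fun q => |M.homCoeff p q|) (fun _ _ => abs_nonneg _)
      (Finset.mem_univ q)).trans (Finset.single_le_sum (f := fun p => ∑ q, |M.homCoeff p q|)
        (fun _ _ => Finset.sum_nonneg fun _ _ => abs_nonneg _) (Finset.mem_univ p))
  have h3 := M.abs_sub_le_deviation u k p q
  have h4 := abs_add_le (M.hessianCoeff u k p q - M.homCoeff p q) (M.homCoeff p q)
  rw [sub_add_cancel] at h4
  linarith

theorem exists_isConjHessian (hd : 1 < d) (hstab : M.HomStable)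
    {u : M.sites → Space m} (hu : M.FiniteEnergy u) :
    ∃ T, M.IsConjHessian u T := by
  obtain ⟨c, hc0, hc⟩ := M.exists_norm_hessianCoeff_le hu
  obtain ⟨B, hB0, hB⟩ := M.exists_bessel_diffFrame hd hstab
  obtain ⟨T, hT⟩ := exists_operator_of_form hc hB hB0 hc0
  exact ⟨T, (M.isConjHessian_iff hd hstab u T).2 hT⟩

theorem isConjHessian_conjHessian (hd : 1 < d) (hstab : M.HomStable)
    {u : M.sites → Space m} (hu : M.FiniteEnergy u) :
    M.IsConjHessian u (M.conjHessian u) := by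
  have h := M.exists_isConjHessian hd hstab hu
  rw [conjHessian, dif_pos h]
  exact h.choose_spec

theorem hasSum_conjHessian (hd : 1 < d) (hstab : M.HomStable)
    {u : M.sites → Space m} (hu : M.FiniteEnergy u) (v w : M.L2) :
    HasSum (fun k => ∑ p, ∑ q, (M.hessianCoeff u k p q : ℂ) *
      (starRingEnd ℂ (inner ℂ (M.diffFrame hd hstab k p) v) *
        inner ℂ (M.diffFrame hd hstab k q) w)) (inner ℂ v (M.conjHessian u w)) :=
  (M.isConjHessian_iff hd hstab u _).1 (M.isConjHessian_conjHessian hd hstab hu) v w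

theorem isSelfAdjoint_conjHessian (hd : 1 < d) (hstab : M.HomStable)
    {u : M.sites → Space m} (hu : M.FiniteEnergy u) :
    IsSelfAdjoint (M.conjHessian u) :=
  isSelfAdjoint_of_form (fun k p q => by rw [Complex.conj_ofReal, M.hessianCoeff_symm])
    (M.hasSum_conjHessian hd hstab hu)

/-- The homogeneous form is summed over the full lattice and equals the identity on `ℓ²(Λ)` even if
`Λ` lacks lattice points. Subtracting it leaves the square summable deviation as coefficient. -/
theorem isLatticePerturbation (hd : 1 < d) (hstab : M.HomStable)
    {u : M.sites → Space m} (hu : M.FiniteEnergy u) {t κ : ℝ}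
    (ht : (d : ℝ) < 2 * t) (hκ0 : 0 ≤ κ)
    (hκ : ∀ k p k' q, ‖inner ℂ (M.diffFrame hd hstab k p) (M.diffFrame hd hstab k' q)‖ ≤
      κ * weight t (k - k')) :
    IsLatticePerturbation (M.diffFrame hd hstab)
      (fun k p q => ((M.hessianCoeff u k p q - M.homCoeff p q : ℝ) : ℂ)) (M.deviation u) κ t
      (M.conjHessian u - 1) where
  exponent := ht
  gram := hκ
  gram_nonneg := hκ0
  coeff k p q := by
    rw [Complex.norm_real, Real.norm_eq_abs]
    exact M.abs_sub_le_deviation u k p q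
  coeff_nonneg := M.deviation_nonneg u
  summable := M.summable_deviation_sq hu
  form v w := by
    have h := (M.hasSum_conjHessian hd hstab hu v w).sub (M.hasSum_homCoeff hd hstab v w)
    rw [sub_apply, one_apply_eq_self, inner_sub_right]
    refine h.congr_fun fun k => ?_
    simp only [← Finset.sum_sub_distrib, Complex.ofReal_sub, sub_mul]
  selfAdjoint := (M.isSelfAdjoint_conjHessian hd hstab hu).sub (IsSelfAdjoint.one _)

end Crystal

end SiteEntropy

namespace SiteEntropy

open MeasureTheory

/-! ### Lattice points in thin spherical shells -/

section Shell

theorem pow_sub_pow_le {d : ℕ} (hd : d = 2 ∨ d = 3) {r σ : ℝ} (hσ : 0 ≤ σ) (hr : σ ≤ r) :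
    (r + σ) ^ d - (r - σ) ^ d ≤ 8 * σ * r ^ (d - 1) := by
  have h0 : 0 ≤ r := hσ.trans hr
  rcases hd with rfl | rfl
  · have : 0 ≤ σ * r := by positivity
    norm_num
    linarith
  · have h1 : σ ^ 2 * σ ≤ r ^ 2 * σ := mul_le_mul_of_nonneg_right (pow_le_pow_left₀ hσ hr 2) hσ
    norm_num
    linarith

variable {d : ℕ}

/-- The number of points in a shell of width `2σ` of a family of points with mutual distances
`2ε`. -/
theorem card_shell_le (hd : d = 2 ∨ d = 3) {κ : Type*} (x : κ → Space d) {ε σ : ℝ} (hε : 0 < ε)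
    (hσ : 0 ≤ σ) (hx : ∀ i j, i ≠ j → 2 * ε ≤ ‖x i - x j‖) (y : Space d) {r : ℝ} (hr : σ + ε ≤ r)
    (F : Finset κ) (hF : ∀ i ∈ F, r - σ ≤ ‖x i - y‖ ∧ ‖x i - y‖ < r + σ) :
    (F.card : ℝ) ≤ 8 * (σ + ε) / ε ^ d * r ^ (d - 1) := by
  have : Nontrivial (Space d) := by
    have : Nonempty (Fin d) := ⟨⟨0, by omega⟩⟩
    infer_instance
  let μ : Measure (Space d) := volume
  have hfin : Module.finrank ℝ (Space d) = d := finrank_euclideanSpace_fin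
  have hball : ∀ (z : Space d) {ρ : ℝ}, 0 ≤ ρ →
      μ.real (Metric.ball z ρ) = ρ ^ d * μ.real (Metric.ball 0 1) := by
    intro z ρ hρ
    have := Measure.addHaar_ball μ z hρ
    rw [hfin] at this
    rw [Measure.real, this, ENNReal.toReal_mul, ENNReal.toReal_ofReal (by positivity)]
    rfl
  have h1 : 0 < μ.real (Metric.ball (0 : Space d) 1) :=
    ENNReal.toReal_pos (Metric.measure_ball_pos μ 0 one_pos).ne' measure_ball_lt_top.ne
  have hdisj : Set.PairwiseDisjoint (F : Set κ) fun i => Metric.ball (x i) ε := by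
    intro i _ j _ hij
    refine Metric.ball_disjoint_ball ?_
    rw [dist_eq_norm]
    linarith [hx i j hij]
  have hunion : μ.real (⋃ i ∈ F, Metric.ball (x i) ε) =
      F.card * (ε ^ d * μ.real (Metric.ball 0 1)) := by
    rw [measureReal_biUnion_finset hdisj (fun _ _ => Metric.isOpen_ball.measurableSet)
      (fun _ _ => measure_ball_lt_top.ne)]
    simp only [hball _ hε.le, Finset.sum_const, nsmul_eq_mul]
  -- Volume comparison: the disjoint balls lie in the shell thickened by `ε` on either side.
  have hsub : (⋃ i ∈ F, Metric.ball (x i) ε) ⊆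
      Metric.ball y (r + (σ + ε)) \ Metric.ball y (r - (σ + ε)) := by
    intro w hw
    simp only [Set.mem_iUnion, exists_prop] at hw
    obtain ⟨i, hi, hw⟩ := hw
    obtain ⟨h2, h3⟩ := hF i hi
    rw [mem_ball_iff_norm] at hw
    rw [Set.mem_sdiff, mem_ball_iff_norm, mem_ball_iff_norm, not_lt]
    have e : w - y = (w - x i) + (x i - y) := by abel
    have h4 := norm_add_le (w - x i) (x i - y)
    have h5 := norm_sub_norm_le (x i - y) (x i - w)
    rw [norm_sub_rev (x i) w, sub_sub_sub_cancel_left] at h5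
    rw [← e] at h4
    constructor <;> linarith
  have hle : μ.real (⋃ i ∈ F, Metric.ball (x i) ε) ≤
      (r + (σ + ε)) ^ d * μ.real (Metric.ball 0 1) - (r - (σ + ε)) ^ d * μ.real (Metric.ball 0 1) := by
    refine (measureReal_mono hsub
      (measure_ne_top_of_subset Set.sdiff_subset measure_ball_lt_top.ne)).trans ?_
    rw [measureReal_sdiff (Metric.ball_subset_ball (by linarith)) Metric.isOpen_ball.measurableSet,
      hball y (by linarith : 0 ≤ r + (σ + ε)), hball y (by linarith : 0 ≤ r - (σ + ε))]
  rw [hunion, ← sub_mul, ← mul_assoc] at hle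
  have h6 := (le_of_mul_le_mul_right hle h1).trans (pow_sub_pow_le hd (by linarith) hr)
  rw [div_mul_eq_mul_div, le_div_iff₀ (by positivity)]
  exact h6

end Shell

/-! ### The spectral point `1` -/

namespace Crystal

variable {d m : ℕ} (M : Crystal d m)

theorem infinite_sites (hd : 0 < d) : Infinite M.sites := by
  have : Nonempty (Fin d) := ⟨⟨0, hd⟩⟩
  have hfin := M.finite_norm_lat_lt M.Rdef
  have hinf : {z | ‖M.lat z‖ < M.Rdef}ᶜ.Infinite := hfin.infinite_compl
  refine Set.infinite_range_iff M.siteCoord_injective |>.1 (hinf.mono fun k hk => ?_)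
  exact M.exists_site_of_le (not_lt.1 hk)

theorem norm_delta (l : M.sites) (i : Fin m) : ‖M.delta l i‖ = 1 := by
  rw [delta, lp.norm_single (by norm_num), PiLp.norm_single, norm_one]

/-- The homogeneous Hessian contributes the point `1` to the (essential) spectrum. -/
theorem one_mem_spectrum (hd : d = 2 ∨ d = 3) (hstab : M.HomStable) (i : Fin m)
    {u : M.sites → Space m} (hu : M.FiniteEnergy u) : (1 : ℂ) ∈ spectrum ℂ (M.conjHessian u) := by
  classical
  have hd1 : 1 < d := by omega
  have hdR : (2 : ℝ) ≤ d := by exact_mod_cast (by omega : 2 ≤ d)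
  have hd3 : (d : ℝ) ≤ 3 := by exact_mod_cast (by omega : d ≤ 3)
  -- The exponents give `2 s - t = d + 1 / 8 > d`, as the Gram estimate requires, together with `t ≤
  -- s < d ≤ 3`.
  obtain ⟨κ, hκ0, hκ⟩ := M.exists_norm_inner_diffFrame_le hd1 hstab (s := d - 1 / 16)
    (t := d - 1 / 4) (by linarith) (by linarith) (by linarith) (by linarith) (by linarith)
    (by linarith)
  have hK := M.isLatticePerturbation hd1 hstab hu (t := d - 1 / 4) (by linarith) hκ0 hκ
  obtain ⟨α, hα0, hα⟩ := M.exists_coeffSize_delta_le hd1 hstab (s := d - 1 / 4) (by linarith)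
    (by linarith) (by linarith)
  obtain ⟨B, hB0, hB⟩ := M.exists_bessel_diffFrame hd1 hstab
  obtain ⟨s, hs⟩ : ∃ s : ℝ, s = d - 1 / 4 := ⟨_, rfl⟩
  rw [← hs] at hK hα
  have hs2 := hK.exponent
  obtain ⟨W, hW⟩ : ∃ W, W = ∑' k : Fin d → ℤ, weight (2 * s) k := ⟨_, rfl⟩
  have hw2 : ∀ k y : Fin d → ℤ, weight s (k - y) ^ 2 ≤ 1 := fun k y =>
    pow_le_one₀ (weight_nonneg _ _) (weight_le_one (by linarith) _)
  have hsum : ∀ y : Fin d → ℤ, Summable fun k => M.deviation u k ^ 2 * weight s (k - y) ^ 2 :=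
    fun y => hK.summable.of_nonneg_of_le (fun k => by positivity) fun k =>
      mul_le_of_le_one_right (sq_nonneg _) (hw2 k y)
  have hle : ∀ l k, (M.deviation u k * coeffSize (M.diffFrame hd1 hstab) (M.delta l i) k) ^ 2 ≤
      α ^ 2 * (M.deviation u k ^ 2 * weight s (k - M.siteCoord l) ^ 2) := fun l k => by
    have := pow_le_pow_left₀ (coeffSize_nonneg _ _ _) (hα l i k) 2
    rw [mul_pow] at this ⊢
    have := mul_le_mul_of_nonneg_left this (sq_nonneg (M.deviation u k))
    linarith
  have hsum' := fun l => ((hsum (M.siteCoord l)).mul_left (α ^ 2)).of_nonneg_of_le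
    (fun k => sq_nonneg _) (hle l)
  have hdelta : ∀ l, ‖(M.conjHessian u - 1) (M.delta l i)‖ ^ 2 ≤
      B * α ^ 2 * ∑' k, M.deviation u k ^ 2 * weight s (k - M.siteCoord l) ^ 2 := by
    intro l
    refine (norm_apply_sq_le hB0 hB hK.coeff_nonneg hK.coeff hK.form (hsum' l)).trans ?_
    rw [mul_assoc, ← tsum_mul_left (a := α ^ 2)]
    exact mul_le_mul_of_nonneg_left ((hsum' l).tsum_le_tsum (hle l) ((hsum _).mul_left _)) hB0
  -- Otherwise `T(u) - 1` would be bounded below, in particular uniformly on the unit vectors `δ_l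
  -- e_i`. But `hdelta` makes the sum over `l` of the squared norms of their images finite, while
  -- there are infinitely many sites.
  by_contra h1
  rw [spectrum.notMem_iff, map_one, ← neg_sub, IsUnit.neg_iff] at h1
  obtain ⟨J, hJ⟩ := h1.exists_left_inv
  have hone : ∀ l, 1 ≤ ‖J‖ ^ 2 * ‖(M.conjHessian u - 1) (M.delta l i)‖ ^ 2 := fun l => by
    have e : J ((M.conjHessian u - 1) (M.delta l i)) = M.delta l i :=
      congrArg (fun Q : M.L2 →L[ℂ] M.L2 => Q (M.delta l i)) hJ
    have := J.le_opNorm ((M.conjHessian u - 1) (M.delta l i))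
    rw [e, norm_delta] at this
    rw [← mul_pow]
    exact one_le_pow₀ this
  obtain ⟨N, hN⟩ := exists_nat_gt (‖J‖ ^ 2 * (B * α ^ 2 * ((∑' k, M.deviation u k ^ 2) * W)))
  have := M.infinite_sites (by omega)
  obtain ⟨F, hF⟩ := Infinite.exists_subset_card_eq M.sites N
  have hwF : ∀ k : Fin d → ℤ, ∑ l ∈ F, weight s (k - M.siteCoord l) ^ 2 ≤ W := by
    intro k
    rw [hW, ← tsum_weight_sq k]
    have := (summable_weight_sq hs2 k).sum_le_tsum (F.image M.siteCoord) fun _ _ => sq_nonneg _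
    rw [Finset.sum_image M.siteCoord_injective.injOn] at this
    refine le_trans (le_of_eq (Finset.sum_congr rfl fun l _ => ?_)) this
    rw [weight_sub_comm]
  have htot : ∑ l ∈ F, ∑' k, M.deviation u k ^ 2 * weight s (k - M.siteCoord l) ^ 2 ≤
      (∑' k, M.deviation u k ^ 2) * W := by
    rw [← Summable.tsum_finsetSum fun l _ => hsum (M.siteCoord l), ← tsum_mul_right]
    refine (summable_sum fun l _ => hsum (M.siteCoord l)).tsum_le_tsum (fun k => ?_)
      (hK.summable.mul_right W)
    rw [← Finset.mul_sum]
    exact mul_le_mul_of_nonneg_left (hwF k) (sq_nonneg _)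
  have hc : (N : ℝ) ≤ ∑ l ∈ F, ‖J‖ ^ 2 * ‖(M.conjHessian u - 1) (M.delta l i)‖ ^ 2 := by
    rw [← hF, Finset.card_eq_sum_ones, Nat.cast_sum]
    exact Finset.sum_le_sum fun l _ => by simpa using hone l
  refine hN.not_ge (hc.trans ?_)
  rw [← Finset.mul_sum]
  refine mul_le_mul_of_nonneg_left ?_ (sq_nonneg _)
  refine (Finset.sum_le_sum fun l _ => hdelta l).trans ?_
  rw [← Finset.mul_sum]
  exact mul_le_mul_of_nonneg_left htot (by positivity)

end Crystal

theorem one_le_norm_of_ne_zero {d : ℕ} {z : Fin d → ℤ} (hz : z ≠ 0) : 1 ≤ ‖z‖ := by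
  obtain ⟨i, hi⟩ := Function.ne_iff.1 hz
  refine le_trans ?_ (norm_le_pi_norm z i)
  rw [Int.norm_eq_abs]
  exact_mod_cast Int.one_le_abs hi

theorem weight_le_rpow {E : Type*} [SeminormedAddCommGroup E] {q c r : ℝ} (hq : 0 ≤ q) (hc : 0 < c)
    (hr : 0 < r) {x : E} (h : r ≤ c * ‖x‖) : weight q x ≤ c ^ q * r ^ (-q) := by
  have h1 : c ^ q * r ^ (-q) = (r / c) ^ (-q) := by
    rw [Real.div_rpow hr.le hc.le, Real.rpow_neg hc.le, div_inv_eq_mul, mul_comm]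
  rw [h1]
  refine Real.rpow_le_rpow_of_nonpos (by positivity) ?_ (by linarith)
  rw [div_le_iff₀ hc]
  linarith

/-! ### Weighted sums over shells and exterior domains -/

namespace Crystal

variable {d m : ℕ} (M : Crystal d m)

/-- Coefficients supported in a thin shell, or square summable and supported in an exterior domain,
are small when tested against the weight at the centre. -/
theorem exists_tsum_shell_le (hd : d = 2 ∨ d = 3) {σ C : ℝ} (hσ : 0 ≤ σ) (hC : 0 ≤ C)
    {g : (Fin d → ℤ) → ℝ} (hg : ∀ k, 0 ≤ g k) (hg2 : Summable fun k => g k ^ 2) :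
    ∃ K r₁ : ℝ, 0 ≤ K ∧ 1 ≤ r₁ ∧ ∀ r, r₁ ≤ r → ∀ (y : Fin d → ℤ) (e : (Fin d → ℤ) → ℝ),
      (∀ k, 0 ≤ e k) → (∀ k, ‖M.lat (k - y)‖ < r - σ → e k = 0) →
      (∀ k, ‖M.lat (k - y)‖ < r + σ → e k ≤ C) → (∀ k, r + σ ≤ ‖M.lat (k - y)‖ → e k ≤ g k) →
      (Summable fun k => e k * weight (d - 1 / 4) (k - y) ^ 2) ∧
        ∑' k, e k * weight (d - 1 / 4) (k - y) ^ 2 ≤ K * r ^ (-(d + 1 / 4 : ℝ)) := by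
  classical
  have hdR : (2 : ℝ) ≤ d := by exact_mod_cast (by omega : 2 ≤ d)
  obtain ⟨c, hc, hlat⟩ := M.exists_norm_lat_le
  obtain ⟨ε, hε⟩ : ∃ ε, ε = 1 / (2 * c) := ⟨_, rfl⟩
  have hε0 : 0 < ε := by rw [hε]; positivity
  have hsep : ∀ i j, i ≠ j → 2 * ε ≤ ‖M.lat i - M.lat j‖ := by
    intro i j hij
    have h1 := (one_le_norm_of_ne_zero (sub_ne_zero.2 hij)).trans (hlat (i - j)).2
    have e : 2 * ε = 1 / c := by rw [hε]; field_simp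
    rw [← map_sub, e, div_le_iff₀ hc]
    linarith
  obtain ⟨s, hs⟩ : ∃ s : ℝ, s = d - 1 / 4 := ⟨_, rfl⟩
  obtain ⟨q, hq⟩ : ∃ q : ℝ, q = d + 1 / 4 := ⟨_, rfl⟩
  obtain ⟨G, hG⟩ : ∃ G, G = √(∑' k, g k ^ 2) * √(∑' k : Fin d → ℤ, weight (2 * (d - 3 / 4)) k) :=
    ⟨_, rfl⟩
  have hG0 : 0 ≤ G := by rw [hG]; positivity
  rw [← hs, ← hq]
  refine ⟨8 * (σ + ε) / ε ^ d * C * (2 * c) ^ (2 * s) + (2 * c) ^ q * G,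
    max 1 (2 * (σ + ε)), by positivity, le_max_left _ _, ?_⟩
  intro r hr y e he0 he1 he2 he3
  have hr1 : 1 ≤ r := (le_max_left _ _).trans hr
  have hrσ : 2 * (σ + ε) ≤ r := (le_max_right _ _).trans hr
  have hr0 : 0 < r := by linarith
  have hfar : ∀ k, r - σ ≤ ‖M.lat (k - y)‖ → r ≤ 2 * c * ‖k - y‖ := fun k hk => by
    have := (hlat (k - y)).1
    linarith
  have hfin : {k | ‖M.lat (k - y)‖ < r + σ}.Finite := by
    refine Set.Finite.of_finite_image ((M.finite_norm_lat_lt (r + σ)).subset ?_)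
      (f := fun k => k - y) (sub_left_injective.injOn)
    rintro _ ⟨k, hk, rfl⟩
    exact hk
  let F : Finset (Fin d → ℤ) := hfin.toFinset.filter fun k => r - σ ≤ ‖M.lat (k - y)‖
  have hF : ∀ k, k ∈ F ↔ ‖M.lat (k - y)‖ < r + σ ∧ r - σ ≤ ‖M.lat (k - y)‖ := fun k => by
    simp [F]
  have hcard : (F.card : ℝ) ≤ 8 * (σ + ε) / ε ^ d * r ^ (d - 1) :=
    card_shell_le hd M.lat hε0 hσ hsep (M.lat y) (by linarith) F fun k hk => by
      rw [← map_sub]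
      exact ⟨((hF k).1 hk).2, ((hF k).1 hk).1⟩
  have hsq : ∀ k, weight s (k - y) ^ 2 = weight (2 * s) (k - y) := fun k => by
    rw [sq, weight_mul_weight, two_mul]
  -- In the shell only the bound `C` and the number of points are used. Farther out, the exponent is
  -- split as `2 s = q + (d - 3/4)`: the first part gives the rate, and the second is a square
  -- summable weight that is paired with `g` by Cauchy-Schwarz.
  have hmain : ∀ k, e k * weight s (k - y) ^ 2 ≤
      (if k ∈ F then C * ((2 * c) ^ (2 * s) * r ^ (-(2 * s))) else 0) +
        (2 * c) ^ q * r ^ (-q) * (g k * weight (d - 3 / 4) (k - y)) := by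
    intro k
    have h2 : 0 ≤ (2 * c) ^ q * r ^ (-q) * (g k * weight (d - 3 / 4) (k - y)) :=
      mul_nonneg (by positivity) (mul_nonneg (hg k) (weight_nonneg _ _))
    have h1 : (0 : ℝ) ≤ if k ∈ F then C * ((2 * c) ^ (2 * s) * r ^ (-(2 * s))) else 0 := by
      split_ifs <;> positivity
    rw [hsq]
    rcases lt_or_ge ‖M.lat (k - y)‖ (r - σ) with h | h
    · rw [he1 k h, zero_mul]
      positivity
    rcases lt_or_ge ‖M.lat (k - y)‖ (r + σ) with h' | h'
    · rw [if_pos ((hF k).2 ⟨h', h⟩)]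
      have := mul_le_mul (he2 k h') (weight_le_rpow (q := 2 * s) (by linarith)
        (by positivity : 0 < 2 * c) hr0 (hfar k h)) (weight_nonneg _ _) hC
      linarith
    · have e1 : weight (2 * s) (k - y) = weight q (k - y) * weight (d - 3 / 4) (k - y) := by
        rw [weight_mul_weight]
        congr 1
        rw [hs, hq]
        ring
      have := mul_le_mul (he3 k h') (mul_le_mul_of_nonneg_right (weight_le_rpow (q := q)
        (by linarith) (by positivity : 0 < 2 * c) hr0 (hfar k h))
        (weight_nonneg (d - 3 / 4 : ℝ) (k - y)))
        (mul_nonneg (weight_nonneg _ _) (weight_nonneg _ _)) (hg k)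
      rw [e1]
      linarith
  obtain ⟨c1, c2⟩ := summable_mul_and_tsum_mul_le_sqrt hg
    (fun k => weight_nonneg (d - 3 / 4 : ℝ) (k - y)) hg2
    (summable_weight_sq (by linarith : (d : ℝ) < 2 * (d - 3 / 4)) y)
  rw [tsum_weight_sq, ← hG] at c2
  have hs1 : HasSum (fun k => if k ∈ F then C * ((2 * c) ^ (2 * s) * r ^ (-(2 * s))) else 0)
      (F.card * (C * ((2 * c) ^ (2 * s) * r ^ (-(2 * s))))) := by
    have := hasSum_sum_of_ne_finset_zero (s := F) (L := SummationFilter.unconditional _)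
      (f := fun k => if k ∈ F then C * ((2 * c) ^ (2 * s) * r ^ (-(2 * s))) else 0)
      fun k hk => if_neg hk
    convert this using 1
    rw [Finset.sum_congr rfl fun k hk => if_pos hk, Finset.sum_const, nsmul_eq_mul]
  have hs2 := c1.mul_left ((2 * c) ^ q * r ^ (-q))
  have hsum : Summable fun k => e k * weight s (k - y) ^ 2 :=
    (hs1.summable.add hs2).of_nonneg_of_le (fun k => mul_nonneg (he0 k) (sq_nonneg _)) hmain
  refine ⟨hsum, (hsum.tsum_le_tsum hmain (hs1.summable.add hs2)).trans ?_⟩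
  rw [hs1.summable.tsum_add hs2, hs1.tsum_eq, tsum_mul_left, add_mul]
  -- The shell contributes `r^{-(d + 1/2)}`, better than needed; the rate `q = d + 1/4` is set by
  -- the exterior.
  have hrr : r ^ (d - 1) * r ^ (-(2 * s)) ≤ r ^ (-q) := by
    rw [← Real.rpow_natCast, ← Real.rpow_add hr0]
    refine Real.rpow_le_rpow_of_exponent_le hr1 ?_
    rw [Nat.cast_sub (by omega), Nat.cast_one, hs, hq]
    linarith
  refine add_le_add ?_ ?_
  · calc F.card * (C * ((2 * c) ^ (2 * s) * r ^ (-(2 * s))))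
        ≤ 8 * (σ + ε) / ε ^ d * r ^ (d - 1) * (C * ((2 * c) ^ (2 * s) * r ^ (-(2 * s)))) :=
          mul_le_mul_of_nonneg_right hcard (by positivity)
      _ = 8 * (σ + ε) / ε ^ d * C * (2 * c) ^ (2 * s) * (r ^ (d - 1) * r ^ (-(2 * s))) := by ring
      _ ≤ _ := mul_le_mul_of_nonneg_left hrr (by positivity)
  · have := mul_le_mul_of_nonneg_left c2 (by positivity : 0 ≤ (2 * c) ^ q * r ^ (-q))
    linarith

/-- The size of the difference of the Hessians at `u` and `w`. -/
def hessianDist (u w : M.sites → Space m) (k : Fin d → ℤ) : ℝ :=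
  ∑ p, ∑ q, |M.hessianCoeff u k p q - M.hessianCoeff w k p q|

theorem hessianDist_nonneg (u w : M.sites → Space m) (k : Fin d → ℤ) : 0 ≤ M.hessianDist u w k :=
  Finset.sum_nonneg fun _ _ => Finset.sum_nonneg fun _ _ => abs_nonneg _

theorem abs_sub_le_hessianDist (u w : M.sites → Space m) (k : Fin d → ℤ)
    (p q : M.displacements × Fin m) :
    |M.hessianCoeff u k p q - M.hessianCoeff w k p q| ≤ M.hessianDist u w k :=
  (Finset.single_le_sum (f := fun q => |M.hessianCoeff u k p q - M.hessianCoeff w k p q|)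
    (fun _ _ => abs_nonneg _) (Finset.mem_univ q)).trans
    (Finset.single_le_sum
      (f := fun p => ∑ q, |M.hessianCoeff u k p q - M.hessianCoeff w k p q|)
      (fun _ _ => Finset.sum_nonneg fun _ _ => abs_nonneg _) (Finset.mem_univ p))

theorem hessianDist_triangle (u v w : M.sites → Space m) (k : Fin d → ℤ) :
    M.hessianDist u w k ≤ M.hessianDist u v k + M.hessianDist w v k := by
  simp only [hessianDist, ← Finset.sum_add_distrib]
  refine Finset.sum_le_sum fun p _ => Finset.sum_le_sum fun q _ => ?_
  rw [abs_sub_comm (M.hessianCoeff w k p q)]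
  exact abs_sub_le _ _ _

theorem hessianDist_congr {u w u' w' : M.sites → Space m} {l : M.sites}
    (h : M.diff u l = M.diff u' l) (h' : M.diff w l = M.diff w' l) :
    M.hessianDist u w (M.siteCoord l) = M.hessianDist u' w' (M.siteCoord l) := by
  simp only [hessianDist, hessianCoeff_siteCoord, h, h']

theorem hessianDist_self (u : M.sites → Space m) (k : Fin d → ℤ) : M.hessianDist u u k = 0 := by
  simp [hessianDist]

theorem hessianDist_of_notMem (u w : M.sites → Space m) {k : Fin d → ℤ}
    (hk : k ∉ Set.range M.siteCoord) : M.hessianDist u w k = 0 := by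
  simp [hessianDist, M.hessianCoeff_of_notMem _ hk]

theorem finiteEnergy_zero : M.FiniteEnergy 0 := by
  simp [FiniteEnergy, diff_zero, summable_zero]

theorem summable_hessianDist_zero_sq {u : M.sites → Space m} (hu : M.FiniteEnergy u) :
    Summable fun k => M.hessianDist u 0 k ^ 2 := by
  have h := ((M.summable_deviation_sq hu).add (M.summable_deviation_sq M.finiteEnergy_zero)).mul_left 2
  refine h.of_nonneg_of_le (fun k => sq_nonneg _) fun k => ?_
  have h1 : M.hessianDist u 0 k ≤ M.deviation u k + M.deviation 0 k := by
    simp only [hessianDist, deviation, ← Finset.sum_add_distrib]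
    refine Finset.sum_le_sum fun p _ => Finset.sum_le_sum fun q _ => ?_
    rw [abs_sub_comm (M.hessianCoeff 0 k p q)]
    exact abs_sub_le _ _ _
  exact (pow_le_pow_left₀ (M.hessianDist_nonneg u 0 k) h1 2).trans add_sq_le

/-- Bounded strains have bounded Hessians. -/
theorem exists_hessianDist_zero_le {R : ℝ} (hR : 0 ≤ R) : ∃ C, 0 ≤ C ∧
    ∀ (u : M.sites → Space m) (k : Fin d → ℤ), (∀ l, ‖M.diff u l‖ ≤ R) →
      M.hessianDist u 0 k ≤ C := by
  obtain ⟨C, hC0, hC⟩ := M.exists_hessianCoeff_sub_le R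
  choose D hD0 hD using fun l => exists_padCoeff_sub_le (M.siteV_smooth l) R
  obtain ⟨S, hS⟩ : ∃ S, S = ∑ l ∈ M.finite_core.toFinset, D l := ⟨_, rfl⟩
  have hS0 : 0 ≤ S := by rw [hS]; exact Finset.sum_nonneg fun l _ => hD0 l
  refine ⟨∑ _ : M.displacements × Fin m, ∑ _ : M.displacements × Fin m, (C + S) * R,
    by positivity, fun u k hu => ?_⟩
  by_cases hk : k ∈ Set.range M.siteCoord
  · obtain ⟨l, rfl⟩ := hk
    refine Finset.sum_le_sum fun p _ => Finset.sum_le_sum fun q _ => ?_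
    have h0 : ‖M.diff (0 : M.sites → Space m) l‖ ≤ R := by rwa [diff_zero, norm_zero]
    rcases lt_or_ge ‖l.1‖ M.Rdef with h | h
    · have h1 := hD l (M.diff u l) (M.diff 0 l) (hu l) h0 p.1 p.2 q.1 q.2
      rw [← hessianCoeff_siteCoord, ← hessianCoeff_siteCoord, diff_zero, sub_zero] at h1
      refine h1.trans (mul_le_mul ?_ (hu l) (norm_nonneg _) (by positivity))
      have := Finset.single_le_sum (f := D) (fun l _ => hD0 l) (M.finite_core.mem_toFinset.2 h)
      rw [← hS] at this
      linarith
    · have h1 := hC u 0 l h (hu l) h0 p q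
      rw [diff_zero, sub_zero] at h1
      exact h1.trans (mul_le_mul (by linarith) (hu l) (norm_nonneg _) (by positivity))
  · rw [M.hessianDist_of_notMem _ _ hk]
    positivity

/-! ### Truncation -/

theorem norm_diff_le {u : M.sites → Space m} {U : ℝ} (hU : 0 ≤ U) (hu : ∀ k, ‖u k‖ ≤ U)
    (l : M.sites) : ‖M.diff u l‖ ≤ 2 * U := by
  refine (pi_norm_le_iff_of_nonneg (by positivity)).2 fun ρ => ?_
  refine (norm_sub_le _ _).trans ?_
  linarith [hu l, hu ⟨l.1 + ρ.1, M.add_mem_sites l ρ.1 ρ.2⟩]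

theorem norm_truncate_le {u : M.sites → Space m} {U : ℝ} (hU : 0 ≤ U) (hu : ∀ k, ‖u k‖ ≤ U)
    (r : ℝ) (l k : M.sites) : ‖M.truncate r l u k‖ ≤ U := by
  rw [truncate]
  split_ifs
  · exact hu k
  · rwa [norm_zero]

theorem exists_norm_displacement_le : ∃ σ : ℝ, 0 ≤ σ ∧ ∀ ρ ∈ M.displacements, ‖ρ‖ ≤ σ :=
  ⟨∑ ρ ∈ M.displacements, ‖ρ‖, by positivity, fun _ hρ =>
    Finset.single_le_sum (f := fun ρ => ‖ρ‖) (fun _ _ => norm_nonneg _) hρ⟩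

theorem diff_truncate_of_lt (u : M.sites → Space m) {σ r : ℝ} (hσ0 : 0 ≤ σ)
    (hσ : ∀ ρ ∈ M.displacements, ‖ρ‖ ≤ σ) {l k : M.sites} (h : ‖k.1 - l.1‖ < r - σ) :
    M.diff (M.truncate r l u) k = M.diff u k := by
  funext ρ
  have hρ := hσ ρ.1 (M.siteRange_subset_displacements k ρ.2)
  have h1 : k.1 ∈ Metric.ball l.1 r := by
    rw [mem_ball_iff_norm]
    linarith
  have h2 : k.1 + ρ.1 ∈ Metric.ball l.1 r := by
    rw [mem_ball_iff_norm, add_sub_right_comm]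
    linarith [norm_add_le (k.1 - l.1) ρ.1]
  simp only [diff, truncate, if_pos h1, if_pos h2]

theorem diff_truncate_of_ge (u : M.sites → Space m) {σ r : ℝ} (hσ0 : 0 ≤ σ)
    (hσ : ∀ ρ ∈ M.displacements, ‖ρ‖ ≤ σ) {l k : M.sites} (h : r + σ ≤ ‖k.1 - l.1‖) :
    M.diff (M.truncate r l u) k = M.diff 0 k := by
  funext ρ
  have hρ := hσ ρ.1 (M.siteRange_subset_displacements k ρ.2)
  have h1 : k.1 ∉ Metric.ball l.1 r := by
    rw [mem_ball_iff_norm, not_lt]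
    linarith
  have h2 : k.1 + ρ.1 ∉ Metric.ball l.1 r := by
    rw [mem_ball_iff_norm, not_lt, add_sub_right_comm]
    have := norm_sub_le (k.1 - l.1 + ρ.1) ρ.1
    rw [add_sub_cancel_right] at this
    linarith
  simp only [diff, truncate, if_neg h1, if_neg h2, Pi.zero_apply]

/-- The weighted difference of the Hessians at `u` and at its truncation. -/
theorem exists_tsum_hessianDist_truncate_le (hd : d = 2 ∨ d = 3) {u : M.sites → Space m}
    (hu : M.FiniteEnergy u) {U : ℝ} (hU : 0 ≤ U) (huU : ∀ k, ‖u k‖ ≤ U) :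
    ∃ K r₁ E : ℝ, 0 ≤ K ∧ 1 ≤ r₁ ∧ ∀ r, r₁ ≤ r → ∀ l : M.sites,
      (∀ k, M.hessianDist u (M.truncate r l u) k ≤ E) ∧
      (Summable fun k => M.hessianDist u (M.truncate r l u) k *
        weight (d - 1 / 4) (k - M.siteCoord l) ^ 2) ∧
      ∑' k, M.hessianDist u (M.truncate r l u) k * weight (d - 1 / 4) (k - M.siteCoord l) ^ 2 ≤
        K * r ^ (-(d + 1 / 4 : ℝ)) := by
  obtain ⟨C, hC0, hC⟩ := M.exists_hessianDist_zero_le (R := 2 * U) (by positivity)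
  obtain ⟨σ, hσ0, hσ⟩ := M.exists_norm_displacement_le
  obtain ⟨K, r₁, hK, hr₁, h⟩ := M.exists_tsum_shell_le hd hσ0 (by positivity : 0 ≤ C + C)
    (M.hessianDist_nonneg u 0) (M.summable_hessianDist_zero_sq hu)
  have hbd : ∀ r l k, M.hessianDist u (M.truncate r l u) k ≤ C + C := fun r l k =>
    (M.hessianDist_triangle u 0 _ k).trans (add_le_add (hC u k (M.norm_diff_le hU huU))
      (hC _ k (M.norm_diff_le hU (M.norm_truncate_le hU huU r l))))
  refine ⟨K, r₁, C + C, hK, hr₁, fun r hr l => ⟨hbd r l, ?_⟩⟩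
  -- Within `r - σ` of the centre no stencil notices the truncation. Beyond `r + σ` the truncated
  -- strain vanishes, and the distance to the Hessian at `0` is square summable.
  refine h r hr (M.siteCoord l) _ (M.hessianDist_nonneg _ _) (fun k hk => ?_)
    (fun k _ => hbd r l k) fun k hk => ?_
  · by_cases hks : k ∈ Set.range M.siteCoord
    · obtain ⟨n, rfl⟩ := hks
      rw [map_sub, lat_siteCoord, lat_siteCoord] at hk
      rw [M.hessianDist_congr rfl (M.diff_truncate_of_lt u hσ0 hσ hk), hessianDist_self]
    · exact M.hessianDist_of_notMem _ _ hks
  · by_cases hks : k ∈ Set.range M.siteCoord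
    · obtain ⟨n, rfl⟩ := hks
      rw [map_sub, lat_siteCoord, lat_siteCoord] at hk
      rw [M.hessianDist_congr rfl (M.diff_truncate_of_ge u hσ0 hσ hk)]
    · rw [M.hessianDist_of_notMem _ _ hks]
      exact M.hessianDist_nonneg _ _ _

end Crystal

theorem adjoint_resolvent {H : Type*} [NormedAddCommGroup H] [InnerProductSpace ℂ H]
    [CompleteSpace H] {T : H →L[ℂ] H} (hT : IsSelfAdjoint T) (z : ℂ) :
    ContinuousLinearMap.adjoint (resolvent T z) = resolvent T (starRingEnd ℂ z) := by
  have h : star (algebraMap ℂ (H →L[ℂ] H) z - T) =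
      algebraMap ℂ (H →L[ℂ] H) (starRingEnd ℂ z) - T := by
    rw [star_sub, hT.star_eq, ← algebraMap_star_comm]
    rfl
  rw [← ContinuousLinearMap.star_eq_adjoint, resolvent, resolvent, ← h]
  exact (Ring.inverse_star _).symm

theorem conj_mem_sphere {a r : ℝ} {z : ℂ} (hz : z ∈ Metric.sphere (a : ℂ) r) :
    starRingEnd ℂ z ∈ Metric.sphere (a : ℂ) r := by
  rw [mem_sphere_iff_norm] at hz ⊢
  rw [← hz, ← Complex.conj_ofReal a, ← map_sub, RCLike.norm_conj, Complex.conj_ofReal]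

/-! ### The truncation error of the site entropy -/

namespace Crystal

variable {d m : ℕ} (M : Crystal d m)

theorem exists_coeffSize_resolvent_delta_le (hd : d = 2 ∨ d = 3) (hd1 : 1 < d)
    (hstab : M.HomStable) {a b : ℝ} (ha : 0 < a) {u : M.sites → Space m}
    (hu : M.Admissible a b u) :
    ∃ A, 0 ≤ A ∧ ∀ z ∈ Metric.sphere (((a + b) / 2 : ℝ) : ℂ) (b / 2), ∀ l i k,
      coeffSize (M.diffFrame hd1 hstab) (resolvent (M.conjHessian u) z (M.delta l i)) k ≤
        A * weight (d - 1 / 4) (k - M.siteCoord l) := by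
  -- For `m = 0` there are no vectors `δ_l e_i`, and `one_mem_spectrum` needs a component.
  rcases Nat.eq_zero_or_pos m with rfl | hm
  · exact ⟨0, le_rfl, fun z _ l i => i.elim0⟩
  have hdR : (2 : ℝ) ≤ d := by exact_mod_cast (by omega : 2 ≤ d)
  have hd3 : (d : ℝ) ≤ 3 := by exact_mod_cast (by omega : d ≤ 3)
  obtain ⟨κ, hκ0, hκ⟩ := M.exists_norm_inner_diffFrame_le hd1 hstab (s := d - 1 / 16)
    (t := d - 1 / 4) (by linarith) (by linarith) (by linarith) (by linarith) (by linarith)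
    (by linarith)
  have hK := M.isLatticePerturbation hd1 hstab hu.1 (t := d - 1 / 4) (by linarith) hκ0 hκ
  obtain ⟨α, hα0, hα⟩ := M.exists_coeffSize_delta_le hd1 hstab (s := d - 1 / 4) (by linarith)
    (by linarith) (by linarith)
  obtain ⟨A, hA0, hA⟩ := hK.exists_resolvent_decay (ρ := 2 / a) (by positivity) hα0
  refine ⟨A, hA0, fun z hz l i k => ?_⟩
  have hsa := M.isSelfAdjoint_conjHessian hd1 hstab hu.1
  obtain ⟨hz1, hz2⟩ := norm_resolvent_le_of_mem_sphere hsa ha hu.2 hz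
  -- Admissibility puts the spectral point `1` into `[a, b]`, so the contour stays at distance `a /
  -- 2` from it and `ζ = z - 1` is bounded away from `0`.
  have hone : (1 : ℝ) ∈ Set.Icc a b := hu.2 1
    (by exact_mod_cast M.one_mem_spectrum hd hstab ⟨0, hm⟩ hu.1) one_pos
  have hζ := half_le_norm_sub_of_mem_sphere hz fun _ => hone
  rw [Complex.ofReal_one] at hζ
  have hζ0 : 0 < ‖z - 1‖ := by linarith
  refine hA (z - 1) (resolvent (M.conjHessian u) z) (norm_pos_iff.1 hζ0) ?_ hz2 (fun x => ?_)
    (fun x => ?_) (M.delta l i) (M.siteCoord l) (hα l i) k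
  · rw [norm_inv, ← inv_div]
    exact inv_anti₀ (by positivity) hζ
  · rw [sub_apply, one_apply_eq_self, sub_smul, one_smul, sub_sub_sub_cancel_right]
    exact (resolvent_apply hz1 x).1
  · rw [sub_apply, one_apply_eq_self, sub_smul, one_smul, map_sub, sub_sub_sub_cancel_right]
    exact (resolvent_apply hz1 x).2

/-- The truncation error of the site entropy decays faster than `r^{-d}`. -/
theorem exists_siteEntropy_sub_le (hd : d = 2 ∨ d = 3) (hstab : M.HomStable) {a b : ℝ} (ha : 0 < a)
    (hab : a < b) {u : M.sites → Space m} (hu : M.Admissible a b u) {U : ℝ} (hU : 0 ≤ U)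
    (huU : ∀ k, ‖u k‖ ≤ U) :
    ∃ K r₁ : ℝ, 0 ≤ K ∧ 1 ≤ r₁ ∧ ∀ r, r₁ ≤ r → ∀ l, M.Admissible a b (M.truncate r l u) →
      |M.siteEntropy a b u l - M.truncatedSiteEntropy a b r u l| ≤
        K * r ^ (-(d + 1 / 4 : ℝ)) := by
  have hd1 : 1 < d := by omega
  obtain ⟨A, hA0, hA⟩ := M.exists_coeffSize_resolvent_delta_le hd hd1 hstab ha hu
  obtain ⟨B, hB0, hB⟩ := M.exists_bessel_diffFrame hd1 hstab
  obtain ⟨Q, hQ0, hQ⟩ := exists_norm_inner_log_sub_le (H := M.L2) ha hab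
  obtain ⟨K, r₁, E, hK0, hr₁, h⟩ := M.exists_tsum_hessianDist_truncate_le hd hu.1 hU huU
  have hE0 : 0 ≤ E ∨ IsEmpty M.sites := by
    by_cases hne : Nonempty M.sites
    · obtain ⟨l⟩ := hne
      exact Or.inl ((M.hessianDist_nonneg _ _ _).trans ((h r₁ le_rfl l).1 0))
    · exact Or.inr (not_nonempty_iff.1 hne)
  rcases hE0 with hE0 | hempty
  swap
  · exact ⟨0, 1, le_rfl, le_rfl, fun r _ l => (hempty.false l).elim⟩
  obtain ⟨P, hP⟩ : ∃ P, P = A ^ 2 + 2 / a * (B * (E * A ^ 2)) := ⟨_, rfl⟩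
  have hP0 : 0 ≤ P := by rw [hP]; positivity
  refine ⟨1 / 2 * (m * (Q * (P * K))), r₁, by positivity, hr₁, fun r hr l hw => ?_⟩
  obtain ⟨hE, hsum, hle⟩ := h r hr l
  have hsa := M.isSelfAdjoint_conjHessian hd1 hstab hu.1
  have hsa' := M.isSelfAdjoint_conjHessian hd1 hstab hw.1
  have hΔ : ∀ v w : M.L2, HasSum (fun k => ∑ p, ∑ q,
      ((M.hessianCoeff u k p q - M.hessianCoeff (M.truncate r l u) k p q : ℝ) : ℂ) *
      (starRingEnd ℂ (inner ℂ (M.diffFrame hd1 hstab k p) v) *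
        inner ℂ (M.diffFrame hd1 hstab k q) w))
      (inner ℂ v ((M.conjHessian u - M.conjHessian (M.truncate r l u)) w)) := by
    intro v w
    have h := (M.hasSum_conjHessian hd1 hstab hu.1 v w).sub
      (M.hasSum_conjHessian hd1 hstab hw.1 v w)
    rw [sub_apply, inner_sub_right]
    refine h.congr_fun fun k => ?_
    simp only [← Finset.sum_sub_distrib, Complex.ofReal_sub, sub_mul]
  have hterm : ∀ i, ‖inner ℂ (M.delta l i) (M.logPlus a b (M.conjHessian u) (M.delta l i)) -
      inner ℂ (M.delta l i)
        (M.logPlus a b (M.conjHessian (M.truncate r l u)) (M.delta l i))‖ ≤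
      Q * (P * (K * r ^ (-(d + 1 / 4 : ℝ)))) := by
    intro i
    refine hQ _ _ _ _ fun z hz => ?_
    obtain ⟨h1, -⟩ := norm_resolvent_le_of_mem_sphere hsa ha hu.2 hz
    obtain ⟨h2, h2'⟩ := norm_resolvent_le_of_mem_sphere hsa' ha hw.2 hz
    refine ⟨h1, h2, ?_⟩
    -- The decay constant `A` belongs to the fixed `u`. The truncation enters only through the norm
    -- `2 / a` of its resolvent, so the estimate is uniform in `r` and `l`.
    refine (norm_inner_resolvent_sub_le hB0 hB (M.hessianDist_nonneg u (M.truncate r l u)) hE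
      (fun k p q => ?_) hsa hsa' hΔ (fun x => (resolvent_apply h1 x).1)
      (fun x => (resolvent_apply h1 x).2) (fun x => (resolvent_apply h2 x).1)
      (fun x => (resolvent_apply h2 x).2) h2' hA0 hsum (hA z hz l i) fun k => ?_).trans ?_
    · rw [Complex.norm_real, Real.norm_eq_abs]
      exact M.abs_sub_le_hessianDist _ _ k p q
    · rw [adjoint_resolvent hsa]
      exact hA _ (conj_mem_sphere hz) l i k
    · rw [← hP]
      exact mul_le_mul_of_nonneg_left hle hP0
  rw [truncatedSiteEntropy, siteEntropy, siteEntropy, ← mul_sub, ← Complex.sub_re,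
    ← Finset.sum_sub_distrib, abs_mul]
  have h1 : |(-(1 / 2) : ℝ)| = 1 / 2 := by norm_num
  rw [h1, mul_assoc]
  refine mul_le_mul_of_nonneg_left ?_ (by norm_num)
  refine (Complex.abs_re_le_norm _).trans ((norm_sum_le _ _).trans
    ((Finset.sum_le_sum fun i _ => hterm i).trans (le_of_eq ?_)))
  rw [Finset.sum_const, Finset.card_univ, Fintype.card_fin, nsmul_eq_mul]
  ring

end Crystal

end SiteEntropy

end

theorem theorem3p2 {d m : ℕ} (hd : d = 2 ∨ d = 3) (M : SiteEntropy.Crystal d m)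
    (hstab : M.HomStable) (a b : ℝ) (ha : 0 < a) (hab : a < b) :
    -- the operators `F` and `F* H(u) F` are well defined
    (MeasureTheory.IntegrableOn M.symbolInvSqrt M.brillouin ∧
      (∀ (v : M.L2) (l : M.sites), Summable fun n : M.sites =>
        (M.kernel (l.1 - n.1) - M.kernel (-n.1)) (v n)) ∧
      ∀ u : M.sites → SiteEntropy.Space m, M.FiniteEnergy u →
        ∃ T : M.L2 →L[ℂ] M.L2, M.IsConjHessian u T) ∧
    -- the truncation estimate
    ∃ C₃ : ℝ, 0 < C₃ ∧
      ∀ u : M.sites → SiteEntropy.Space m, M.Admissible a b u →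
        BddAbove (Set.range fun k => ‖u k‖) →
        ∃ r₀ : ℝ, 0 < r₀ ∧ ∀ r : ℝ, r₀ ≤ r → ∀ l : M.sites,
          M.Admissible a b (M.truncate r l u) →
            |M.siteEntropy a b u l - M.truncatedSiteEntropy a b r u l| ≤
              C₃ * r ^ (-(d : ℤ)) * ⨆ k, ‖u k‖ := by
  have hd1 : 1 < d := by omega
  -- The constant `C₃ = 1` is possible because the threshold may depend on `u` and the proven rate
  -- is strictly better than `r^{-d}`.
  refine ⟨⟨M.integrableOn_symbolInvSqrt hd1 hstab, M.summable_applyF hd1 hstab,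
    fun u hu => M.exists_isConjHessian hd1 hstab hu⟩, 1, one_pos, fun u hu hbdd => ?_⟩
  have huU : ∀ k, ‖u k‖ ≤ ⨆ k, ‖u k‖ := fun k => le_ciSup hbdd k
  obtain ⟨U, hU⟩ : ∃ U, U = ⨆ k, ‖u k‖ := ⟨_, rfl⟩
  rw [← hU] at huU ⊢
  have hU0 : 0 ≤ U := hU ▸ Real.iSup_nonneg fun k => norm_nonneg _
  -- If the supremum is `0`, the right-hand side leaves nothing to absorb `K`; but then `u = 0` and
  -- truncation does not change it.
  rcases hU0.eq_or_lt with h0 | hpos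
  · have hu0 : u = 0 := funext fun k => by
      have := huU k
      rw [← h0] at this
      exact norm_le_zero_iff.1 this
    refine ⟨1, one_pos, fun r _ l _ => ?_⟩
    have e : M.truncate r l u = u := by
      rw [hu0]
      funext k
      simp [SiteEntropy.Crystal.truncate]
    rw [SiteEntropy.Crystal.truncatedSiteEntropy, e, sub_self, abs_zero, ← h0, mul_zero]
  · obtain ⟨K, r₁, hK0, hr₁, h⟩ := M.exists_siteEntropy_sub_le hd hstab ha hab hu hU0 huU
    -- From `(K / U) ^ 4` on, `r ^ (1 / 4)` exceeds `K / U`, so that `K * r ^ (-1 / 4) ≤ U`.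
    refine ⟨max r₁ ((K / U) ^ 4), lt_max_of_lt_left (by linarith), fun r hr l hw => ?_⟩
    have hr1 : r₁ ≤ r := (le_max_left _ _).trans hr
    have hrK : (K / U) ^ 4 ≤ r := (le_max_right _ _).trans hr
    have hr0 : 0 < r := by linarith
    refine (h r hr1 l hw).trans ?_
    have e1 : r ^ (-(d + 1 / 4 : ℝ)) = r ^ (-(d : ℤ)) * (r ^ (1 / 4 : ℝ))⁻¹ := by
      rw [neg_add, Real.rpow_add hr0, Real.rpow_neg hr0.le (1 / 4), zpow_neg, zpow_natCast,
        Real.rpow_neg hr0.le, Real.rpow_natCast]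
    have e2 : K / U ≤ r ^ (1 / 4 : ℝ) := by
      have := Real.rpow_le_rpow (by positivity) hrK (by norm_num : (0 : ℝ) ≤ 1 / 4)
      rwa [← Real.rpow_natCast, ← Real.rpow_mul (by positivity), Nat.cast_ofNat,
        show (4 : ℝ) * (1 / 4) = 1 by norm_num, Real.rpow_one] at this
    have e3 : K * (r ^ (1 / 4 : ℝ))⁻¹ ≤ U := by
      rw [← div_eq_mul_inv, div_le_iff₀ (by positivity)]
      rw [div_le_iff₀ hpos] at e2
      linarith
    rw [e1, one_mul, mul_left_comm]
    exact mul_le_mul_of_nonneg_left e3 (by positivity)
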